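/- Let $m,d\in\mathbb N$ (with $m\ge 1$). \textbf{Univariate functions.} Let $N_1=\chi_{[0,1)}$ and $N_{r+1}(x)=\int_0^1N_r(x-t)\,dt$ be the cardinal B-splines, and let $$\psi_m(x)=\frac1{2^{m-1}}\sum_{l=0}^{2m-2}(-1)^lN_{2m}(l+1)N_{2m}^{(m)}(2x-l)$$ be the Chui--Wang wavelet of order $m$. Let $\psi_m^*=\sum_{n\in\mathbb Z}a^{(m)}_n\psi_m(\cdot-n)$ be its dual wavelet, i.e. $\langle\psi_m^*,\psi_m(\cdot-k)\rangle=\delta_{k,0}$ for $k\in\mathbb Z$; explicitly, $(a^{(m)}_n)_n$ is the sequence of Fourier coefficients of the reciprocal of $\sum_k\langle\psi_m,\psi_m(\cdot-k)\rangle e^{ik\theta}$. Let $L^{2m}(x)=\sum_{n\in\mathbb Z}c_nN_{2m}(x+m-n)$ be the cardinal spline function, $L^{2m}(k)=\delta_{k,0}$ for $k\in\mathbb Z$, where $(c_n)_n$ is the sequence of Fourier coefficients of the reciprocal of $\sum_kN_{2m}(m+k)e^{ik\theta}$. For $k\in\mathbb Z$ put $s_{2m;-1,k}(x)=L^{2m}(x-k)$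 and, for $j\in\mathbb N_0$, $$s_{2m;j,k}(x)=2^{mj}\int_{-\infty}^x\frac{\psi_m^*(2^jt-k)}{(m-1)!}(x-t)^{m-1}\,dt .$$ \textbf{Tensor Faber spline expansion.} For $\boldsymbol j\in\{-1,0,1,\dots\}^d$ and $\boldsymbol k\in\mathbb Z^d$ let $\boldsymbol s_{2m;\boldsymbol j,\boldsymbol k}(\boldsymbol x)=\prod_{i=1}^ds_{2m;j_i,k_i}(x_i)$ and $e(\boldsymbol j)=\{i: j_i\ge0\}$, and for $f$ on $\mathbb R^d$ let $$\lambda_{2m;\boldsymbol j,\boldsymbol k}(f)=\sum_{\boldsymbol l\in\{0,\dots,2m-2\}^d}\Big(\prod_{i\in e(\boldsymbol j)}(-1)^{m+l_i}\Big)\Big(\prod_{i=1}^dN_{2m}(l_i+1)\Big)\Big(\prod_{i\in e(\boldsymbol j)}\Delta^{2m,i}_{2^{-j_i-1}}\Big)f(\boldsymbol x_{\boldsymbol j;\boldsymbol k,\boldsymbol l}),$$ where $\Delta^{2m,i}_h$ is the $2m$-th iterate of $\Delta^{1,i}_hg(\boldsymbol x)=g(\boldsymbol x+h\boldsymbol e_i)-g(\boldsymbol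 x)$ and $\boldsymbol x_{\boldsymbol j;\boldsymbol k,\boldsymbol l}$ has the coordinates $k_i$ if $j_i=-1$ and $(2k_i+l_i)/2^{j_i+1}$ if $j_i\ge0$. For $N\in\mathbb N$ let $$\boldsymbol S_N^mf=\sum_{|\boldsymbol j|_\infty<N}\ \sum_{\boldsymbol k\in\mathbb Z^d}\lambda_{2m;\boldsymbol j,\boldsymbol k}(f)\,\boldsymbol s_{2m;\boldsymbol j,\boldsymbol k}.$$ \textbf{Theorem.} For every continuous, compactly supported (real- or complex-valued) function $f$ on $\mathbb R^d$, the partial sums $\boldsymbol S_N^mf$ converge to $f$ uniformly on $\mathbb R^d$: $$\lim_{N\to\infty}\|f-\boldsymbol S_N^mf\|_\infty=0 .$$ -/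

import Mathlib

open MeasureTheory Filter Topology

noncomputable section

namespace FaberSpline

/-- The cardinal B-spline `N_r` of order `r ≥ 1` with knots at the integers:
`N_1` is the indicator function of `[0,1)` and `N_{r+1}(x) = ∫_0^1 N_r(x - t) dt`.
(The value for `r = 0` is never used.) -/
def bspline : ℕ → ℝ → ℝ
  | 0 => 0
  | 1 => Set.indicator (Set.Ico 0 1) 1
  | (r + 2) => fun x => ∫ t in (0 : ℝ)..1, bspline (r + 1) (x - t)

/-- The Chui–Wang wavelet of order `m`,
`ψ_m(x) = 2^{-(m-1)} ∑_{l=0}^{2m-2} (-1)^l N_{2m}(l+1) N_{2m}^{(m)}(2x - l)`. -/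
def chuiWang (m : ℕ) (x : ℝ) : ℝ :=
  1 / 2 ^ (m - 1) *
    ∑ l ∈ Finset.range (2 * m - 1),
      (-1) ^ l * bspline (2 * m) ((l : ℝ) + 1) * iteratedDeriv m (bspline (2 * m)) (2 * x - l)

/-- The inverse, with respect to convolution on `ℤ`, of a finitely supported sequence `b` whose
symbol `∑_k b_k e^{ikθ}` has no zero: the sequence of the Fourier coefficients
`(2π)⁻¹ ∫_0^{2π} e^{-inθ} / (∑_k b_k e^{ikθ}) dθ` of the reciprocal symbol
(these are real numbers because `b` is real). -/
def convInverse (b : ℤ → ℝ) (n : ℤ) : ℝ :=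
  (1 / (2 * (Real.pi : ℂ)) *
    ∫ θ in (0 : ℝ)..(2 * Real.pi),
      Complex.exp (-(Complex.I * n * θ)) /
        ∑' k : ℤ, (b k : ℂ) * Complex.exp (Complex.I * k * θ)).re

/-- The coefficients `a_n^{(m)}` of the dual wavelet: the convolution inverse of the Gram sequence
`k ↦ ⟨ψ_m, ψ_m(· - k)⟩`. -/
def dualCoeff (m : ℕ) : ℤ → ℝ :=
  convInverse fun k => ∫ x : ℝ, chuiWang m x * chuiWang m (x - k)

/-- The dual wavelet `ψ_m^* = ∑_n a_n^{(m)} ψ_m(· - n)`, i.e. the element of the wavelet space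
`W_0` with `⟨ψ_m^*, ψ_m(· - k)⟩ = δ_{k,0}` for all integers `k`
(for each `x` only finitely many terms of the series are nonzero). -/
def dualWavelet (m : ℕ) (x : ℝ) : ℝ :=
  ∑' n : ℤ, dualCoeff m n * chuiWang m (x - n)

/-- The coefficients `c_n^{(r)}` of the cardinal spline function `L^r`: the convolution inverse of
the sequence `k ↦ N_r(k + r/2)`. -/
def cardinalCoeff (r : ℕ) : ℤ → ℝ :=
  convInverse fun k => bspline r ((k : ℝ) + (r : ℝ) / 2)

/-- The cardinal spline function `L^r(x) = ∑_n c_n^{(r)} N_r(x + r/2 - n)`, for which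
`L^r(k) = δ_{k,0}` for all integers `k`. -/
def cardinalSpline (r : ℕ) (x : ℝ) : ℝ :=
  ∑' n : ℤ, cardinalCoeff r n * bspline r (x + (r : ℝ) / 2 - n)

/-- The univariate Faber splines of order `2m`, for a level `j ∈ {-1, 0, 1, …}` and `k ∈ ℤ`:
`s_{2m;-1,k}(x) = L^{2m}(x - k)` and, for `j ≥ 0`,
`s_{2m;j,k}(x) = 2^{mj} ∫_{-∞}^x ψ_m^*(2^j t - k) / (m-1)! * (x - t)^{m-1} dt`. -/
def faberSpline (m : ℕ) (j k : ℤ) (x : ℝ) : ℝ :=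
  if j = -1 then cardinalSpline (2 * m) (x - k)
  else (2 : ℝ) ^ ((m : ℤ) * j) *
    ∫ t in Set.Iic x,
      dualWavelet m ((2 : ℝ) ^ j * t - k) / ((m - 1).factorial : ℝ) * (x - t) ^ (m - 1)

/-- The tensor product Faber splines. -/
def tensorFaberSpline {d : ℕ} (m : ℕ) (j k : Fin d → ℤ) (x : Fin d → ℝ) : ℝ :=
  ∏ i, faberSpline m (j i) (k i) (x i)

/-- The set `e(j)` of the directions `i` with `j_i ≥ 0`. -/
def activeDirs {d : ℕ} (j : Fin d → ℤ) : Finset (Fin d) :=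
  Finset.univ.filter fun i => 0 ≤ j i

/-- The mixed difference `Δ_h^{M,e} f = (∏_{i ∈ e} Δ_{h_i}^{M,i}) f`, where `Δ_{h_i}^{M,i}` is the
`M`-th iterate of the forward difference `g ↦ g(· + h_i e_i) - g`. The operators for different
directions commute; they are applied one after the other. -/
def mixedDiff {d : ℕ} {E : Type*} [AddCommGroup E] (M : ℕ) (e : Finset (Fin d)) (h : Fin d → ℝ)
    (f : (Fin d → ℝ) → E) : (Fin d → ℝ) → E :=
  (List.finRange d).foldr
    (fun i g => if i ∈ e then (fwdDiff (Pi.single i (h i) : Fin d → ℝ))^[M] g else g) f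

/-- The sampling node `x_{j;k,l}`: it is `k` for `j = -1` and `(2k + l) / 2^{j+1}` for `j ≥ 0`. -/
def node (j k : ℤ) (l : ℕ) : ℝ :=
  if j = -1 then (k : ℝ) else (2 * (k : ℝ) + l) / (2 : ℝ) ^ (j + 1)

/-- The Faber spline coefficients
`λ_{2m;j,k}(f) = ∑_l (∏_{i ∈ e(j)} (-1)^{m + l_i}) (∏_i N_{2m}(l_i + 1))
  (Δ^{2m,e(j)}_{2^{-j-1}} f)(x_{j;k,l})`,
the sum being over all `l` with `0 ≤ l_i ≤ 2m - 2`. -/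
def faberCoeff {d : ℕ} {E : Type*} [AddCommGroup E] [Module ℝ E] (m : ℕ) (j k : Fin d → ℤ)
    (f : (Fin d → ℝ) → E) : E :=
  ∑ l ∈ Fintype.piFinset fun _ : Fin d => Finset.range (2 * m - 1),
    ((∏ i ∈ activeDirs j, (-1 : ℝ) ^ (m + l i)) * ∏ i, bspline (2 * m) ((l i : ℝ) + 1)) •
      mixedDiff (2 * m) (activeDirs j) (fun i => (2 : ℝ) ^ (-j i - 1)) f
        (fun i => node (j i) (k i) (l i))

/-- The levels `j ∈ {-1, 0, 1, …}^d` with `|j|_∞ < N`. -/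
def levels (d N : ℕ) : Finset (Fin d → ℤ) :=
  Fintype.piFinset fun _ => (Finset.Icc (-1 : ℤ) N).filter fun a => |a| < N

/-- The partial sum
`S_N^m f = ∑_{|j|_∞ < N} ∑_{k ∈ ℤ^d} λ_{2m;j,k}(f) s_{2m;j,k}`
of the tensor Faber spline expansion. If `f` has compact support, then for each `j` only finitely
many of the coefficients are nonzero. -/
def partialSum {d : ℕ} {E : Type*} [NormedAddCommGroup E] [NormedSpace ℝ E] (m N : ℕ)
    (f : (Fin d → ℝ) → E) (x : Fin d → ℝ) : E :=
  ∑ j ∈ levels d N, ∑' k : Fin d → ℤ, tensorFaberSpline m j k x • faberCoeff m j k f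

end FaberSpline

end

open scoped ContDiff

namespace FaberSpline

/-! ### Cardinal B-splines -/

/-! Over the box of levels |j|_∞ < N (N ≥ 2) the expansion telescopes: S_N f is the tensor cardinal
spline interpolant ∑_p f(2^{-N} p) ∏_i L(2^N x_i - p_i), L = L^{2m} (`partialSum_eq`). Convergence
is then the usual argument for a localised approximation scheme. The sums ∑_p |L(t - p)| are bounded
with uniformly small tails, and ∑_p L(t - p) = 1, so f(x) - S_N f(x) is a weighted sum of the
differences f(x) - f(2^{-N} p); uniform continuity handles p near 2^N x and the tails handle the
rest (`norm_sub_partialSum_le`).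

The telescoping is one-dimensional. Write u ⋆ φ = ∑_n u_n φ(· - n), E_k = N_{2m}(m + k), c for the
convolution inverse of E, and b(x) = L(2x - 2m + 1). The symbol of E is the integral over a period
of |Z|², where Z is the Zak transform of N_m, and is never zero (`symbol_samples_ne_zero`); so its
reciprocal is smooth and c decays faster than any power. The Gram sequence of ψ_m factors as E ⋆ R
with R_k = ∑_j (-1)^j E_j E_{2k-j} (`integral_wavelet_mul_wavelet`), and the m-fold integral of ψ_m
is a multiple of R ⋆ b (`waveletPrimitive_eq`). Passing to the dual wavelet cancels E ⋆ R, so the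
Faber spline s of level 0 satisfies E ⋆ s = κ b with κ = (-1)^{m+1} 2^{-(2m-1)}
(`conv_samples_faberBase`). Together with the refinement of N_{2m} this gives L(y) - L(2y) = κ^{-1}
(O ⋆ s)(y + m - 1), where O consists of the samples of the centered B-spline at the odd multiples of
1/2 (`cardinalSpline_sub`).

By the two-scale relation the coefficients of a point mass are half-integer samples of N_{2m} up to
sign and scale. Hence level j contributes to a point mass exactly the difference of its interpolants
of mesh 2^{-j-1} and 2^{-j} (`tsum_univariateCoeff_mul_faberSpline`). Coefficients of level below N
see only the values on 2^{-N} ℤ^d, where f is a finite combination of products of point masses, and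
for these everything factorises over the coordinates. -/

theorem bspline_one : bspline 1 = Set.indicator (Set.Ico 0 1) 1 := rfl

theorem bspline_succ' {r : ℕ} (hr : 1 ≤ r) (x : ℝ) :
    bspline (r + 1) x = ∫ t in (0 : ℝ)..1, bspline r (x - t) := by
  obtain ⟨r, rfl⟩ := Nat.exists_eq_add_of_le' hr
  rfl

theorem bspline_succ {r : ℕ} (hr : 1 ≤ r) (x : ℝ) :
    bspline (r + 1) x = ∫ t in (x - 1)..x, bspline r t := by
  rw [bspline_succ' hr, intervalIntegral.integral_comp_sub_left, sub_zero]

/-- The two claims are proved together because the inductive step needs the B-spline of lower order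
to be integrable, which uses both. -/
theorem bspline_measurable_and_bounds {r : ℕ} (hr : 1 ≤ r) :
    Measurable (bspline r) ∧ ∀ x, 0 ≤ bspline r x ∧ bspline r x ≤ 1 := by
  induction r, hr using Nat.le_induction with
  | base =>
    rw [bspline_one]
    refine ⟨measurable_one.indicator measurableSet_Ico, fun x => ?_⟩
    by_cases hx : x ∈ Set.Ico (0 : ℝ) 1 <;> simp [hx]
  | succ r hr ih =>
    obtain ⟨hm, hb⟩ := ih
    have hint : ∀ a b : ℝ, IntervalIntegrable (bspline r) volume a b := fun a b =>
      (intervalIntegrable_const (c := (1 : ℝ))).mono_fun hm.aestronglyMeasurable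
        (ae_of_all _ fun x => by
          simpa [abs_of_nonneg (hb x).1] using (hb x).2)
    constructor
    · have h1 : bspline (r + 1) =
          fun x => (∫ t in (0 : ℝ)..x, bspline r t) - ∫ t in (0 : ℝ)..(x - 1), bspline r t := by
        funext x
        rw [bspline_succ hr, intervalIntegral.integral_interval_sub_left (hint _ _) (hint _ _)]
      have h2 := intervalIntegral.continuous_primitive hint 0
      rw [h1]
      exact (h2.sub (h2.comp (continuous_id.sub continuous_const))).measurable
    · intro x
      rw [bspline_succ hr]
      refine ⟨intervalIntegral.integral_nonneg (by linarith) fun t _ => (hb t).1, ?_⟩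
      calc _ ≤ ∫ t in (x - 1)..x, (1 : ℝ) :=
            intervalIntegral.integral_mono_on (by linarith) (hint _ _)
              intervalIntegrable_const fun t _ => (hb t).2
        _ = 1 := by simp

theorem measurable_bspline {r : ℕ} (hr : 1 ≤ r) : Measurable (bspline r) :=
  (bspline_measurable_and_bounds hr).1

theorem bspline_nonneg {r : ℕ} (hr : 1 ≤ r) (x : ℝ) : 0 ≤ bspline r x :=
  ((bspline_measurable_and_bounds hr).2 x).1

theorem bspline_le_one {r : ℕ} (hr : 1 ≤ r) (x : ℝ) : bspline r x ≤ 1 :=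
  ((bspline_measurable_and_bounds hr).2 x).2

theorem norm_bspline_le_one {r : ℕ} (hr : 1 ≤ r) (x : ℝ) : ‖bspline r x‖ ≤ 1 := by
  rw [Real.norm_of_nonneg (bspline_nonneg hr x)]
  exact bspline_le_one hr x

theorem intervalIntegrable_bspline {r : ℕ} (hr : 1 ≤ r) (a b : ℝ) :
    IntervalIntegrable (bspline r) volume a b :=
  (intervalIntegrable_const (c := (1 : ℝ))).mono_fun (measurable_bspline hr).aestronglyMeasurable
    (ae_of_all _ fun x => by rw [norm_one]; exact norm_bspline_le_one hr x)

theorem bspline_succ_eq_sub {r : ℕ} (hr : 1 ≤ r) (x : ℝ) :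
    bspline (r + 1) x =
      (∫ t in (0 : ℝ)..x, bspline r t) - ∫ t in (0 : ℝ)..(x - 1), bspline r t := by
  rw [bspline_succ hr, intervalIntegral.integral_interval_sub_left
    (intervalIntegrable_bspline hr _ _) (intervalIntegrable_bspline hr _ _)]

theorem continuous_bspline {r : ℕ} (hr : 2 ≤ r) : Continuous (bspline r) := by
  obtain ⟨r, rfl⟩ := Nat.exists_eq_add_of_le' hr
  have h2 := intervalIntegral.continuous_primitive
    (intervalIntegrable_bspline (r := r + 1) (by omega)) 0
  rw [funext (bspline_succ_eq_sub (r := r + 1) (by omega))]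
  exact h2.sub (h2.comp (continuous_id.sub continuous_const))

theorem bspline_eq_zero_of_neg {r : ℕ} (hr : 1 ≤ r) {x : ℝ} (hx : x < 0) : bspline r x = 0 := by
  induction r, hr using Nat.le_induction generalizing x with
  | base =>
    rw [bspline_one, Set.indicator_of_notMem]
    simp [hx]
  | succ r hr ih =>
    rw [bspline_succ' hr]
    refine intervalIntegral.integral_zero_ae (ae_of_all _ fun t ht => ih ?_)
    rw [Set.uIoc_of_le zero_le_one] at ht
    linarith [ht.1]

theorem bspline_eq_zero_of_ge {r : ℕ} (hr : 1 ≤ r) {x : ℝ} (hx : (r : ℝ) ≤ x) :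
    bspline r x = 0 := by
  induction r, hr using Nat.le_induction generalizing x with
  | base =>
    rw [bspline_one, Set.indicator_of_notMem]
    simp only [Nat.cast_one] at hx
    simp [hx]
  | succ r hr ih =>
    rw [bspline_succ' hr]
    refine intervalIntegral.integral_zero_ae (ae_of_all _ fun t ht => ih ?_)
    rw [Set.uIoc_of_le zero_le_one] at ht
    push_cast at hx
    linarith [ht.2]

theorem bspline_zero {r : ℕ} (hr : 2 ≤ r) : bspline r 0 = 0 := by
  obtain ⟨r, rfl⟩ := Nat.exists_eq_add_of_le' hr
  rw [bspline_succ' (r := r + 1) (by omega)]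
  refine intervalIntegral.integral_zero_ae (ae_of_all _ fun t ht => ?_)
  rw [Set.uIoc_of_le zero_le_one] at ht
  exact bspline_eq_zero_of_neg (by omega) (by linarith [ht.1])

theorem bspline_eq_zero_of_nonpos {r : ℕ} (hr : 2 ≤ r) {x : ℝ} (hx : x ≤ 0) :
    bspline r x = 0 := by
  rcases hx.lt_or_eq with h | rfl
  · exact bspline_eq_zero_of_neg (by omega) h
  · exact bspline_zero hr

theorem support_bspline_subset {r : ℕ} (hr : 1 ≤ r) :
    Function.support (bspline r) ⊆ Set.Ico 0 (r : ℝ) := by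
  intro x hx
  by_contra h
  rw [Set.mem_Ico, not_and_or, not_le, not_lt] at h
  exact hx (h.elim (bspline_eq_zero_of_neg hr) (bspline_eq_zero_of_ge hr))

theorem integrable_bspline {r : ℕ} (hr : 1 ≤ r) : Integrable (bspline r) := by
  have h : IntegrableOn (bspline r) (Set.Ico 0 (r : ℝ)) :=
    Measure.integrableOn_of_bounded (M := 1) (by simp)
      (measurable_bspline hr).aestronglyMeasurable
      (ae_of_all _ fun x => norm_bspline_le_one hr x)
  exact (integrableOn_iff_integrable_of_support_subset (support_bspline_subset hr)).1 h

theorem hasDerivAt_bspline_succ {r : ℕ} (hr : 1 ≤ r) {x : ℝ} (h1 : ContinuousAt (bspline r) x)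
    (h2 : ContinuousAt (bspline r) (x - 1)) :
    HasDerivAt (bspline (r + 1)) (bspline r x - bspline r (x - 1)) x := by
  rw [funext (bspline_succ_eq_sub hr)]
  have hm : ∀ y, StronglyMeasurableAtFilter (bspline r) (𝓝 y) := fun y =>
    (measurable_bspline hr).stronglyMeasurable.stronglyMeasurableAtFilter
  have h3 := intervalIntegral.integral_hasDerivAt_right
    (intervalIntegrable_bspline hr 0 x) (hm x) h1
  have h4 := intervalIntegral.integral_hasDerivAt_right
    (intervalIntegrable_bspline hr 0 (x - 1)) (hm _) h2
  exact h3.sub (HasDerivAt.comp_sub_const x 1 h4)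

theorem continuousAt_bspline_one {x : ℝ} (h0 : x ≠ 0) (h1 : x ≠ 1) :
    ContinuousAt (bspline 1) x := by
  rw [bspline_one]
  by_cases hx : x ∈ Set.Ico (0 : ℝ) 1
  · refine continuousAt_const.congr (f := fun _ => (1 : ℝ)) ?_
    filter_upwards [Ioo_mem_nhds (lt_of_le_of_ne hx.1 h0.symm) hx.2] with y hy
    exact (Set.indicator_of_mem (Set.Ioo_subset_Ico_self hy) (1 : ℝ → ℝ)).symm
  · have hc : x ∉ Set.Icc (0 : ℝ) 1 := fun h => hx ⟨h.1, lt_of_le_of_ne h.2 h1⟩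
    refine continuousAt_const.congr (f := fun _ => (0 : ℝ)) ?_
    filter_upwards [isClosed_Icc.isOpen_compl.mem_nhds hc] with y hy
    exact (Set.indicator_of_notMem (fun h => hy (Set.Ico_subset_Icc_self h)) (1 : ℝ → ℝ)).symm

/-- Reflection symmetry of the B-splines about the midpoint of their support. -/
theorem bspline_reflect_ae {r : ℕ} (hr : 1 ≤ r) :
    ∀ᵐ x : ℝ, bspline r (r - x) = bspline r x := by
  induction r, hr using Nat.le_induction with
  | base =>
    have h0 : ∀ᵐ x : ℝ, x ≠ 0 := by simp [ae_iff]
    have h1 : ∀ᵐ x : ℝ, x ≠ 1 := by simp [ae_iff]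
    filter_upwards [h0, h1] with x hx0 hx1
    rw [bspline_one]
    by_cases hx : x ∈ Set.Ico (0 : ℝ) 1
    · rw [Set.indicator_of_mem hx, Set.indicator_of_mem]
      · rfl
      · have := lt_of_le_of_ne hx.1 hx0.symm
        constructor <;> push_cast <;> linarith [hx.2]
    · rw [Set.indicator_of_notMem hx, Set.indicator_of_notMem]
      rintro ⟨h2, h3⟩
      push_cast at h2 h3
      have := lt_of_le_of_ne (show x ≤ 1 by linarith) hx1
      exact hx ⟨by linarith, this⟩
  | succ r hr ih =>
    refine ae_of_all _ fun x => ?_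
    rw [bspline_succ hr, bspline_succ hr x]
    have : ∫ t in (x - 1)..x, bspline r t = ∫ t in (x - 1)..x, bspline r (r - t) :=
      intervalIntegral.integral_congr_ae (ih.mono fun t ht _ => ht.symm)
    rw [this, intervalIntegral.integral_comp_sub_left]
    push_cast
    congr 1 <;> ring

theorem bspline_reflect {r : ℕ} (hr : 2 ≤ r) (x : ℝ) : bspline r (r - x) = bspline r x := by
  have h := bspline_reflect_ae (r := r) (by omega)
  have := (continuous_bspline hr).comp ((continuous_const (y := (r : ℝ))).sub continuous_id)
  exact congrFun ((this.ae_eq_iff_eq volume (continuous_bspline hr)).1 h) x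

/-- The B-splines of order `a + b` are the convolutions of those of orders `a` and `b`. -/
theorem integral_bspline_mul_bspline {a b : ℕ} (ha : 1 ≤ a) (hb : 1 ≤ b) (x : ℝ) :
    ∫ t, bspline a t * bspline b (x - t) = bspline (a + b) x := by
  induction a, ha using Nat.le_induction generalizing x with
  | base =>
    rw [add_comm, bspline_succ' hb, intervalIntegral.integral_of_le zero_le_one,
      ← integral_Ico_eq_integral_Ioc, ← integral_indicator measurableSet_Ico]
    refine integral_congr_ae (ae_of_all _ fun t => ?_)
    by_cases ht : t ∈ Set.Ico (0 : ℝ) 1 <;> simp [bspline_one, Set.indicator, ht]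
  | succ a ha ih =>
    rw [show a + 1 + b = a + b + 1 by ring, bspline_succ' (r := a + b) (by omega)]
    simp_rw [← ih]
    have h1 : ∀ s : ℝ, ∫ t, bspline a t * bspline b (x - s - t) =
        ∫ t, bspline a (t - s) * bspline b (x - t) := fun s => by
      rw [← integral_sub_right_eq_self (fun t => bspline a t * bspline b (x - s - t)) s]
      refine integral_congr_ae (ae_of_all _ fun t => ?_)
      simp only
      congr 2; ring
    simp_rw [h1, intervalIntegral.integral_of_le zero_le_one]
    rw [integral_integral_swap]
    · refine integral_congr_ae (ae_of_all _ fun t => ?_)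
      simp only
      rw [bspline_succ' ha, intervalIntegral.integral_of_le zero_le_one, ← integral_mul_const]
    · have hg : Integrable (fun t => bspline b (x - t)) := (integrable_bspline hb).comp_sub_left x
      -- Fubini: since N_a ≤ 1, the double integrand is dominated by 1 · N_b(x - t) on (0,1] × ℝ.
      have h2 := (integrable_const (μ := volume.restrict (Set.Ioc (0 : ℝ) 1)) (1 : ℝ)).mul_prod hg
      refine h2.mono ?_ (ae_of_all _ fun p => ?_)
      · exact (((measurable_bspline ha).comp (measurable_snd.sub measurable_fst)).mul
          ((measurable_bspline hb).comp (measurable_const.sub measurable_snd))).aestronglyMeasurable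
      · simp only [Function.uncurry, norm_mul, one_mul]
        exact mul_le_of_le_one_left (norm_nonneg _) (norm_bspline_le_one ha _)

/-- The two-scale relation of the B-splines. -/
theorem bspline_two_scale {r : ℕ} (hr : 1 ≤ r) (x : ℝ) :
    2 ^ (r - 1) * bspline r x =
      ∑ i ∈ Finset.range (r + 1), (r.choose i : ℝ) * bspline r (2 * x - i) := by
  induction r, hr using Nat.le_induction generalizing x with
  | base =>
    simp only [bspline_one, Set.indicator, Set.mem_Ico, Finset.sum_range_succ]
    simp
    split_ifs <;> grind
  | succ r hr ih =>
    -- Doubling the variable turns the unit interval into one of length 2, that is, into two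
    -- adjacent unit averages; Pascal's rule then merges the neighbouring terms.
    have h1 : ∀ i : ℕ, ∫ t in (0 : ℝ)..1, bspline r (2 * (x - t) - i) =
        1 / 2 * (bspline (r + 1) (2 * x - i) + bspline (r + 1) (2 * x - (i + 1))) := fun i => by
      have : ∀ t : ℝ, 2 * (x - t) - i = (2 * x - i) - 2 * t := fun t => by ring
      simp_rw [this]
      rw [intervalIntegral.integral_comp_sub_mul _ two_ne_zero, bspline_succ hr, bspline_succ hr,
        add_comm, show 2 * x - ((i : ℝ) + 1) = 2 * x - i - 1 by ring,
        intervalIntegral.integral_add_adjacent_intervals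
        (intervalIntegrable_bspline hr _ _) (intervalIntegrable_bspline hr _ _), smul_eq_mul]
      norm_num
      congr 1; ring
    have h2 : 2 ^ (r - 1) * bspline (r + 1) x = 1 / 2 * ∑ i ∈ Finset.range (r + 1),
        (r.choose i : ℝ) *
          (bspline (r + 1) (2 * x - i) + bspline (r + 1) (2 * x - (i + 1))) := by
      rw [bspline_succ' hr, ← intervalIntegral.integral_const_mul]
      simp_rw [ih]
      rw [intervalIntegral.integral_finsetSum]
      · rw [Finset.mul_sum]
        refine Finset.sum_congr rfl fun i _ => ?_
        rw [intervalIntegral.integral_const_mul, h1]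
        ring
      · intro i _
        refine IntervalIntegrable.const_mul ?_ _
        exact (intervalIntegrable_const (c := (1 : ℝ))).mono_fun
          ((measurable_bspline hr).comp (by fun_prop)).aestronglyMeasurable
          (ae_of_all _ fun x => by rw [norm_one]; exact norm_bspline_le_one hr _)
    obtain ⟨k, rfl⟩ := Nat.exists_eq_add_of_le' hr
    simp only [Nat.add_sub_cancel] at h2 ⊢
    rw [pow_succ, mul_assoc, mul_left_comm, h2, ← mul_assoc, mul_one_div_cancel two_ne_zero,
      one_mul]
    have := Finset.sum_choose_succ_mul (R := ℝ)
      (fun i _ => bspline (k + 1 + 1) (2 * x - i)) (k + 1)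
    rw [this]
    simp_rw [mul_add]
    rw [Finset.sum_add_distrib]
    push_cast
    rfl

theorem bspline_sub_intCast_eq_zero {r : ℕ} (hr : 1 ≤ r) {x : ℝ} {k : ℤ}
    (hk : k ∉ Finset.Icc (⌊x⌋ - r) ⌊x⌋) : bspline r (x - k) = 0 := by
  by_contra h
  have := support_bspline_subset hr h
  refine hk (Finset.mem_Icc.2 ⟨?_, Int.le_floor.2 (by linarith [this.1])⟩)
  have h1 : x < ((k + r : ℤ) : ℝ) := by push_cast; linarith [this.2]
  have := Int.floor_lt.2 h1
  omega

theorem hasFiniteSupport_bspline_sub {r : ℕ} (hr : 1 ≤ r) (x : ℝ) :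
    (Function.support fun k : ℤ => bspline r (x - k)).Finite :=
  (Finset.Icc (⌊x⌋ - r) ⌊x⌋).finite_toSet.subset fun k hk => by
    by_contra h
    exact hk (bspline_sub_intCast_eq_zero hr h)

theorem summable_bspline_sub {r : ℕ} (hr : 1 ≤ r) (x : ℝ) :
    Summable fun k : ℤ => bspline r (x - k) :=
  summable_of_hasFiniteSupport (hasFiniteSupport_bspline_sub hr x)

/-- The integer translates of a B-spline form a partition of unity. -/
theorem tsum_bspline_sub {r : ℕ} (hr : 1 ≤ r) (x : ℝ) : ∑' k : ℤ, bspline r (x - k) = 1 := by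
  induction r, hr using Nat.le_induction generalizing x with
  | base =>
    rw [tsum_eq_single ⌊x⌋]
    · rw [bspline_one, Set.indicator_of_mem]
      · rfl
      · exact ⟨by linarith [Int.floor_le x], by linarith [Int.lt_floor_add_one x]⟩
    · intro k hk
      rw [bspline_one, Set.indicator_of_notMem]
      rintro ⟨h1, h2⟩
      exact hk (Int.floor_eq_iff.2 ⟨by linarith, by linarith⟩).symm
  | succ r hr ih =>
    -- One finite window of k serves all t in [0,1], so the sum can be moved inside the integral.
    have h0 : ∀ t ∈ Set.Icc (0 : ℝ) 1, ∀ k ∉ Finset.Icc (⌊x⌋ - (r + 1 : ℕ)) ⌊x⌋,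
        bspline r (x - t - k) = 0 := fun t ht k hk => by
      apply bspline_sub_intCast_eq_zero hr
      refine fun h => hk ?_
      rw [Finset.mem_Icc] at h ⊢
      have h1 : ⌊x - t⌋ ≤ ⌊x⌋ := Int.floor_le_floor (by linarith [ht.1])
      have h2 : ⌊x⌋ ≤ ⌊x - t⌋ + 1 := by
        rw [← Int.floor_add_one]; exact Int.floor_le_floor (by linarith [ht.2])
      push_cast
      omega
    rw [tsum_eq_sum fun k hk => bspline_sub_intCast_eq_zero (r := r + 1) (by omega) hk]
    simp_rw [bspline_succ' hr]
    rw [← intervalIntegral.integral_finsetSum]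
    · rw [intervalIntegral.integral_congr (g := fun _ => (1 : ℝ))]
      · simp
      · intro t ht
        rw [Set.uIcc_of_le zero_le_one] at ht
        simp only
        rw [← ih (x - t), tsum_eq_sum (h0 t ht)]
        refine Finset.sum_congr rfl fun k _ => ?_
        congr 1; ring
    · intro k _
      exact (intervalIntegrable_const (c := (1 : ℝ))).mono_fun
          ((measurable_bspline hr).comp (by fun_prop)).aestronglyMeasurable
          (ae_of_all _ fun x => by rw [norm_one]; exact norm_bspline_le_one hr _)

/-! ### Convolution with sequences on the integers -/

section conv

variable {A V : Type*} [AddCommGroupWithOne A] [NormedAddCommGroup V] [NormedSpace ℝ V]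

/-- The action of a sequence on functions, `(u ⋆ φ)(x) = ∑_n u_n φ(x - n)`. -/
noncomputable def conv (u : ℤ → ℝ) (φ : A → V) (x : A) : V := ∑' n : ℤ, u n • φ (x - n)

theorem conv_shift (u : ℤ → ℝ) (φ : A → V) (a x : A) :
    conv u (fun y => φ (y - a)) x = conv u φ (x - a) := by
  simp only [conv]
  exact tsum_congr fun n => by rw [sub_right_comm]

theorem conv_const_smul (u : ℤ → ℝ) (φ : A → V) (a : ℝ) (x : A) :
    conv u (fun y => a • φ y) x = a • conv u φ x := by
  simp only [conv]
  rw [← tsum_const_smul'' a]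
  exact tsum_congr fun n => smul_comm _ _ _

theorem single_conv (φ : A → V) : conv (Pi.single 0 1) φ = φ := by
  funext x
  rw [conv, tsum_eq_single 0]
  · simp
  · intro n hn
    simp [hn]

theorem norm_conv_le {u : ℤ → ℝ} (hu : Summable u) {φ : A → V} {C : ℝ} (hφ : ∀ x, ‖φ x‖ ≤ C)
    (x : A) : ‖conv u φ x‖ ≤ (∑' n, |u n|) * C := by
  refine tsum_of_norm_bounded (hu.abs.hasSum.mul_right C) fun n => ?_
  rw [norm_smul, Real.norm_eq_abs]
  exact mul_le_mul_of_nonneg_left (hφ _) (abs_nonneg _)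

variable [CompleteSpace V]

theorem summable_conv {u : ℤ → ℝ} (hu : Summable u) {φ : A → V} {C : ℝ} (hφ : ∀ x, ‖φ x‖ ≤ C)
    (x : A) : Summable fun n : ℤ => u n • φ (x - n) := by
  refine Summable.of_norm_bounded (hu.abs.mul_right C) fun n => ?_
  rw [norm_smul, Real.norm_eq_abs]
  exact mul_le_mul_of_nonneg_left (hφ _) (abs_nonneg _)

theorem summable_conv_conv {u v : ℤ → ℝ} (hu : Summable u) (hv : Summable v) {φ : A → V} {C : ℝ}
    (hφ : ∀ x, ‖φ x‖ ≤ C) (x : A) :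
    Summable fun p : ℤ × ℤ => u p.1 • v p.2 • φ (x - p.1 - p.2) := by
  refine Summable.of_norm_bounded
    ((hu.abs.mul_of_nonneg hv.abs (fun _ => abs_nonneg _) fun _ => abs_nonneg _).mul_right C)
    fun p => ?_
  rw [norm_smul, norm_smul, Real.norm_eq_abs, Real.norm_eq_abs, ← mul_assoc]
  exact mul_le_mul_of_nonneg_left (hφ _) (by positivity)

theorem conv_conv {u v : ℤ → ℝ} (hv : Summable v) {φ : A → V} {C : ℝ} (hφ : ∀ x, ‖φ x‖ ≤ C)
    (x : A) : conv u (conv v φ) x = ∑' n : ℤ, ∑' k : ℤ, u n • v k • φ (x - n - k) := by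
  simp only [conv]
  refine tsum_congr fun n => ?_
  rw [(summable_conv hv hφ _).tsum_const_smul]

theorem conv_left_comm {u v : ℤ → ℝ} (hu : Summable u) (hv : Summable v) {φ : A → V} {C : ℝ}
    (hφ : ∀ x, ‖φ x‖ ≤ C) : conv u (conv v φ) = conv v (conv u φ) := by
  funext x
  rw [conv_conv hv hφ, conv_conv hu hφ]
  refine ((summable_conv_conv (u := u) (v := v) hu hv hφ x).tsum_comm
      (f := fun n k : ℤ => u n • v k • φ (x - n - k))).symm.trans ?_
  refine tsum_congr fun n => tsum_congr fun k => ?_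
  rw [smul_comm, sub_right_comm]

/-- Absolute convergence of the double series allows the change of index (n, k) ↦ (n, n + k) and the
exchange of summations. -/
theorem conv_assoc {u v : ℤ → ℝ} (hu : Summable u) (hv : Summable v) {φ : A → V} {C : ℝ}
    (hφ : ∀ x, ‖φ x‖ ≤ C) : conv (conv u v) φ = conv u (conv v φ) := by
  funext x
  have h1 := summable_conv_conv (u := u) (v := v) hu hv hφ x
  let e : ℤ × ℤ ≃ ℤ × ℤ :=
    { toFun := fun p => (p.1, p.2 - p.1), invFun := fun p => (p.1, p.2 + p.1),
      left_inv := fun p => by simp, right_inv := fun p => by simp }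
  have h2 : Summable fun p : ℤ × ℤ => u p.1 • v (p.2 - p.1) • φ (x - p.2) := by
    convert (e.summable_iff (f := fun p : ℤ × ℤ => u p.1 • v p.2 • φ (x - p.1 - p.2))).2 h1
      using 2 with p
    simp [e, sub_sub]
  have hvb : ∃ D, ∀ n, ‖v n‖ ≤ D := ⟨∑' n, |v n|, fun n =>
    hv.abs.le_tsum n fun _ _ => abs_nonneg _⟩
  obtain ⟨D, hD⟩ := hvb
  calc conv (conv u v) φ x = ∑' k : ℤ, ∑' n : ℤ, u n • v (k - n) • φ (x - k) := by
        simp only [conv]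
        refine tsum_congr fun k => ?_
        rw [← (summable_conv hu hD k).tsum_smul_const]
        simp [mul_smul]
    _ = ∑' n : ℤ, ∑' k : ℤ, u n • v (k - n) • φ (x - k) :=
        h2.tsum_comm (f := fun n k : ℤ => u n • v (k - n) • φ (x - k))
    _ = ∑' n : ℤ, ∑' k : ℤ, u n • v k • φ (x - n - k) := by
        refine tsum_congr fun n => ?_
        rw [← (Equiv.subRight n).tsum_eq fun k => u n • v k • φ (x - n - k)]
        refine tsum_congr fun k => ?_
        simp
    _ = _ := (conv_conv hv hφ x).symm

end conv

theorem summable_conv_seq {u v : ℤ → ℝ} (hu : Summable u) (hv : Summable v) :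
    Summable (conv u v) := by
  let e : ℤ × ℤ ≃ ℤ × ℤ :=
    { toFun := fun p => (p.2, p.1 - p.2), invFun := fun p => (p.2 + p.1, p.1),
      left_inv := fun p => by simp, right_inv := fun p => by simp }
  have h0 : Summable fun p : ℤ × ℤ => u p.1 * v p.2 :=
    summable_mul_of_summable_norm hu.norm hv.norm
  have h1 : Summable fun p : ℤ × ℤ => u p.2 * v (p.1 - p.2) := e.summable_iff.2 h0
  have h2 : conv u v = fun n : ℤ => ∑' k : ℤ, u k * v (n - k) := by
    funext n
    simp [conv]
  rw [h2]
  exact h1.prod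

/-! ### Inverses with respect to convolution -/

/-- The symbol `∑_k b_k e^{ikθ}` of a sequence. -/
noncomputable def symbol (b : ℤ → ℝ) (θ : ℝ) : ℂ :=
  ∑' k : ℤ, (b k : ℂ) * Complex.exp (Complex.I * k * θ)

theorem symbol_eq_sum {b : ℤ → ℝ} {s : Finset ℤ} (hs : ∀ k ∉ s, b k = 0) (θ : ℝ) :
    symbol b θ = ∑ k ∈ s, (b k : ℂ) * Complex.exp (Complex.I * k * θ) :=
  tsum_eq_sum fun k hk => by simp [hs k hk]

theorem norm_exp_I_mul_int_mul (k : ℤ) (θ : ℝ) : ‖Complex.exp (Complex.I * k * θ)‖ = 1 := by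
  rw [show Complex.I * k * θ = ((k * θ : ℝ) : ℂ) * Complex.I by push_cast; ring]
  exact Complex.norm_exp_ofReal_mul_I _

/-- Characters are eigenfunctions of convolution, with the symbol as eigenvalue. -/
theorem conv_character (u : ℤ → ℝ) (θ : ℝ) (x : ℤ) :
    conv u (fun n : ℤ => Complex.exp (-(Complex.I * n * θ))) x =
      symbol u θ * Complex.exp (-(Complex.I * x * θ)) := by
  rw [conv, symbol, ← tsum_mul_right]
  refine tsum_congr fun n => ?_
  rw [Complex.real_smul, mul_assoc ((u n : ℝ) : ℂ), ← Complex.exp_add]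
  congr 2
  simp only [Int.cast_id]
  push_cast
  ring

/-- Associativity applied to a character and evaluated at 0 compares the eigenvalues. -/
theorem symbol_conv {u v : ℤ → ℝ} (hu : Summable u) (hv : Summable v) (θ : ℝ) :
    symbol (conv u v) θ = symbol u θ * symbol v θ := by
  have hb : ∀ n : ℤ, ‖Complex.exp (-(Complex.I * n * θ))‖ ≤ 1 := fun n => by
    have := norm_exp_I_mul_int_mul (-n) θ
    push_cast at this
    rw [← this]
    apply le_of_eq; congr 2; ring
  have h := congrFun (conv_assoc hu hv hb) 0
  have h2 : conv v (fun n : ℤ => Complex.exp (-(Complex.I * n * θ))) =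
      fun x : ℤ => symbol v θ • Complex.exp (-(Complex.I * x * θ)) := by
    funext x; rw [conv_character, smul_eq_mul]
  rw [conv_character, h2] at h
  have h3 : conv u (fun x : ℤ => symbol v θ • Complex.exp (-(Complex.I * x * θ))) 0 =
      symbol v θ * conv u (fun n : ℤ => Complex.exp (-(Complex.I * n * θ))) 0 := by
    simp only [conv]
    rw [← tsum_mul_left]
    refine tsum_congr fun n => ?_
    simp only [Complex.real_smul, smul_eq_mul]
    ring
  rw [h3, conv_character] at h
  simpa [mul_comm] using h

/-- Fourier coefficients of smooth periodic functions decay faster than any power. -/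
theorem exists_pow_mul_norm_integral_le (K : ℕ) (g : ℝ → ℂ) (hg : ContDiff ℝ ∞ g)
    (hper : Function.Periodic g (2 * Real.pi)) :
    ∃ C : ℝ, ∀ n : ℤ, |(n : ℝ)| ^ K *
      ‖∫ θ in (0 : ℝ)..(2 * Real.pi), Complex.exp (-(Complex.I * n * θ)) * g θ‖ ≤ C := by
  induction K generalizing g with
  | zero =>
    refine ⟨∫ θ in (0 : ℝ)..(2 * Real.pi), ‖g θ‖, fun n => ?_⟩
    rw [pow_zero, one_mul]
    refine (intervalIntegral.norm_integral_le_integral_norm Real.two_pi_pos.le).trans_eq ?_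
    refine intervalIntegral.integral_congr fun θ _ => ?_
    have := norm_exp_I_mul_int_mul (-n) θ
    push_cast at this
    simp only [norm_mul]
    rw [show -(Complex.I * n * θ) = Complex.I * -n * θ by ring, this, one_mul]
  | succ K ih =>
    have hg' : ContDiff ℝ ∞ (deriv g) := (contDiff_infty_iff_deriv.1 hg).2
    have hper' : Function.Periodic (deriv g) (2 * Real.pi) := fun x => by
      rw [← deriv_comp_add_const, funext hper]
    obtain ⟨C, hC⟩ := ih (deriv g) hg' hper'
    refine ⟨C, fun n => ?_⟩
    have hgd : Differentiable ℝ g := hg.differentiable (by simp)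
    have hgc : Continuous g := hg.continuous
    have hgc' : Continuous (deriv g) := hg'.continuous
    have hd : ∀ θ ∈ Set.uIcc (0 : ℝ) (2 * Real.pi),
        HasDerivAt (fun θ : ℝ => Complex.exp (-(Complex.I * n * θ)) * g θ)
        (Complex.exp (-(Complex.I * n * θ)) * (-(Complex.I * n)) * g θ +
          Complex.exp (-(Complex.I * n * θ)) * deriv g θ) θ := fun θ _ => by
      refine HasDerivAt.mul ?_ (hgd θ).hasDerivAt
      refine HasDerivAt.cexp ?_
      have := ((hasDerivAt_id (θ : ℂ)).comp_ofReal.const_mul (-(Complex.I * n)))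
      simpa using this
    have h1 := intervalIntegral.integral_eq_sub_of_hasDerivAt hd
      (Continuous.intervalIntegrable (by fun_prop) _ _)
    rw [intervalIntegral.integral_add (Continuous.intervalIntegrable (by fun_prop) _ _)
      (Continuous.intervalIntegrable (by fun_prop) _ _)] at h1
    -- Periodicity makes the boundary terms of the integration by parts cancel.
    have h2 : g (2 * Real.pi) = g 0 := by simpa using hper 0
    have h3 : Complex.exp (-(Complex.I * n * ((2 * Real.pi : ℝ) : ℂ))) = 1 := by
      rw [Complex.exp_eq_one_iff]
      exact ⟨-n, by push_cast; ring⟩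
    have h4 : ∫ θ in (0 : ℝ)..(2 * Real.pi),
        Complex.exp (-(Complex.I * n * θ)) * (-(Complex.I * n)) * g θ =
        -(Complex.I * n) * ∫ θ in (0 : ℝ)..(2 * Real.pi),
          Complex.exp (-(Complex.I * n * θ)) * g θ := by
      rw [← intervalIntegral.integral_const_mul]
      refine intervalIntegral.integral_congr fun θ _ => ?_
      ring
    rw [h3, h2, h4] at h1
    have h5 : ∫ θ in (0 : ℝ)..(2 * Real.pi), Complex.exp (-(Complex.I * n * θ)) * deriv g θ =
        (Complex.I * n) * ∫ θ in (0 : ℝ)..(2 * Real.pi),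
          Complex.exp (-(Complex.I * n * θ)) * g θ := by
      rw [Complex.ofReal_zero, mul_zero, neg_zero, Complex.exp_zero, sub_self] at h1
      linear_combination h1
    have h6 := hC n
    rw [h5, norm_mul, norm_mul, Complex.norm_I, one_mul, Complex.norm_intCast] at h6
    rwa [pow_succ, mul_assoc]

/-- The reciprocal of a zero-free trigonometric polynomial is smooth and periodic. The polynomial
weight is needed when the series of the dual wavelet is integrated against (x - t)^(m-1). -/
theorem summable_abs_pow_mul_convInverse {b : ℤ → ℝ} (hb : (Function.support b).Finite)
    (h0 : ∀ θ : ℝ, symbol b θ ≠ 0) (K : ℕ) :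
    Summable fun n : ℤ => |(n : ℝ)| ^ K * |convInverse b n| := by
  have hs : ∀ k ∉ hb.toFinset, b k = 0 := fun k hk => by simpa using hk
  have hsm : ContDiff ℝ ∞ fun θ => (symbol b θ)⁻¹ := by
    refine ContDiff.inv ?_ h0
    rw [funext (symbol_eq_sum hs)]
    have : ContDiff ℝ ∞ ((↑) : ℝ → ℂ) := Complex.ofRealCLM.contDiff
    fun_prop
  have hper : Function.Periodic (fun θ => (symbol b θ)⁻¹) (2 * Real.pi) := fun θ => by
    simp only [symbol]
    congr 1
    refine tsum_congr fun k => ?_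
    congr 1
    rw [Complex.exp_eq_exp_iff_exists_int]
    exact ⟨k, by push_cast; ring⟩
  -- Two spare powers give comparison with ∑ 1/n².
  obtain ⟨C, hC⟩ := exists_pow_mul_norm_integral_le (K + 2) _ hsm hper
  have hle : ∀ n : ℤ, |convInverse b n| ≤ ‖∫ θ in (0 : ℝ)..(2 * Real.pi),
      Complex.exp (-(Complex.I * n * θ)) * (symbol b θ)⁻¹‖ := fun n => by
    rw [convInverse]
    refine (Complex.abs_re_le_norm _).trans ?_
    rw [norm_mul]
    refine mul_le_of_le_one_left (norm_nonneg _) ?_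
    rw [norm_div, norm_mul, norm_one, Complex.norm_real, Complex.norm_ofNat,
      Real.norm_of_nonneg Real.pi_pos.le, div_le_one Real.two_pi_pos]
    linarith [Real.pi_gt_three]
  have h2 : Summable fun n : ℤ => C * (1 / (n : ℝ) ^ 2) :=
    (Real.summable_one_div_int_pow.2 one_lt_two).mul_left C
  refine h2.of_norm_bounded_eventually ?_
  have : ∀ᶠ n : ℤ in cofinite, n ≠ 0 := by
    rw [Filter.eventually_cofinite]
    simp
  filter_upwards [this] with n hn
  have hn' : 0 < (n : ℝ) ^ 2 := by positivity
  rw [Real.norm_of_nonneg (by positivity), mul_one_div, le_div_iff₀ hn', ← sq_abs (n : ℝ)]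
  calc |(n : ℝ)| ^ K * |convInverse b n| * |(n : ℝ)| ^ 2 =
        |(n : ℝ)| ^ (K + 2) * |convInverse b n| := by ring
    _ ≤ _ := (mul_le_mul_of_nonneg_left (hle n) (by positivity)).trans (hC n)

theorem summable_convInverse {b : ℤ → ℝ} (hb : (Function.support b).Finite)
    (h0 : ∀ θ : ℝ, symbol b θ ≠ 0) : Summable (convInverse b) := by
  refine Summable.of_abs ?_
  simpa using (summable_abs_pow_mul_convInverse hb h0 0)

theorem conv_convInverse {b : ℤ → ℝ} (hb : (Function.support b).Finite)
    (h0 : ∀ θ : ℝ, symbol b θ ≠ 0) : conv b (convInverse b) = Pi.single 0 1 := by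
  funext n
  have hs : ∀ k ∉ hb.toFinset, b k = 0 := fun k hk => by simpa using hk
  have hcont : Continuous (symbol b) := by
    rw [funext (symbol_eq_sum hs)]
    fun_prop
  rw [conv, tsum_eq_sum (s := hb.toFinset) (fun k hk => by simp [hs k hk])]
  simp only [convInverse, smul_eq_mul, Int.cast_id]
  -- The weights b_k are real, so the real part can be taken after summation. The symbol then
  -- cancels its reciprocal and only the orthogonality of the exponentials remains.
  simp_rw [← Complex.re_ofReal_mul, ← Complex.re_sum]
  have h1 : ∀ k : ℤ, (b k : ℂ) * (1 / (2 * (Real.pi : ℂ)) *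
      ∫ θ in (0 : ℝ)..(2 * Real.pi), Complex.exp (-(Complex.I * (n - k : ℤ) * θ)) /
        ∑' k : ℤ, (b k : ℂ) * Complex.exp (Complex.I * k * θ)) =
      1 / (2 * (Real.pi : ℂ)) * ∫ θ in (0 : ℝ)..(2 * Real.pi),
        (b k : ℂ) * Complex.exp (Complex.I * k * θ) *
          (Complex.exp (-(Complex.I * n * θ)) / symbol b θ) := fun k => by
    rw [mul_left_comm, ← intervalIntegral.integral_const_mul]
    congr 1
    refine intervalIntegral.integral_congr fun θ _ => ?_
    simp only [symbol]
    rw [mul_assoc ((b k : ℝ) : ℂ), ← mul_div_assoc (Complex.exp _), ← Complex.exp_add]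
    congr 4
    push_cast; ring
  simp_rw [h1]
  rw [← Finset.mul_sum, ← intervalIntegral.integral_finsetSum]
  · have h2 : ∀ θ : ℝ, ∑ k ∈ hb.toFinset, (b k : ℂ) * Complex.exp (Complex.I * k * θ) *
        (Complex.exp (-(Complex.I * n * θ)) / symbol b θ) =
        Complex.exp (-(Complex.I * n) * θ) := fun θ => by
      rw [← Finset.sum_mul, ← symbol_eq_sum hs, mul_div_cancel₀ _ (h0 θ), neg_mul]
    simp_rw [h2]
    by_cases hn : n = 0
    · subst hn
      simp
      field_simp
    · have hn' : -(Complex.I * n) ≠ 0 := by simp [hn]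
      rw [integral_exp_mul_complex hn']
      have h3 : Complex.exp (-(Complex.I * n) * ((2 * Real.pi : ℝ) : ℂ)) = 1 := by
        rw [Complex.exp_eq_one_iff]
        exact ⟨-n, by push_cast; ring⟩
      rw [h3]
      simp [hn]
  · intro k _
    refine Continuous.intervalIntegrable ?_ _ _
    exact Continuous.mul (by fun_prop) (Continuous.div (by fun_prop) hcont h0)

/-! ### Positivity of the symbol of the sampled B-spline -/

/-- The quasi-periodic function `∑_k e^{ikθ} N_r(x - k)`. -/
noncomputable def zak (r : ℕ) (θ x : ℝ) : ℂ :=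
  ∑' k : ℤ, Complex.exp (Complex.I * k * θ) * (bspline r (x - k) : ℂ)

theorem zak_eq_sum {r : ℕ} (hr : 1 ≤ r) (θ : ℝ) {a b : ℤ} {x : ℝ} (ha : (a : ℝ) ≤ x)
    (hb : x < b + 1) :
    zak r θ x = ∑ k ∈ Finset.Icc (a - r) b,
      Complex.exp (Complex.I * k * θ) * (bspline r (x - k) : ℂ) := by
  refine tsum_eq_sum fun k hk => ?_
  rw [bspline_sub_intCast_eq_zero hr, Complex.ofReal_zero, mul_zero]
  refine fun h => hk ?_
  rw [Finset.mem_Icc] at h ⊢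
  have h1 : a ≤ ⌊x⌋ := Int.le_floor.2 ha
  have h2 : ⌊x⌋ < b + 1 := Int.floor_lt.2 (by push_cast; exact hb)
  omega

theorem zak_add_int {r : ℕ} (θ x : ℝ) (n : ℤ) :
    zak r θ (x + n) = Complex.exp (Complex.I * n * θ) * zak r θ x := by
  rw [zak, zak, ← tsum_mul_left, ← (Equiv.addRight n).tsum_eq]
  refine tsum_congr fun k => ?_
  rw [← mul_assoc, ← Complex.exp_add, Equiv.coe_addRight]
  congr 2
  · push_cast; ring
  · congr 1; push_cast; ring

theorem zak_eventuallyEq {r : ℕ} (hr : 1 ≤ r) (θ x : ℝ) :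
    zak r θ =ᶠ[𝓝 x] fun y => ∑ k ∈ Finset.Icc (⌊x⌋ - 1 - r) (⌊x⌋ + 1),
      Complex.exp (Complex.I * k * θ) * (bspline r (y - k) : ℂ) := by
  filter_upwards [Ioo_mem_nhds (show x - 1 < x by linarith) (show x < x + 1 by linarith)]
    with y hy
  refine zak_eq_sum hr θ ?_ ?_
  · push_cast; linarith [hy.1, Int.floor_le x]
  · push_cast; linarith [hy.2, Int.lt_floor_add_one x]

theorem continuous_zak {r : ℕ} (hr : 2 ≤ r) (θ : ℝ) : Continuous (zak r θ) := by
  have hc := continuous_bspline hr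
  rw [continuous_iff_continuousAt]
  intro x
  refine ContinuousAt.congr (Continuous.continuousAt ?_)
    (zak_eventuallyEq (by omega) θ x).symm
  fun_prop

/-- Differentiating N_{r+1} gives a backward difference of N_r, and by quasi-periodicity the unit
shift is multiplication by e^{-iθ}. -/
theorem hasDerivAt_zak {r : ℕ} (hr : 2 ≤ r) (θ x : ℝ) :
    HasDerivAt (zak (r + 1) θ) ((1 - Complex.exp (-(Complex.I * θ))) * zak r θ x) x := by
  have hc := continuous_bspline hr
  have h1 : HasDerivAt (fun y : ℝ => ∑ k ∈ Finset.Icc (⌊x⌋ - 1 - (r + 1 : ℕ)) (⌊x⌋ + 1),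
      Complex.exp (Complex.I * k * θ) * (bspline (r + 1) (y - k) : ℂ))
      (∑ k ∈ Finset.Icc (⌊x⌋ - 1 - (r + 1 : ℕ)) (⌊x⌋ + 1), Complex.exp (Complex.I * k * θ) *
        ((bspline r (x - k) - bspline r (x - k - 1) : ℝ) : ℂ)) x :=
    HasDerivAt.fun_sum fun k _ => HasDerivAt.const_mul _ (HasDerivAt.ofReal_comp
      (HasDerivAt.comp_sub_const x (k : ℝ)
        (hasDerivAt_bspline_succ (by omega) hc.continuousAt hc.continuousAt)))
  refine (h1.congr_of_eventuallyEq (zak_eventuallyEq (by omega) θ x)).congr_deriv (Eq.symm ?_)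
  have h2 : zak r θ (x - 1) = Complex.exp (-(Complex.I * θ)) * zak r θ x := by
    have := zak_add_int (r := r) θ x (-1)
    push_cast at this
    rw [← sub_eq_add_neg] at this
    rw [this]
    congr 2; ring
  rw [sub_mul, one_mul, ← h2]
  -- The same summation window represents the function at both x and x - 1.
  have h3 : ∀ y, x - 1 ≤ y → y ≤ x → zak r θ y =
      ∑ k ∈ Finset.Icc (⌊x⌋ - 1 - (r + 1 : ℕ)) (⌊x⌋ + 1),
        Complex.exp (Complex.I * k * θ) * (bspline r (y - k) : ℂ) := fun y h1 h2 => by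
    rw [show ⌊x⌋ - 1 - ((r + 1 : ℕ) : ℤ) = ⌊x⌋ - 2 - (r : ℤ) by push_cast; ring]
    refine zak_eq_sum (by omega) θ ?_ ?_
    · push_cast; linarith [Int.floor_le x]
    · push_cast; linarith [Int.lt_floor_add_one x]
  rw [h3 x (by linarith) le_rfl, h3 (x - 1) le_rfl (by linarith), ← Finset.sum_sub_distrib]
  refine Finset.sum_congr rfl fun k _ => ?_
  rw [← mul_sub, sub_right_comm x (k : ℝ) 1]
  push_cast
  rfl

theorem bspline_two_one : bspline 2 1 = 1 := by
  have h := tsum_bspline_sub (r := 2) (by norm_num) 1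
  rw [tsum_eq_single 0] at h
  · simpa using h
  · intro k hk
    rcases lt_or_gt_of_ne hk with hk | hk
    · apply bspline_eq_zero_of_ge (by norm_num)
      have : (k : ℝ) ≤ -1 := by exact_mod_cast (by omega : k ≤ -1)
      push_cast; linarith
    · apply bspline_eq_zero_of_nonpos (by norm_num)
      have : (1 : ℝ) ≤ k := by exact_mod_cast hk
      linarith

/-- If e^{iθ} = 1 the function is constantly 1 by the partition of unity. Otherwise its derivative
is a nonzero multiple of the function of one order less, so vanishing identically would descend to
order 2, where the value at 1 is 1. -/
theorem exists_zak_ne_zero {r : ℕ} (hr : 2 ≤ r) (θ : ℝ) : ∃ x, zak r θ x ≠ 0 := by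
  by_cases hθ : Complex.exp (-(Complex.I * θ)) = 1
  · refine ⟨0, ?_⟩
    have h1 : ∀ k : ℤ, Complex.exp (Complex.I * k * θ) = 1 := fun k => by
      rw [show Complex.I * k * θ = (-k : ℤ) * (-(Complex.I * θ)) by push_cast; ring,
        Complex.exp_int_mul, hθ, one_zpow]
    simp only [zak, h1, one_mul]
    rw [← Complex.ofReal_tsum, tsum_bspline_sub (by omega)]
    simp
  · induction r, hr using Nat.le_induction with
    | base =>
      refine ⟨1, ?_⟩
      rw [zak, tsum_eq_single 0]
      · simp [bspline_two_one]
      · intro k hk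
        have h : bspline 2 (1 - k) = 0 := by
          rcases lt_or_gt_of_ne hk with hk | hk
          · apply bspline_eq_zero_of_ge (by norm_num)
            have : (k : ℝ) ≤ -1 := by exact_mod_cast (by omega : k ≤ -1)
            push_cast; linarith
          · apply bspline_eq_zero_of_nonpos (by norm_num)
            have : (1 : ℝ) ≤ k := by exact_mod_cast hk
            linarith
        rw [h, Complex.ofReal_zero, mul_zero]
    | succ r hr ih =>
      by_contra! h
      obtain ⟨x, hx⟩ := ih
      have h1 := hasDerivAt_zak hr θ x
      rw [show zak (r + 1) θ = fun _ => 0 from funext h] at h1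
      exact mul_ne_zero (sub_ne_zero.2 (Ne.symm hθ)) hx (h1.unique (hasDerivAt_const x _))

/-- For r ≥ 2 the integrand is continuous and, by quasi-periodicity, nonzero somewhere in [0,1].
Order 1 is discontinuous, but there the modulus is 1 almost everywhere. -/
theorem integral_normSq_zak_pos {r : ℕ} (hr : 1 ≤ r) (θ : ℝ) :
    0 < ∫ x in (0 : ℝ)..1, Complex.normSq (zak r θ x) := by
  rcases hr.eq_or_lt with rfl | hr
  · have h : ∀ᵐ x : ℝ, x ∈ Set.uIoc (0 : ℝ) 1 → Complex.normSq (zak 1 θ x) = 1 := by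
      have h1 : ∀ᵐ x : ℝ, x ≠ 1 := by simp [ae_iff]
      filter_upwards [h1] with x hx1 hx
      rw [Set.uIoc_of_le zero_le_one] at hx
      have hx2 := lt_of_le_of_ne hx.2 hx1
      rw [zak, tsum_eq_single 0]
      · simp [bspline_one, hx.1.le, hx2]
      · intro k hk
        rw [bspline_one, Set.indicator_of_notMem, Complex.ofReal_zero, mul_zero]
        rintro ⟨h2, h3⟩
        have h4 : (k : ℝ) < (1 : ℤ) := by push_cast; linarith
        have h5 : ((-1 : ℤ) : ℝ) < k := by push_cast; linarith [hx.1]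
        rw [Int.cast_lt] at h4 h5
        omega
    rw [intervalIntegral.integral_congr_ae h]
    simp
  · have hc := continuous_zak (show 2 ≤ r from hr) θ
    obtain ⟨x, hx⟩ := exists_zak_ne_zero (show 2 ≤ r from hr) θ
    refine intervalIntegral.integral_pos zero_lt_one
      (Complex.continuous_normSq.comp hc).continuousOn (fun _ _ => Complex.normSq_nonneg _)
      ⟨Int.fract x, ⟨Int.fract_nonneg x, (Int.fract_lt_one x).le⟩, ?_⟩
    have := zak_add_int (r := r) θ (Int.fract x) ⌊x⌋
    rw [Int.fract_add_floor] at this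
    rw [Complex.normSq_pos]
    exact fun h => hx (by rw [this, h, mul_zero])

/-- The B-spline of order `2m`, centered at the origin. -/
noncomputable def centered (m : ℕ) (x : ℝ) : ℝ := bspline (2 * m) (x + m)

/-- The samples of the centered B-spline at the integers. -/
noncomputable def samples (m : ℕ) (k : ℤ) : ℝ := centered m k

theorem samples_eq_zero {m : ℕ} (hm : 1 ≤ m) {k : ℤ} (hk : k ∉ Finset.Icc (-m : ℤ) m) :
    samples m k = 0 := by
  rw [Finset.mem_Icc, not_and_or, not_le, not_le] at hk
  rw [samples, centered]
  rcases hk with hk | hk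
  · apply bspline_eq_zero_of_neg (by omega)
    have : (k : ℝ) < ((-m : ℤ) : ℝ) := by exact_mod_cast hk
    push_cast at this
    linarith
  · apply bspline_eq_zero_of_ge (by omega)
    have : ((m : ℤ) : ℝ) < k := by exact_mod_cast hk
    push_cast at this ⊢
    linarith

/-- N_{2m} = N_m * N_m, and the reflection of N_m turns the convolution into an autocorrelation;
this is the source of positivity of the symbol. -/
theorem samples_eq_integral {m : ℕ} (hm : 1 ≤ m) (k : ℤ) :
    samples m k = ∫ t, bspline m t * bspline m (t - k) := by
  rw [samples, centered, two_mul, ← integral_bspline_mul_bspline hm hm]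
  have h := (measurePreserving_sub_right volume (k : ℝ)).quasiMeasurePreserving.ae
    (bspline_reflect_ae hm)
  refine integral_congr_ae (h.mono fun t ht => ?_)
  simp only at ht ⊢
  rw [← ht]
  congr 2; ring

/-- The autocorrelation formula gives the symbol as ∫ N_m Z over ℝ. Cutting ℝ into unit intervals
and using the quasi-periodicity of Z gathers the translates of N_m into the conjugate of Z. -/
theorem symbol_samples {m : ℕ} (hm : 1 ≤ m) (θ : ℝ) :
    symbol (samples m) θ = ((∫ x in (0 : ℝ)..1, Complex.normSq (zak m θ x) : ℝ) : ℂ) := by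
  have hmeas := measurable_bspline hm
  have hi : ∀ k : ℤ, Integrable fun t => bspline m t * bspline m (t - k) := fun k =>
    (integrable_bspline hm).mul_bdd (c := 1)
      (hmeas.comp (by fun_prop)).aestronglyMeasurable
      (ae_of_all _ fun x => norm_bspline_le_one hm _)
  have hz : ∀ t : ℝ, (bspline m t : ℂ) * zak m θ t = ∑ k ∈ Finset.Icc (-m : ℤ) m,
      Complex.exp (Complex.I * k * θ) * ((bspline m t * bspline m (t - k) : ℝ) : ℂ) := by
    intro t
    by_cases ht : bspline m t = 0
    · simp [ht]
    · have ht' := support_bspline_subset hm ht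
      rw [zak_eq_sum (a := 0) (b := m) hm θ (by simpa using ht'.1)
        (by push_cast; linarith [ht'.2]), Finset.mul_sum, zero_sub]
      refine Finset.sum_congr rfl fun k _ => ?_
      push_cast; ring
  have hzi : Integrable fun t : ℝ => (bspline m t : ℂ) * zak m θ t := by
    simp_rw [hz]
    exact integrable_finsetSum _ fun k _ => (hi k).ofReal.const_mul _
  have h1 : symbol (samples m) θ = ∫ t : ℝ, (bspline m t : ℂ) * zak m θ t := by
    rw [symbol_eq_sum fun k hk => samples_eq_zero hm hk]
    simp_rw [hz]
    rw [integral_finsetSum _ fun k _ => (hi k).ofReal.const_mul _]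
    refine Finset.sum_congr rfl fun k _ => ?_
    rw [integral_const_mul, integral_complex_ofReal, samples_eq_integral hm, mul_comm]
  have h2 : ∫ t : ℝ, (bspline m t : ℂ) * zak m θ t =
      ∑ n ∈ Finset.range m, ∫ t in (n : ℝ)..((n + 1 : ℕ) : ℝ), (bspline m t : ℂ) * zak m θ t := by
    rw [intervalIntegral.sum_integral_adjacent_intervals
      (a := fun n : ℕ => (n : ℝ)) fun k _ => hzi.intervalIntegrable,
      intervalIntegral.integral_of_le (by simp), ← integral_Ico_eq_integral_Ioc,
      setIntegral_eq_integral_of_forall_compl_eq_zero]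
    intro t ht
    have : bspline m t = 0 := by
      by_contra h
      exact ht (by simpa using support_bspline_subset hm h)
    rw [this, Complex.ofReal_zero, zero_mul]
  have h3 : ∀ n : ℕ, ∫ t in (n : ℝ)..((n + 1 : ℕ) : ℝ), (bspline m t : ℂ) * zak m θ t =
      ∫ t in (0 : ℝ)..1,
        Complex.exp (Complex.I * n * θ) * (bspline m (t + n) : ℂ) * zak m θ t := fun n => by
    have := intervalIntegral.integral_comp_add_right (a := 0) (b := 1)
      (fun t => (bspline m t : ℂ) * zak m θ t) (n : ℝ)
    rw [zero_add, add_comm (1 : ℝ)] at this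
    push_cast
    rw [← this]
    refine intervalIntegral.integral_congr fun t _ => ?_
    have := zak_add_int (r := m) θ t n
    push_cast at this
    simp only [this]
    ring
  have h4 : ∀ n : ℕ, IntervalIntegrable (fun t : ℝ =>
      Complex.exp (Complex.I * n * θ) * (bspline m (t + n) : ℂ) * zak m θ t) volume 0 1 :=
    fun n => by
    have := (hzi.comp_add_right (n : ℝ)).intervalIntegrable (a := 0) (b := 1)
    refine this.congr fun t _ => ?_
    have := zak_add_int (r := m) θ t n
    push_cast at this
    simp only [this]
    ring
  rw [h1, h2]
  simp_rw [h3]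
  rw [← intervalIntegral.integral_finsetSum fun n _ => h4 n, ← intervalIntegral.integral_ofReal]
  have h5 : ∀ᵐ x : ℝ, x ≠ 1 := by simp [ae_iff]
  refine intervalIntegral.integral_congr_ae (h5.mono fun t ht1 ht => ?_)
  rw [Set.uIoc_of_le zero_le_one] at ht
  have ht2 := lt_of_le_of_ne ht.2 ht1
  rw [← Finset.sum_mul, Complex.normSq_eq_conj_mul_self]
  congr 1
  -- After k ↦ -k, only the translates 0 ≤ k < m survive for t in (0,1).
  rw [zak, Complex.conj_tsum, ← (Equiv.neg ℤ).tsum_eq, tsum_eq_sum (s := (Finset.range m).map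
    ⟨fun n : ℕ => (n : ℤ), Nat.cast_injective⟩)]
  · rw [Finset.sum_map]
    refine Finset.sum_congr rfl fun n _ => ?_
    simp only [Function.Embedding.coeFn_mk, Equiv.neg_apply, map_mul, Complex.conj_ofReal,
      ← Complex.exp_conj, Complex.conj_I]
    push_cast
    simp
  · intro k hk
    have : bspline m (t - ((-k : ℤ) : ℝ)) = 0 := by
      by_contra h
      have h6 := support_bspline_subset hm h
      push_cast at h6
      have h7 : ((-1 : ℤ) : ℝ) < k := by push_cast; linarith [h6.1]
      have h8 : (k : ℝ) < (m : ℤ) := by push_cast; linarith [h6.2, ht.1]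
      rw [Int.cast_lt] at h7 h8
      refine hk (Finset.mem_map.2 ⟨k.toNat, Finset.mem_range.2 (by omega), ?_⟩)
      simp; omega
    simp only [Equiv.neg_apply, this]
    simp

theorem symbol_samples_ne_zero {m : ℕ} (hm : 1 ≤ m) (θ : ℝ) : symbol (samples m) θ ≠ 0 := by
  rw [symbol_samples hm, Complex.ofReal_ne_zero]
  exact (integral_normSq_zak_pos hm θ).ne'

/-! ### The cardinal spline function -/

theorem centered_nonneg {m : ℕ} (hm : 1 ≤ m) (x : ℝ) : 0 ≤ centered m x :=
  bspline_nonneg (by omega) _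

theorem norm_centered_le_one {m : ℕ} (hm : 1 ≤ m) (x : ℝ) : ‖centered m x‖ ≤ 1 :=
  norm_bspline_le_one (by omega) _

theorem centered_neg {m : ℕ} (hm : 1 ≤ m) (x : ℝ) : centered m (-x) = centered m x := by
  rw [centered, centered, ← bspline_reflect (by omega)]
  congr 1; push_cast; ring

theorem centered_eq_zero {m : ℕ} (hm : 1 ≤ m) {x : ℝ} (hx : (m : ℝ) ≤ |x|) :
    centered m x = 0 := by
  rcases le_abs.1 hx with h | h
  · exact bspline_eq_zero_of_ge (by omega) (by push_cast; linarith)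
  · exact bspline_eq_zero_of_nonpos (by omega) (by linarith)

theorem summable_centered_sub {m : ℕ} (hm : 1 ≤ m) (x : ℝ) :
    Summable fun k : ℤ => centered m (x - k) := by
  simp_rw [centered, sub_add_eq_add_sub]
  exact summable_bspline_sub (by omega) _

theorem tsum_centered_sub {m : ℕ} (hm : 1 ≤ m) (x : ℝ) :
    ∑' k : ℤ, centered m (x - k) = 1 := by
  simp_rw [centered, sub_add_eq_add_sub]
  exact tsum_bspline_sub (by omega) _

theorem samples_neg {m : ℕ} (hm : 1 ≤ m) (k : ℤ) : samples m (-k) = samples m k := by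
  rw [samples, samples, Int.cast_neg, centered_neg hm]

theorem finite_support_samples {m : ℕ} (hm : 1 ≤ m) : (Function.support (samples m)).Finite :=
  (Finset.Icc (-m : ℤ) m).finite_toSet.subset fun _ hk => by
    by_contra h
    exact hk (samples_eq_zero hm h)

theorem summable_samples {m : ℕ} (hm : 1 ≤ m) : Summable (samples m) :=
  summable_of_hasFiniteSupport (finite_support_samples hm)

theorem cardinalCoeff_eq (m : ℕ) : cardinalCoeff (2 * m) = convInverse (samples m) := by
  rw [cardinalCoeff]
  congr 1
  funext k
  rw [samples, centered]
  congr 1; push_cast; ring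

theorem summable_cardinalCoeff {m : ℕ} (hm : 1 ≤ m) : Summable (cardinalCoeff (2 * m)) := by
  rw [cardinalCoeff_eq]
  exact summable_convInverse (finite_support_samples hm) (symbol_samples_ne_zero hm)

theorem conv_samples_cardinalCoeff {m : ℕ} (hm : 1 ≤ m) :
    conv (samples m) (cardinalCoeff (2 * m)) = Pi.single 0 1 := by
  rw [cardinalCoeff_eq]
  exact conv_convInverse (finite_support_samples hm) (symbol_samples_ne_zero hm)

theorem cardinalSpline_eq_conv (m : ℕ) :
    cardinalSpline (2 * m) = conv (cardinalCoeff (2 * m)) (centered m) := by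
  funext x
  rw [cardinalSpline, conv]
  refine tsum_congr fun n => ?_
  rw [centered, smul_eq_mul]
  congr 2; push_cast; ring

theorem norm_cardinalSpline_le {m : ℕ} (hm : 1 ≤ m) (x : ℝ) :
    ‖cardinalSpline (2 * m) x‖ ≤ ∑' n, |cardinalCoeff (2 * m) n| := by
  rw [cardinalSpline_eq_conv]
  simpa using norm_conv_le (summable_cardinalCoeff hm) (norm_centered_le_one hm) x

/-- Convolution with the samples is inverted by convolution with the cardinal coefficients. -/
theorem conv_samples_conv_cardinalCoeff {m : ℕ} (hm : 1 ≤ m) {φ : ℝ → ℝ} {C : ℝ}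
    (hφ : ∀ x, ‖φ x‖ ≤ C) : conv (samples m) (conv (cardinalCoeff (2 * m)) φ) = φ := by
  rw [← conv_assoc (summable_samples hm) (summable_cardinalCoeff hm) hφ,
    conv_samples_cardinalCoeff hm, single_conv]

theorem conv_cardinalCoeff_conv_samples {m : ℕ} (hm : 1 ≤ m) {φ : ℝ → ℝ} {C : ℝ}
    (hφ : ∀ x, ‖φ x‖ ≤ C) : conv (cardinalCoeff (2 * m)) (conv (samples m) φ) = φ := by
  rw [conv_left_comm (summable_cardinalCoeff hm) (summable_samples hm) hφ,
    conv_samples_conv_cardinalCoeff hm hφ]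

theorem conv_samples_cardinalSpline {m : ℕ} (hm : 1 ≤ m) :
    conv (samples m) (cardinalSpline (2 * m)) = centered m := by
  rw [cardinalSpline_eq_conv, conv_samples_conv_cardinalCoeff hm (norm_centered_le_one hm)]

theorem hasSum_mul_prod {u v : ℤ → ℝ} {a b : ℝ} (hu : HasSum u a) (hv : HasSum v b) :
    HasSum (fun p : ℤ × ℤ => u p.1 * v p.2) (a * b) :=
  hu.mul hv (summable_mul_of_summable_norm hu.summable.norm hv.summable.norm)

/-- Summing over p first leaves u_n times the partition of unity. Used with u = c for the partition
of unity of L, and with u a truncation of |c| for the tail estimates. -/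
theorem hasSum_mul_centered {m : ℕ} (hm : 1 ≤ m) {u : ℤ → ℝ} (hu : Summable u) (t : ℝ) :
    HasSum (fun p : ℤ × ℤ => u p.2 * centered m (t - p.1 - p.2)) (∑' n, u n) := by
  let e : ℤ × ℤ ≃ ℤ × ℤ :=
    { toFun := fun p => (p.2, p.1 + p.2), invFun := fun p => (p.2 - p.1, p.1),
      left_inv := fun p => by simp, right_inv := fun p => by simp }
  have h0 : HasSum (fun k : ℤ => centered m (t - k)) 1 := by
    rw [← tsum_centered_sub hm t]
    exact (summable_centered_sub hm t).hasSum
  have h1 := hasSum_mul_prod hu.hasSum h0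
  rw [mul_one, ← e.hasSum_iff] at h1
  convert h1 using 2 with p
  simp [e, sub_sub]

theorem hasSum_cardinalSpline_sub {m : ℕ} (hm : 1 ≤ m) (t : ℝ) :
    HasSum (fun p : ℤ => cardinalSpline (2 * m) (t - p)) 1 := by
  -- This is the inversion relation for symbols at θ = 0, where the symbol of the samples is 1.
  have h0 : ∑' n, cardinalCoeff (2 * m) n = 1 := by
    have h := symbol_conv (summable_samples hm) (summable_cardinalCoeff hm) 0
    rw [conv_samples_cardinalCoeff hm] at h
    have h1 : symbol (samples m) 0 = 1 := by
      simp only [symbol, Complex.ofReal_zero, mul_zero, Complex.exp_zero, mul_one]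
      rw [← Complex.ofReal_tsum]
      have := tsum_centered_sub hm 0
      rw [← (Equiv.neg ℤ).tsum_eq] at this
      simp only [samples]
      simp only [Equiv.neg_apply, Int.cast_neg, zero_sub, neg_neg] at this
      rw [this, Complex.ofReal_one]
    have h2 : symbol (Pi.single 0 1) 0 = 1 := by
      rw [symbol, tsum_eq_single 0]
      · simp
      · intro k hk; simp [hk]
    rw [h1, h2, one_mul] at h
    simp only [symbol, Complex.ofReal_zero, mul_zero, Complex.exp_zero, mul_one] at h
    rw [← Complex.ofReal_tsum] at h
    exact_mod_cast h.symm
  have h1 := hasSum_mul_centered hm (summable_cardinalCoeff hm) t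
  rw [h0] at h1
  refine h1.prod_fiberwise fun p => ?_
  rw [cardinalSpline_eq_conv]
  exact (summable_conv (summable_cardinalCoeff hm) (norm_centered_le_one hm) (t - p)).hasSum

/-- In L(t - p) = ∑_n c_n N(t - p - n), with N the centered B-spline, only n with |t - p - n| < m
count, which forces |n| ≥ R - m. The partition of unity then removes the sum over p. -/
theorem sum_abs_cardinalSpline_sub_le {m : ℕ} (hm : 1 ≤ m) {R : ℝ} (t : ℝ) (P : Finset ℤ)
    (hP : ∀ p ∈ P, R ≤ |t - p|) :
    ∑ p ∈ P, |cardinalSpline (2 * m) (t - p)| ≤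
      ∑' n : ℤ, if R - m ≤ |(n : ℝ)| then |cardinalCoeff (2 * m) n| else 0 := by
  set v : ℤ → ℝ := fun n => if R - m ≤ |(n : ℝ)| then |cardinalCoeff (2 * m) n| else 0
  have hv : Summable v := (summable_cardinalCoeff hm).abs.of_nonneg_of_le
    (fun n => by simp only [v]; split_ifs <;> positivity)
    (fun n => by simp only [v]; split_ifs; exacts [le_rfl, abs_nonneg _])
  have hv0 : ∀ n, 0 ≤ v n := fun n => by simp only [v]; split_ifs <;> positivity
  have h1 := hasSum_mul_centered hm hv t
  have h2 : ∀ p : ℤ, HasSum (fun n : ℤ => v n * centered m (t - p - n))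
      (∑' n : ℤ, v n * centered m (t - p - n)) := fun p =>
    (summable_conv hv (norm_centered_le_one hm) (t - p)).hasSum
  have h3 := h1.prod_fiberwise h2
  refine le_trans ?_ (sum_le_hasSum P (fun p _ => tsum_nonneg fun n =>
    mul_nonneg (hv0 n) (centered_nonneg hm _)) h3)
  refine Finset.sum_le_sum fun p hp => ?_
  rw [cardinalSpline_eq_conv, conv, ← Real.norm_eq_abs]
  refine tsum_of_norm_bounded (h2 p) fun n => ?_
  rw [norm_smul, Real.norm_of_nonneg (centered_nonneg hm _), Real.norm_eq_abs]
  by_cases hn : (m : ℝ) ≤ |t - p - n|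
  · rw [centered_eq_zero hm hn, mul_zero, mul_zero]
  · refine mul_le_mul_of_nonneg_right ?_ (centered_nonneg hm _)
    have : R - m ≤ |(n : ℝ)| := by
      have h4 := abs_sub_abs_le_abs_sub (t - p) n
      have h5 := hP p hp
      linarith [not_le.1 hn]
    simp only [v, if_pos this, le_refl]

/-- The absolute values of the integer translates of the cardinal spline have bounded sums. -/
theorem exists_sum_abs_cardinalSpline_sub_le {m : ℕ} (hm : 1 ≤ m) :
    ∃ A : ℝ, 1 ≤ A ∧ ∀ (t : ℝ) (P : Finset ℤ), ∑ p ∈ P, |cardinalSpline (2 * m) (t - p)| ≤ A :=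
  -- For R = 0 the cut-off is void. The bound 1 ≤ A allows a factor τ to be replaced by A τ in the
  -- tensor tail estimate.
  ⟨max 1 _, le_max_left _ _, fun t P =>
    (sum_abs_cardinalSpline_sub_le hm (R := 0) t P fun _ _ => abs_nonneg _).trans
      (le_max_right _ _)⟩

/-- The tails of these sums are uniformly small. -/
theorem exists_tail_cardinalSpline_sub_le {m : ℕ} (hm : 1 ≤ m) {ε : ℝ} (hε : 0 < ε) :
    ∃ R : ℝ, ∀ (t : ℝ) (P : Finset ℤ), (∀ p ∈ P, R ≤ |t - p|) →
      ∑ p ∈ P, |cardinalSpline (2 * m) (t - p)| ≤ ε := by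
  have hs := (summable_cardinalCoeff hm).abs
  obtain ⟨S, hS⟩ := (hs.vanishing (Metric.ball_mem_nhds (0 : ℝ) hε))
  obtain ⟨M, hM⟩ : ∃ M : ℝ, ∀ n ∈ S, |(n : ℝ)| < M := by
    obtain ⟨M, hM⟩ := (S.image fun n : ℤ => |(n : ℝ)|).exists_le
    exact ⟨M + 1, fun n hn => by
      linarith [hM _ (Finset.mem_image_of_mem (fun n : ℤ => |(n : ℝ)|) hn)]⟩
  -- The summand m offsets the half-width of the support of the centered B-spline.
  refine ⟨M + m, fun t P hP => (sum_abs_cardinalSpline_sub_le hm t P hP).trans ?_⟩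
  refine Real.tsum_le_of_sum_le (fun n => by split_ifs <;> positivity) fun T => ?_
  rw [← Finset.sum_filter]
  have h2 := hS (T.filter fun n : ℤ => M + m - m ≤ |(n : ℝ)|) (by
    rw [Finset.disjoint_left]
    intro n hn hn'
    have := (Finset.mem_filter.1 hn).2
    linarith [hM n hn'])
  rw [mem_ball_zero_iff, Real.norm_eq_abs] at h2
  exact (le_abs_self _).trans h2.le

/-! ### Refinement -/

/-- The samples of the centered B-spline at the half integers. -/
noncomputable def halfSamples (m : ℕ) (j : ℤ) : ℝ := centered m ((j : ℝ) / 2)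

/-- The samples of the centered B-spline with alternating signs. -/
noncomputable def altSamples (m : ℕ) (j : ℤ) : ℝ := (j.negOnePow : ℤ) * samples m j

theorem halfSamples_two_mul (m : ℕ) (j : ℤ) : halfSamples m (2 * j) = samples m j := by
  rw [halfSamples, samples]
  congr 1; push_cast; ring

theorem halfSamples_neg {m : ℕ} (hm : 1 ≤ m) (j : ℤ) : halfSamples m (-j) = halfSamples m j := by
  rw [halfSamples, halfSamples, Int.cast_neg, neg_div, centered_neg hm]

theorem halfSamples_eq_zero {m : ℕ} (hm : 1 ≤ m) {j : ℤ}
    (hj : j ∉ Finset.Icc (-(2 * m) : ℤ) (2 * m)) : halfSamples m j = 0 := by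
  rw [halfSamples]
  apply centered_eq_zero hm
  rw [Finset.mem_Icc, not_and_or, not_le, not_le] at hj
  rw [le_abs]
  rcases hj with hj | hj
  · right
    have : (j : ℝ) < ((-(2 * m) : ℤ) : ℝ) := by exact_mod_cast hj
    push_cast at this
    linarith
  · left
    have : (((2 * m) : ℤ) : ℝ) < (j : ℝ) := by exact_mod_cast hj
    push_cast at this
    linarith

theorem summable_halfSamples {m : ℕ} (hm : 1 ≤ m) : Summable (halfSamples m) :=
  summable_of_hasFiniteSupport ((Finset.Icc (-(2 * m) : ℤ) (2 * m)).finite_toSet.subset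
    fun _ hk => by
      by_contra h
      exact hk (halfSamples_eq_zero hm h))

theorem centered_two_scale {m : ℕ} (hm : 1 ≤ m) (y : ℝ) :
    2 ^ (2 * m - 1) * centered m y =
      ∑ i ∈ Finset.range (2 * m + 1), ((2 * m).choose i : ℝ) * centered m (2 * y + m - i) := by
  rw [centered, bspline_two_scale (by omega)]
  refine Finset.sum_congr rfl fun i _ => ?_
  rw [centered]
  congr 2; ring

/-- The centered B-spline interpolates its own samples at the half integers. -/
theorem conv_halfSamples_cardinalSpline {m : ℕ} (hm : 1 ≤ m) (y : ℝ) :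
    conv (halfSamples m) (cardinalSpline (2 * m)) (2 * y) = centered m y := by
  have hL := norm_cardinalSpline_le hm
  have h0 : (2 : ℝ) ^ (2 * m - 1) ≠ 0 := by positivity
  refine mul_left_cancel₀ h0 ?_
  rw [centered_two_scale hm, conv, ← tsum_mul_left]
  -- The two-scale relation is used twice: at 2y, where each translate is resummed as E ⋆ L, and at
  -- j/2, where the resulting coefficients are recognised as half-integer samples.
  have h1 : ∀ j : ℤ, (2 : ℝ) ^ (2 * m - 1) *
      halfSamples m j • cardinalSpline (2 * m) (2 * y - j) =
      ∑ i ∈ Finset.range (2 * m + 1), ((2 * m).choose i : ℝ) *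
        (samples m (j + m - i) * cardinalSpline (2 * m) (2 * y - j)) := fun j => by
    rw [smul_eq_mul, ← mul_assoc, halfSamples, centered_two_scale hm, Finset.sum_mul]
    refine Finset.sum_congr rfl fun i _ => ?_
    rw [samples, mul_assoc]
    congr 3; push_cast; ring
  have h2 : ∀ i : ℕ, HasSum (fun j : ℤ =>
      samples m (j + m - i) * cardinalSpline (2 * m) (2 * y - j))
      (centered m (2 * y + m - i)) := fun i => by
    rw [← conv_samples_cardinalSpline hm]
    have h3 : (fun j : ℤ => samples m (j + m - i) * cardinalSpline (2 * m) (2 * y - j)) =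
        (fun n : ℤ => samples m n • cardinalSpline (2 * m) (2 * y + m - i - n)) ∘
          Equiv.addRight ((m : ℤ) - i) := by
      funext j
      simp only [Function.comp, Equiv.coe_addRight, smul_eq_mul]
      congr 2
      · ring
      · push_cast; ring
    rw [h3]
    exact (Equiv.hasSum_iff _).2
      (summable_conv (summable_samples hm) hL (2 * y + m - i)).hasSum
  simp_rw [h1]
  exact (hasSum_sum fun i _ => (h2 i).mul_left _).tsum_eq

/-- The substitution n ↦ j - n changes the sign of every term when j is odd. This cancellation makes
products of alternating and plain samples live on the even integers. -/
theorem conv_altSamples_samples_of_odd {m : ℕ} {j : ℤ} (hj : Odd j) :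
    conv (altSamples m) (samples m) j = 0 := by
  have h : conv (altSamples m) (samples m) j = -conv (altSamples m) (samples m) j := by
    conv_lhs => rw [conv, ← (Equiv.subLeft j).tsum_eq]
    rw [conv, ← tsum_neg]
    refine tsum_congr fun n => ?_
    rw [Equiv.subLeft_apply, altSamples, altSamples, Int.cast_id, Int.cast_id, sub_sub_cancel,
      smul_eq_mul, smul_eq_mul, Int.negOnePow_sub, Int.negOnePow_odd j hj]
    push_cast
    ring
  linarith

theorem summable_altSamples {m : ℕ} (hm : 1 ≤ m) : Summable (altSamples m) :=
  summable_of_hasFiniteSupport ((finite_support_samples hm).subset fun k hk h => hk (by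
    simp [altSamples, h]))

/-- The substitution l = j + m - 1 centers the B-spline; the range of l covers all nonzero samples,
so the sum may run over ℤ. -/
theorem sum_alternating_bspline {m : ℕ} (hm : 1 ≤ m) (h : ℤ → ℝ) :
    ∑ l ∈ Finset.range (2 * m - 1), (-1) ^ l * bspline (2 * m) ((l : ℝ) + 1) * h l =
      (-1) ^ (m + 1) * ∑' j : ℤ, altSamples m j * h (j + m - 1) := by
  have h1 : ∑ l ∈ Finset.range (2 * m - 1), (-1) ^ l * bspline (2 * m) ((l : ℝ) + 1) * h l =
      ∑' l : ℤ, (l.negOnePow : ℤ) * bspline (2 * m) ((l : ℝ) + 1) * h l := by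
    rw [tsum_eq_sum (s := (Finset.range (2 * m - 1)).map
      ⟨fun n : ℕ => (n : ℤ), Nat.cast_injective⟩)]
    · rw [Finset.sum_map]
      refine Finset.sum_congr rfl fun l _ => ?_
      simp [Int.negOnePow]
    · intro l hl
      have : bspline (2 * m) ((l : ℝ) + 1) = 0 := by
        rcases lt_or_ge l 0 with h0 | h0
        · apply bspline_eq_zero_of_nonpos (by omega)
          have : (l : ℝ) ≤ ((-1 : ℤ) : ℝ) := by exact_mod_cast (by omega : l ≤ -1)
          push_cast at this
          linarith
        · apply bspline_eq_zero_of_ge (by omega)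
          have h2 : 2 * m - 1 ≤ l.toNat := by
            by_contra h2
            exact hl (Finset.mem_map.2 ⟨l.toNat, Finset.mem_range.2 (by omega), by simp; omega⟩)
          have : (((2 * m : ℕ) : ℤ) : ℝ) ≤ ((l + 1 : ℤ) : ℝ) := by
            rw [Int.cast_le]; omega
          push_cast at this ⊢
          linarith
      rw [this, mul_zero, zero_mul]
  rw [h1, ← tsum_mul_left, ← (Equiv.addRight ((m : ℤ) - 1)).tsum_eq]
  refine tsum_congr fun j => ?_
  simp only [Equiv.coe_addRight]
  rw [altSamples, samples, centered, Int.negOnePow_add, Int.negOnePow_sub, ← add_sub_assoc]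
  have h2 : ((j + m - 1 : ℤ) : ℝ) + 1 = j + m := by push_cast; ring
  rw [h2]
  have h3 : ((((m : ℤ).negOnePow : ℤˣ) : ℤ) : ℝ) = (-1) ^ m := by simp [Int.negOnePow]
  push_cast
  rw [h3]
  simp [pow_succ]
  ring

/-- The signs combine to (-1)^{l+i}, so collecting terms with l + i fixed leaves a binomial sum of
samples, which the two-scale relation evaluates as a half-integer sample. This one identity drives
both the Gram sequence and the coefficient functionals. -/
theorem sum_alternating_bspline_diff {m : ℕ} (hm : 1 ≤ m) (h : ℤ → ℝ) :
    ∑ l ∈ Finset.range (2 * m - 1), (-1) ^ l * bspline (2 * m) ((l : ℝ) + 1) *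
      ∑ i ∈ Finset.range (2 * m + 1), (-1) ^ i * ((2 * m).choose i : ℝ) * h (l + i) =
      -2 ^ (2 * m - 1) * ∑' j : ℤ, (j.negOnePow : ℤ) * halfSamples m j * h (j + 2 * m - 1) := by
  rw [sum_alternating_bspline hm fun l => ∑ i ∈ Finset.range (2 * m + 1),
    (-1) ^ i * ((2 * m).choose i : ℝ) * h (l + i), ← tsum_mul_left, ← tsum_mul_left]
  have h1 : ∀ i : ℕ, HasSum (fun j : ℤ => -((j.negOnePow : ℤ) : ℝ) *
      (((2 * m).choose i : ℝ) * samples m (j + m - i)) * h (j + 2 * m - 1))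
      (∑' j : ℤ, (-1) ^ (m + 1) * (altSamples m j *
        ((-1) ^ i * ((2 * m).choose i : ℝ) * h (j + m - 1 + i)))) := fun i => by
    have hs : Summable fun j : ℤ => (-1) ^ (m + 1) * (altSamples m j *
        ((-1) ^ i * ((2 * m).choose i : ℝ) * h (j + m - 1 + i))) :=
      summable_of_hasFiniteSupport ((finite_support_samples hm).subset fun k hk h => hk (by
        simp [altSamples, h]))
    have := hs.hasSum
    rw [← (Equiv.addRight ((m : ℤ) - i)).hasSum_iff] at this
    convert this using 2 with j
    simp only [Function.comp, Equiv.coe_addRight, altSamples, Int.negOnePow_add,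
      Int.negOnePow_sub]
    have h3 : ∀ n : ℕ, ((((n : ℤ).negOnePow : ℤˣ) : ℤ) : ℝ) = (-1) ^ n := fun n => by
      simp [Int.negOnePow]
    push_cast
    rw [h3, h3, show j + ((m : ℤ) - i) + m - 1 + i = j + 2 * m - 1 by ring, add_sub_assoc]
    have h4 : ∀ n : ℕ, ((-1 : ℝ) ^ n) * (-1) ^ n = 1 := fun n => by
      rw [← mul_pow]; simp
    rw [pow_succ]
    linear_combination (-((j.negOnePow : ℤ) : ℝ) *
      (((2 * m).choose i : ℝ) * samples m (j + (m - i))) * h (j + 2 * m - 1)) *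
      (-(h4 m) * ((-1) ^ i * (-1) ^ i) - h4 i)
  have h2 : ∀ j : ℤ, (-1) ^ (m + 1) * (altSamples m j * ∑ i ∈ Finset.range (2 * m + 1),
      (-1) ^ i * ((2 * m).choose i : ℝ) * h (j + m - 1 + i)) =
      ∑ i ∈ Finset.range (2 * m + 1), (-1) ^ (m + 1) * (altSamples m j *
        ((-1) ^ i * ((2 * m).choose i : ℝ) * h (j + m - 1 + i))) := fun j => by
    rw [Finset.mul_sum, Finset.mul_sum]
  simp_rw [h2]
  rw [Summable.tsum_finsetSum]
  · rw [← (hasSum_sum fun i _ => h1 i).tsum_eq]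
    refine tsum_congr fun j => ?_
    rw [← Finset.sum_mul, ← Finset.mul_sum]
    have h3 : ∑ i ∈ Finset.range (2 * m + 1), ((2 * m).choose i : ℝ) * samples m (j + m - i) =
        2 ^ (2 * m - 1) * halfSamples m j := by
      rw [halfSamples, centered_two_scale hm]
      refine Finset.sum_congr rfl fun i _ => ?_
      rw [samples]
      congr 2; push_cast; ring
    rw [h3]
    ring
  · intro i _
    exact summable_of_hasFiniteSupport ((finite_support_samples hm).subset fun k hk h => hk (by
        simp [altSamples, h]))

/-! ### Backward differences of B-splines -/

/-- The `k`-th backward difference of the B-spline of order `r`. -/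
noncomputable def bdiff (r : ℕ) : ℕ → ℝ → ℝ
  | 0 => bspline r
  | k + 1 => fun x => bdiff r k x - bdiff r k (x - 1)

theorem bdiff_succ (r k : ℕ) (x : ℝ) : bdiff r (k + 1) x = bdiff r k x - bdiff r k (x - 1) := rfl

theorem bdiff_eq_sum (r k : ℕ) (x : ℝ) :
    bdiff r k x = ∑ i ∈ Finset.range (k + 1), (-1) ^ i * (k.choose i : ℝ) * bspline r (x - i) := by
  induction k generalizing x with
  | zero => simp [bdiff]
  | succ k ih =>
    have h := Finset.sum_choose_succ_mul (R := ℝ)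
      (fun i _ => (-1) ^ i * bspline r (x - i)) k
    have h1 : ∀ (n : ℕ) (y : ℝ) (i : ℕ), (-1) ^ i * (n.choose i : ℝ) * bspline r (y - i) =
        (n.choose i : ℝ) * ((-1) ^ i * bspline r (y - i)) := fun n y i => by ring
    rw [bdiff_succ, ih, ih]
    simp_rw [h1]
    rw [h, sub_eq_add_neg, ← Finset.sum_neg_distrib]
    congr 1
    refine Finset.sum_congr rfl fun i _ => ?_
    rw [sub_sub x 1, add_comm (1 : ℝ), pow_succ]
    push_cast
    ring

theorem measurable_bdiff {r : ℕ} (hr : 1 ≤ r) (k : ℕ) : Measurable (bdiff r k) := by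
  induction k with
  | zero => exact measurable_bspline hr
  | succ k ih => exact ih.sub (ih.comp (by fun_prop))

theorem norm_bdiff_le {r : ℕ} (hr : 1 ≤ r) (k : ℕ) (x : ℝ) : ‖bdiff r k x‖ ≤ 2 ^ k := by
  induction k generalizing x with
  | zero => simpa [bdiff] using norm_bspline_le_one hr x
  | succ k ih =>
    rw [bdiff_succ, pow_succ, mul_two]
    exact (norm_sub_le _ _).trans (add_le_add (ih _) (ih _))

theorem integrable_bdiff {r : ℕ} (hr : 1 ≤ r) (k : ℕ) : Integrable (bdiff r k) := by
  induction k with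
  | zero => exact integrable_bspline hr
  | succ k ih => exact ih.sub (ih.comp_sub_right 1)

theorem continuous_bdiff {r : ℕ} (hr : 2 ≤ r) (k : ℕ) : Continuous (bdiff r k) := by
  induction k with
  | zero => exact continuous_bspline hr
  | succ k ih => exact ih.sub (ih.comp (by fun_prop))

theorem bdiff_eq_zero_of_neg {r : ℕ} (hr : 1 ≤ r) (k : ℕ) {x : ℝ} (hx : x < 0) :
    bdiff r k x = 0 := by
  induction k generalizing x with
  | zero => exact bspline_eq_zero_of_neg hr hx
  | succ k ih => rw [bdiff_succ, ih hx, ih (by linarith), sub_zero]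

theorem bdiff_eq_zero_of_ge {r : ℕ} (hr : 1 ≤ r) (k : ℕ) {x : ℝ} (hx : (r + k : ℝ) ≤ x) :
    bdiff r k x = 0 := by
  induction k generalizing x with
  | zero => exact bspline_eq_zero_of_ge hr (by simpa using hx)
  | succ k ih =>
    push_cast at hx
    rw [bdiff_succ, ih (by linarith), ih (by linarith), sub_zero]

theorem continuousAt_bspline_of_notInt {r : ℕ} (hr : 1 ≤ r) {x : ℝ}
    (hx : x ∉ Set.range ((↑) : ℤ → ℝ)) : ContinuousAt (bspline r) x := by
  rcases hr.eq_or_lt with rfl | hr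
  · exact continuousAt_bspline_one (fun h => hx ⟨0, by simp [h]⟩) (fun h => hx ⟨1, by simp [h]⟩)
  · exact (continuous_bspline hr).continuousAt

theorem sub_one_notInt {x : ℝ} (hx : x ∉ Set.range ((↑) : ℤ → ℝ)) :
    x - 1 ∉ Set.range ((↑) : ℤ → ℝ) := by
  rintro ⟨n, hn⟩
  exact hx ⟨n + 1, by push_cast; linarith⟩

theorem hasDerivAt_bdiff {r : ℕ} (hr : 1 ≤ r) (k : ℕ) {x : ℝ}
    (hx : x ∉ Set.range ((↑) : ℤ → ℝ)) :
    HasDerivAt (bdiff (r + 1) k) (bdiff r (k + 1) x) x := by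
  induction k generalizing x with
  | zero =>
    exact hasDerivAt_bspline_succ hr (continuousAt_bspline_of_notInt hr hx)
      (continuousAt_bspline_of_notInt hr (sub_one_notInt hx))
  | succ k ih =>
    exact (ih hx).sub (HasDerivAt.comp_sub_const x 1 (ih (sub_one_notInt hx)))

/-- Each derivative trades one order of the spline for one difference. The integers are excluded
because N_1 jumps there; their complement is open, so the inductive identity can be differentiated.
-/
theorem iteratedDeriv_bspline {r : ℕ} (hr : 1 ≤ r) (k : ℕ) {x : ℝ}
    (hx : x ∉ Set.range ((↑) : ℤ → ℝ)) :
    iteratedDeriv k (bspline (r + k)) x = bdiff r k x := by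
  induction k generalizing r x with
  | zero => simp [bdiff]
  | succ k ih =>
    have h : iteratedDeriv k (bspline (r + (k + 1))) =ᶠ[𝓝 x] bdiff (r + 1) k := by
      have ho : IsOpen (Set.range ((↑) : ℤ → ℝ))ᶜ :=
        Int.isClosedEmbedding_coe_real.isClosed_range.isOpen_compl
      filter_upwards [ho.mem_nhds hx] with y hy
      rw [show r + (k + 1) = r + 1 + k by ring]
      exact ih (by omega) hy
    rw [iteratedDeriv_succ, h.deriv_eq, (hasDerivAt_bdiff hr k hx).deriv]

theorem setIntegral_Iic_eq_of_neg {g : ℝ → ℝ} (hg : ∀ t < 0, g t = 0) {a x : ℝ} (ha : a < 0)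
    (hax : a ≤ x) : ∫ t in Set.Iic x, g t = ∫ t in a..x, g t := by
  rw [intervalIntegral.integral_of_le hax]
  refine setIntegral_eq_of_subset_of_forall_sdiff_eq_zero measurableSet_Iic
    Set.Ioc_subset_Iic_self fun t ht => hg t ?_
  by_contra h
  exact ht.2 ⟨by linarith, ht.1⟩

/-- The `k`-fold integral of the `k`-th difference of a B-spline of order `r` is the B-spline of
order `r + k`. -/
theorem setIntegral_Iic_bdiff {r : ℕ} (hr : 1 ≤ r) (k : ℕ) (x : ℝ) :
    ∫ t in Set.Iic x, bdiff r (k + 1) t / (k.factorial : ℝ) * (x - t) ^ k =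
      bspline (r + k + 1) x := by
  induction k generalizing r with
  | zero =>
    simp only [Nat.factorial_zero, Nat.cast_one, div_one, pow_zero, mul_one, bdiff,
      add_zero]
    have hi := integrable_bspline hr
    rw [integral_sub hi.integrableOn (hi.comp_sub_right 1).integrableOn]
    have h : ∫ t in Set.Iic x, bspline r (t - 1) = ∫ t in Set.Iic (x - 1), bspline r t := by
      rw [← integral_indicator measurableSet_Iic, ← integral_indicator measurableSet_Iic,
        ← integral_sub_right_eq_self (Set.indicator (Set.Iic (x - 1)) (bspline r)) 1]
      refine integral_congr_ae (ae_of_all _ fun t => ?_)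
      simp [Set.indicator]
    rw [h, intervalIntegral.integral_Iic_sub_Iic hi.integrableOn hi.integrableOn, bspline_succ hr]
  | succ k ih =>
    have h1 := ih (r := r + 1) (by omega)
    rw [show r + (k + 1) + 1 = r + 1 + k + 1 by ring, ← h1]
    -- Any point below both x and 0 would do, since the integrands vanish on the negative axis.
    have ha : min x 0 - 1 < 0 := by linarith [min_le_right x 0]
    have hax : min x 0 - 1 ≤ x := by linarith [min_le_left x 0]
    set a := min x 0 - 1
    rw [setIntegral_Iic_eq_of_neg (fun t ht => by
      rw [bdiff_eq_zero_of_neg hr _ ht, zero_div, zero_mul]) ha hax,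
      setIntegral_Iic_eq_of_neg (fun t ht => by
      rw [bdiff_eq_zero_of_neg (by omega) _ ht, zero_div, zero_mul]) ha hax]
    have hc := continuous_bdiff (r := r + 1) (by omega) (k + 1)
    have hi1 : IntervalIntegrable (fun t => bdiff r (k + 1 + 1) t / ((k + 1).factorial : ℝ) *
        (x - t) ^ (k + 1)) volume a x :=
      ((integrable_bdiff hr (k + 1 + 1)).intervalIntegrable.div_const _).mul_continuousOn
        (by fun_prop)
    have hi2 : IntervalIntegrable (fun t => bdiff (r + 1) (k + 1) t / (k.factorial : ℝ) *
        (x - t) ^ k) volume a x := Continuous.intervalIntegrable (by fun_prop) _ _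
    -- Integration by parts off the countable set of knots: the boundary term vanishes at x because
    -- of the power of x - t, and at a because the difference of B-splines is zero there.
    have h2 := MeasureTheory.integral_eq_of_hasDerivAt_off_countable (a := a) (b := x)
      (fun t => bdiff (r + 1) (k + 1) t / ((k + 1).factorial : ℝ) * (x - t) ^ (k + 1))
      (fun t => bdiff r (k + 1 + 1) t / ((k + 1).factorial : ℝ) * (x - t) ^ (k + 1) -
        bdiff (r + 1) (k + 1) t / (k.factorial : ℝ) * (x - t) ^ k)
      (s := Set.range ((↑) : ℤ → ℝ)) (Set.countable_range _) (by fun_prop) ?_ (hi1.sub hi2)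
    · rw [intervalIntegral.integral_sub hi1 hi2] at h2
      rw [bdiff_eq_zero_of_neg (by omega) _ ha] at h2
      simp at h2
      linarith
    · intro t ht
      have hd := ((hasDerivAt_bdiff hr (k + 1) ht.2).div_const ((k + 1).factorial : ℝ)).mul
        (((hasDerivAt_id t).const_sub x).pow (k + 1))
      refine hd.congr_deriv ?_
      have : (k.factorial : ℝ) ≠ 0 := by positivity
      simp only [id, Nat.factorial_succ, Nat.add_sub_cancel, Pi.pow_apply]
      push_cast
      field_simp
      ring

theorem bdiff_reflect_ae {r : ℕ} (hr : 1 ≤ r) (k : ℕ) :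
    ∀ᵐ x : ℝ, bdiff r k (r + k - x) = (-1) ^ k * bdiff r k x := by
  induction k with
  | zero => simpa [bdiff] using bspline_reflect_ae hr
  | succ k ih =>
    have h1 := (measurePreserving_sub_right volume (1 : ℝ)).quasiMeasurePreserving.ae ih
    filter_upwards [ih, h1] with x hx hx1
    rw [bdiff_succ, bdiff_succ, pow_succ]
    push_cast
    rw [show (r : ℝ) + (k + 1) - x = r + k - (x - 1) by ring, hx1,
      show (r : ℝ) + k - (x - 1) - 1 = r + k - x by ring, hx]
    ring

/-- Differences commute with convolution and can be moved from either factor to the outside. -/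
theorem integral_bdiff_mul_bdiff {r : ℕ} (hr : 1 ≤ r) (a b : ℕ) (x : ℝ) :
    ∫ t, bdiff r a t * bdiff r b (x - t) = bdiff (2 * r) (a + b) x := by
  have hi : ∀ (a b : ℕ) (x y : ℝ), Integrable fun t => bdiff r a (t - y) * bdiff r b (x - t) :=
    fun a b x y => ((integrable_bdiff hr a).comp_sub_right y).mul_bdd (c := 2 ^ b)
      ((measurable_bdiff hr b).comp (by fun_prop)).aestronglyMeasurable
      (ae_of_all _ fun x => norm_bdiff_le hr _ _)
  have hi0 : ∀ (a b : ℕ) (x : ℝ), Integrable fun t => bdiff r a t * bdiff r b (x - t) :=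
    fun a b x => by simpa using hi a b x 0
  induction a generalizing x with
  | zero =>
    induction b generalizing x with
    | zero => rw [two_mul]; exact integral_bspline_mul_bspline hr hr x
    | succ b ih =>
      rw [← add_assoc, bdiff_succ, ← ih, ← ih, ← integral_sub (hi0 _ _ _) (hi0 _ _ _)]
      refine integral_congr_ae (ae_of_all _ fun t => ?_)
      simp only [bdiff_succ r b]
      rw [sub_right_comm x 1 t]
      ring
  | succ a ih =>
    rw [add_right_comm, bdiff_succ, ← ih, ← ih]
    have h1 : ∫ t, bdiff r a t * bdiff r b (x - 1 - t) =
        ∫ t, bdiff r a (t - 1) * bdiff r b (x - t) := by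
      rw [← integral_sub_right_eq_self (fun t => bdiff r a t * bdiff r b (x - 1 - t)) 1]
      refine integral_congr_ae (ae_of_all _ fun t => ?_)
      simp only
      congr 2; ring
    rw [h1, ← integral_sub (hi0 _ _ _) (hi _ _ _ _)]
    refine integral_congr_ae (ae_of_all _ fun t => ?_)
    simp only [bdiff_succ r a]
    ring

/-- Reflecting the second factor, at the cost of (-1)^m, turns the correlation into a convolution,
hence into a 2m-th difference of N_{2m}. -/
theorem integral_bdiff_mul_bdiff_sub {m : ℕ} (hm : 1 ≤ m) (j : ℤ) :
    ∫ t, bdiff m m t * bdiff m m (t - j) = (-1) ^ m * ∑ i ∈ Finset.range (2 * m + 1),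
      (-1) ^ i * ((2 * m).choose i : ℝ) * samples m (j + m - i) := by
  have h1 : ∫ t, bdiff m m t * bdiff m m (t - j) =
      ∫ t, (-1) ^ m * (bdiff m m t * bdiff m m (2 * m + j - t)) := by
    have h := (measurePreserving_sub_right volume (j : ℝ)).quasiMeasurePreserving.ae
      (bdiff_reflect_ae hm m)
    refine integral_congr_ae (h.mono fun t ht => ?_)
    simp only
    rw [show (2 * m + j - t : ℝ) = m + m - (t - j) by ring, ht, ← mul_assoc, mul_comm (_ ^ _),
      mul_assoc, ← mul_assoc (_ ^ _) (_ ^ _), ← mul_pow]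
    simp
  rw [h1, integral_const_mul, integral_bdiff_mul_bdiff hm, ← two_mul, bdiff_eq_sum]
  congr 1
  refine Finset.sum_congr rfl fun i _ => ?_
  rw [samples, centered]
  congr 2; push_cast; ring

/-! ### The Gram sequence of the Chui–Wang wavelet -/

theorem finite_support_conv {u v : ℤ → ℝ} (hu : (Function.support u).Finite)
    (hv : (Function.support v).Finite) : (Function.support (conv u v)).Finite := by
  refine (hu.add hv).subset fun n hn => ?_
  by_contra h
  refine hn ?_
  rw [conv, ← tsum_zero (α := ℝ) (β := ℤ)]
  refine tsum_congr fun k => ?_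
  by_contra hk
  rw [smul_eq_mul, mul_eq_zero, not_or] at hk
  exact h ⟨k, hk.1, n - k, hk.2, by simp⟩

theorem tsum_eq_tsum_two_mul {V : Type*} [AddCommMonoid V] [TopologicalSpace V] {f : ℤ → V}
    (hf : ∀ j, Odd j → f j = 0) : ∑' j, f j = ∑' r, f (2 * r) := by
  have hinj : Function.Injective fun r : ℤ => 2 * r := fun a b h => by simpa using h
  refine (hinj.tsum_eq fun j hj => ?_).symm
  rcases Int.even_or_odd' j with ⟨r, rfl | rfl⟩
  · exact ⟨r, rfl⟩
  · exact (hj (hf _ (odd_two_mul_add_one r))).elim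

/-- The sequence `∑_j (-1)^j E_j E_{2k-j}` for the samples `E` of the centered B-spline. -/
noncomputable def crossSamples (m : ℕ) (k : ℤ) : ℝ := conv (altSamples m) (samples m) (2 * k)

theorem finite_support_altSamples {m : ℕ} (hm : 1 ≤ m) :
    (Function.support (altSamples m)).Finite :=
  (finite_support_samples hm).subset fun k hk h => hk (by simp [altSamples, h])

theorem finite_support_crossSamples {m : ℕ} (hm : 1 ≤ m) :
    (Function.support (crossSamples m)).Finite :=
  (finite_support_conv (finite_support_altSamples hm) (finite_support_samples hm)).preimage
    fun a _ b _ h => by simpa using h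

theorem altSamples_neg {m : ℕ} (hm : 1 ≤ m) (k : ℤ) : altSamples m (-k) = altSamples m k := by
  rw [altSamples, altSamples, samples_neg hm, Int.negOnePow_neg]

/-- The factor (-1)^k is e^{ikπ}. -/
theorem symbol_altSamples (m : ℕ) (θ : ℝ) :
    symbol (altSamples m) θ = symbol (samples m) (θ + Real.pi) := by
  rw [symbol, symbol]
  refine tsum_congr fun k => ?_
  have h : Complex.exp (Complex.I * k * ((θ + Real.pi : ℝ) : ℂ)) =
      ((k.negOnePow : ℤ) : ℂ) * Complex.exp (Complex.I * k * θ) := by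
    rw [Complex.ofReal_add, mul_add, Complex.exp_add, mul_comm]
    congr 1
    rw [show Complex.I * k * Real.pi = k * (Real.pi * Complex.I) by ring, Complex.exp_int_mul,
      Complex.exp_pi_mul_I, Int.cast_negOnePow]
  rw [h, altSamples]
  push_cast
  ring

/-- The odd terms of the underlying convolution vanish, so restricting to even indices only halves
the frequency: the symbol is a product of the symbol of E at θ/2 and at θ/2 + π. -/
theorem symbol_crossSamples_ne_zero {m : ℕ} (hm : 1 ≤ m) (θ : ℝ) :
    symbol (crossSamples m) θ ≠ 0 := by
  have h : symbol (crossSamples m) θ =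
      symbol (conv (altSamples m) (samples m)) (θ / 2) := by
    rw [symbol, symbol, tsum_eq_tsum_two_mul (f := fun k : ℤ =>
      ((conv (altSamples m) (samples m) k : ℝ) : ℂ) *
        Complex.exp (Complex.I * k * (θ / 2 : ℝ)))]
    · refine tsum_congr fun k => ?_
      rw [crossSamples]
      congr 2
      push_cast; ring
    · intro j hj
      rw [conv_altSamples_samples_of_odd hj, Complex.ofReal_zero, zero_mul]
  rw [h, symbol_conv (summable_altSamples hm) (summable_samples hm), symbol_altSamples]
  exact mul_ne_zero (symbol_samples_ne_zero hm _) (symbol_samples_ne_zero hm _)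

/-- The Chui–Wang wavelet in terms of backward differences of B-splines, which agrees with it off
the half integers. -/
noncomputable def wavelet (m : ℕ) (x : ℝ) : ℝ :=
  1 / 2 ^ (m - 1) * ∑ l ∈ Finset.range (2 * m - 1),
    (-1) ^ l * bspline (2 * m) ((l : ℝ) + 1) * bdiff m m (2 * x - l)

/-- Only almost everywhere, since for m = 1 the spline N_2 is not differentiable at its knots; the
wavelet is used only under integrals. -/
theorem chuiWang_ae_eq {m : ℕ} (hm : 1 ≤ m) : chuiWang m =ᵐ[volume] wavelet m := by
  have h : ∀ᵐ x : ℝ, x ∉ Set.range fun n : ℤ => (n : ℝ) / 2 :=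
    (Set.countable_range _).ae_notMem volume
  filter_upwards [h] with x hx
  rw [chuiWang, wavelet]
  congr 1
  refine Finset.sum_congr rfl fun l _ => ?_
  congr 1
  conv_lhs => rw [two_mul m]
  refine iteratedDeriv_bspline hm m ?_
  rintro ⟨n, hn⟩
  exact hx ⟨n + l, by push_cast; linarith⟩

theorem ae_sub_of_ae {p : ℝ → Prop} (h : ∀ᵐ x, p x) (a : ℝ) : ∀ᵐ x, p (x - a) :=
  (measurePreserving_sub_right volume a).quasiMeasurePreserving.ae h

theorem integral_bdiff_two_mul {m : ℕ} (hm : 1 ≤ m) (k : ℤ) (l l' : ℕ) :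
    ∫ x : ℝ, bdiff m m (2 * x - l) * bdiff m m (2 * (x - k) - l') =
      1 / 2 * ((-1) ^ m * ∑ i ∈ Finset.range (2 * m + 1),
        (-1) ^ i * ((2 * m).choose i : ℝ) * samples m (2 * k + l' + m - (l + i))) := by
  have h1 : ∫ x : ℝ, bdiff m m (2 * x - l) * bdiff m m (2 * (x - k) - l') =
      1 / 2 * ∫ x : ℝ, bdiff m m (x - l) * bdiff m m (x - 2 * k - l') := by
    have := Measure.integral_comp_mul_left
      (fun x : ℝ => bdiff m m (x - l) * bdiff m m (x - 2 * k - l')) 2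
    simp only [abs_inv, abs_two, smul_eq_mul] at this
    rw [one_div, ← this]
    simp_rw [mul_sub]
  have h2 : ∫ x : ℝ, bdiff m m (x - l) * bdiff m m (x - 2 * k - l') =
      ∫ x : ℝ, bdiff m m x * bdiff m m (x - (2 * k + l' - l : ℤ)) := by
    rw [← integral_sub_right_eq_self
      (fun x => bdiff m m x * bdiff m m (x - (2 * k + l' - l : ℤ))) (l : ℝ)]
    refine integral_congr_ae (ae_of_all _ fun t => ?_)
    simp only
    congr 2; push_cast; ring
  rw [h1, h2, integral_bdiff_mul_bdiff_sub hm]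
  congr 2
  refine Finset.sum_congr rfl fun i _ => ?_
  congr 2; ring

/-- Summing over the shifts of the first wavelet produces alternating half-integer samples; summing
over those of the second produces alternating samples convolved with samples, which vanish at odd
indices. On even indices the half-integer samples are ordinary ones, which gives the factorisation
of the Gram sequence. -/
theorem integral_wavelet_mul_wavelet {m : ℕ} (hm : 1 ≤ m) (k : ℤ) :
    ∫ x : ℝ, wavelet m x * wavelet m (x - k) = conv (samples m) (crossSamples m) k := by
  set w : ℕ → ℝ := fun l => (-1) ^ l * bspline (2 * m) ((l : ℝ) + 1) with hw
  have hi : ∀ l l' : ℕ, Integrable fun x : ℝ =>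
      bdiff m m (2 * x - l) * bdiff m m (2 * (x - k) - l') := fun l l' => by
    refine Integrable.mul_bdd (c := 2 ^ m) ?_
      ((measurable_bdiff hm m).comp (by fun_prop)).aestronglyMeasurable
      (ae_of_all _ fun x => norm_bdiff_le hm _ _)
    exact ((integrable_bdiff hm m).comp_sub_right (l : ℝ)).comp_mul_left' two_ne_zero
  have h1 : ∀ x : ℝ, wavelet m x * wavelet m (x - k) =
      ∑ l' ∈ Finset.range (2 * m - 1), ∑ l ∈ Finset.range (2 * m - 1),
        (1 / 2 ^ (m - 1)) ^ 2 * w l' * w l *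
          (bdiff m m (2 * x - l) * bdiff m m (2 * (x - k) - l')) := fun x => by
    rw [wavelet, wavelet, mul_mul_mul_comm, Finset.sum_mul_sum, Finset.sum_comm, Finset.mul_sum]
    refine Finset.sum_congr rfl fun l' _ => ?_
    rw [Finset.mul_sum]
    refine Finset.sum_congr rfl fun l _ => ?_
    simp only [hw]
    ring
  simp_rw [h1]
  rw [integral_finsetSum _ fun l' _ => integrable_finsetSum _ fun l _ => (hi l l').const_mul _]
  have h2 : ∀ l' ∈ Finset.range (2 * m - 1), ∫ x : ℝ, ∑ l ∈ Finset.range (2 * m - 1),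
      (1 / 2 ^ (m - 1)) ^ 2 * w l' * w l *
        (bdiff m m (2 * x - l) * bdiff m m (2 * (x - k) - l')) =
      (-1) ^ (m + 1) * (w l' * ∑' j : ℤ, (j.negOnePow : ℤ) * halfSamples m j *
        samples m (2 * k + l' + m - (j + 2 * m - 1))) := fun l' _ => by
    rw [integral_finsetSum _ fun l _ => (hi l l').const_mul _]
    simp_rw [integral_const_mul, integral_bdiff_two_mul hm]
    have h3 := sum_alternating_bspline_diff hm fun n : ℤ => samples m (2 * k + l' + m - n)
    -- The normalisations 2^{-(m-1)} of both wavelets and the factor 1/2 from doubling the variable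
    -- cancel exactly.
    have h4 : (2 : ℝ) ^ (2 * m - 1) = 2 * (2 ^ (m - 1)) ^ 2 := by
      obtain ⟨n, rfl⟩ := Nat.exists_eq_add_of_le' hm
      rw [show 2 * (n + 1) - 1 = 2 * n + 1 by omega, Nat.add_sub_cancel]
      ring
    have h5 : ∀ l : ℕ, (1 / 2 ^ (m - 1)) ^ 2 * w l' * w l * (1 / 2 * ((-1) ^ m *
        ∑ i ∈ Finset.range (2 * m + 1), (-1) ^ i * ((2 * m).choose i : ℝ) *
          samples m (2 * k + l' + m - (l + i)))) =
        ((1 / 2 ^ (m - 1)) ^ 2 * w l' * (1 / 2) * (-1) ^ m) * (w l *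
        ∑ i ∈ Finset.range (2 * m + 1), (-1) ^ i * ((2 * m).choose i : ℝ) *
          samples m (2 * k + l' + m - (l + i))) := fun l => by ring
    simp_rw [h5]
    rw [← Finset.mul_sum, h3, h4]
    field_simp
    ring
  rw [Finset.sum_congr rfl h2, ← Finset.mul_sum]
  have hs : ∀ l' : ℕ, Summable fun j : ℤ => w l' * ((j.negOnePow : ℤ) * halfSamples m j *
      samples m (2 * k + l' + m - (j + 2 * m - 1))) := fun l' => by
    refine summable_of_hasFiniteSupport
      ((Finset.Icc (-(2 * m) : ℤ) (2 * m)).finite_toSet.subset fun j hj => ?_)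
    by_contra h
    exact hj (by simp [halfSamples_eq_zero hm h])
  simp_rw [← tsum_mul_left]
  rw [← Summable.tsum_finsetSum fun l' _ => hs l', ← tsum_mul_left]
  have h6 : ∀ j : ℤ, (-1) ^ (m + 1) * ∑ l' ∈ Finset.range (2 * m - 1),
      w l' * ((j.negOnePow : ℤ) * halfSamples m j *
        samples m (2 * k + l' + m - (j + 2 * m - 1))) =
      (j.negOnePow : ℤ) * halfSamples m j * conv (altSamples m) (samples m) (2 * k - j) :=
      fun j => by
    have h7 := sum_alternating_bspline hm fun l' : ℤ =>
      samples m (2 * k + l' + m - (j + 2 * m - 1))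
    have h8 : ∑' i : ℤ, altSamples m i * samples m (2 * k + (i + m - 1) + m - (j + 2 * m - 1)) =
        conv (altSamples m) (samples m) (2 * k - j) := by
      rw [conv, ← (Equiv.neg ℤ).tsum_eq]
      refine tsum_congr fun i => ?_
      rw [Equiv.neg_apply, altSamples_neg hm, smul_eq_mul, Int.cast_id]
      congr 2; ring
    have h9 : ((-1 : ℝ) ^ (m + 1)) * (-1) ^ (m + 1) = 1 := by rw [← mul_pow]; simp
    rw [h8] at h7
    simp_rw [mul_left_comm (w _)]
    rw [← Finset.mul_sum, h7]
    linear_combination ((j.negOnePow : ℤ) * halfSamples m j *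
      conv (altSamples m) (samples m) (2 * k - j)) * h9
  simp_rw [h6]
  -- For odd j the index 2k - j is odd, so only j = 2r remains.
  rw [tsum_eq_tsum_two_mul, conv]
  · refine tsum_congr fun r => ?_
    rw [halfSamples_two_mul, crossSamples, smul_eq_mul, Int.cast_id, ← mul_sub,
      Int.negOnePow_even _ (even_two_mul r)]
    simp
  · intro j hj
    rw [conv_altSamples_samples_of_odd, mul_zero]
    exact (even_two_mul k).sub_odd hj

theorem dualCoeff_eq {m : ℕ} (hm : 1 ≤ m) :
    dualCoeff m = convInverse (conv (samples m) (crossSamples m)) := by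
  rw [dualCoeff]
  congr 1
  funext k
  rw [← integral_wavelet_mul_wavelet hm]
  refine integral_congr_ae ?_
  filter_upwards [chuiWang_ae_eq hm, ae_sub_of_ae (chuiWang_ae_eq hm) k] with x h1 h2
  rw [h1, h2]

theorem summable_crossSamples {m : ℕ} (hm : 1 ≤ m) : Summable (crossSamples m) :=
  summable_of_hasFiniteSupport (finite_support_crossSamples hm)

theorem finite_support_gram {m : ℕ} (hm : 1 ≤ m) :
    (Function.support (conv (samples m) (crossSamples m))).Finite :=
  finite_support_conv (finite_support_samples hm) (finite_support_crossSamples hm)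

theorem symbol_gram_ne_zero {m : ℕ} (hm : 1 ≤ m) (θ : ℝ) :
    symbol (conv (samples m) (crossSamples m)) θ ≠ 0 := by
  rw [symbol_conv (summable_samples hm) (summable_crossSamples hm)]
  exact mul_ne_zero (symbol_samples_ne_zero hm θ) (symbol_crossSamples_ne_zero hm θ)

theorem summable_abs_pow_mul_dualCoeff {m : ℕ} (hm : 1 ≤ m) (K : ℕ) :
    Summable fun n : ℤ => |(n : ℝ)| ^ K * |dualCoeff m n| := by
  rw [dualCoeff_eq hm]
  exact summable_abs_pow_mul_convInverse (finite_support_gram hm) (symbol_gram_ne_zero hm) K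

theorem summable_dualCoeff {m : ℕ} (hm : 1 ≤ m) : Summable (dualCoeff m) := by
  rw [dualCoeff_eq hm]
  exact summable_convInverse (finite_support_gram hm) (symbol_gram_ne_zero hm)

theorem conv_gram_dualCoeff {m : ℕ} (hm : 1 ≤ m) :
    conv (conv (samples m) (crossSamples m)) (dualCoeff m) = Pi.single 0 1 := by
  rw [dualCoeff_eq hm]
  exact conv_convInverse (finite_support_gram hm) (symbol_gram_ne_zero hm)

/-! ### The univariate Faber splines -/

/-- The `m`-fold integral of the Chui–Wang wavelet. -/
noncomputable def waveletPrimitive (m : ℕ) (x : ℝ) : ℝ :=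
  1 / 2 ^ (2 * m - 1) * ∑ l ∈ Finset.range (2 * m - 1),
    (-1) ^ l * bspline (2 * m) ((l : ℝ) + 1) * bspline (2 * m) (2 * x - l)

/-- The cardinal spline of half the mesh width, centered at `m - 1/2`. -/
noncomputable def shiftedCardinal (m : ℕ) (x : ℝ) : ℝ :=
  cardinalSpline (2 * m) (2 * x - (2 * m - 1))

theorem norm_shiftedCardinal_le {m : ℕ} (hm : 1 ≤ m) (x : ℝ) :
    ‖shiftedCardinal m x‖ ≤ ∑' n, |cardinalCoeff (2 * m) n| :=
  norm_cardinalSpline_le hm _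

/-- Writing the centered B-spline as E ⋆ L makes the alternating sum a convolution of L with
altSamples ⋆ E, which is supported on even integers; with L at doubled argument these become integer
shifts. -/
theorem waveletPrimitive_eq {m : ℕ} (hm : 1 ≤ m) :
    waveletPrimitive m = fun x => ((-1) ^ (m + 1) / 2 ^ (2 * m - 1) : ℝ) •
      conv (crossSamples m) (shiftedCardinal m) x := by
  funext x
  have h1 := sum_alternating_bspline hm fun l : ℤ => bspline (2 * m) (2 * x - l)
  have h2 : ∑' j : ℤ, altSamples m j * bspline (2 * m) (2 * x - (j + m - 1 : ℤ)) =
      conv (altSamples m) (centered m) (2 * x - (2 * m - 1)) := by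
    rw [conv]
    refine tsum_congr fun j => ?_
    rw [centered, smul_eq_mul]
    congr 2; push_cast; ring
  have h3 : conv (conv (altSamples m) (samples m)) (cardinalSpline (2 * m))
      (2 * x - (2 * m - 1)) = conv (crossSamples m) (shiftedCardinal m) x := by
    rw [conv, conv, tsum_eq_tsum_two_mul]
    · refine tsum_congr fun k => ?_
      rw [crossSamples, shiftedCardinal]
      congr 2; push_cast; ring
    · intro j hj
      rw [conv_altSamples_samples_of_odd hj, zero_smul]
  rw [waveletPrimitive]
  simp only [Int.cast_natCast] at h1
  rw [h1, h2, ← h3, conv_assoc (summable_altSamples hm) (summable_samples hm)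
    (norm_cardinalSpline_le hm), conv_samples_cardinalSpline hm, smul_eq_mul]
  ring

theorem norm_waveletPrimitive_le {m : ℕ} (hm : 1 ≤ m) :
    ∃ C, ∀ x, ‖waveletPrimitive m x‖ ≤ C := by
  obtain ⟨C, hC⟩ : ∃ C, ∀ x, ‖conv (crossSamples m) (shiftedCardinal m) x‖ ≤ C :=
    ⟨_, norm_conv_le (summable_crossSamples hm) (norm_shiftedCardinal_le hm)⟩
  refine ⟨‖((-1) ^ (m + 1) / 2 ^ (2 * m - 1) : ℝ)‖ * C, fun x => ?_⟩
  rw [waveletPrimitive_eq hm, norm_smul]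
  exact mul_le_mul_of_nonneg_left (hC x) (norm_nonneg _)

theorem setIntegral_Iic_comp_mul_sub (g : ℝ → ℝ) {c : ℝ} (hc : 0 < c) (b x : ℝ) :
    ∫ t in Set.Iic x, g (c * t - b) = c⁻¹ * ∫ t in Set.Iic (c * x - b), g t := by
  rw [← integral_indicator measurableSet_Iic, ← integral_indicator measurableSet_Iic]
  have h1 := Measure.integral_comp_mul_left
    (fun t => Set.indicator (Set.Iic (c * x - b)) g (t - b)) c
  rw [integral_sub_right_eq_self (Set.indicator (Set.Iic (c * x - b)) g), smul_eq_mul,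
    abs_of_pos (inv_pos.2 hc)] at h1
  rw [← h1]
  refine integral_congr_ae (ae_of_all _ fun t => ?_)
  simp only [Set.indicator, Set.mem_Iic, sub_le_sub_iff_right, mul_le_mul_iff_right₀ hc]

theorem integrable_mul_of_bounded_support {f g : ℝ → ℝ} (hf : Integrable f) {M : ℝ}
    (hM : ∀ t, M < |t| → f t = 0) (hg : Continuous g) : Integrable fun t => f t * g t := by
  obtain ⟨C, hC⟩ := (isCompact_Icc (a := -M) (b := M)).exists_bound_of_continuousOn
    hg.continuousOn
  have h : Integrable fun t => f t * Set.indicator (Set.Icc (-M) M) g t := by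
    refine hf.mul_bdd (c := max C 0)
      (hg.measurable.indicator measurableSet_Icc).aestronglyMeasurable (ae_of_all _ fun t => ?_)
    by_cases ht : t ∈ Set.Icc (-M) M
    · rw [Set.indicator_of_mem ht]
      exact (hC t ht).trans (le_max_left _ _)
    · rw [Set.indicator_of_notMem ht, norm_zero]
      exact le_max_right _ _
  refine h.congr (ae_of_all _ fun t => ?_)
  by_cases ht : t ∈ Set.Icc (-M) M
  · simp only [Set.indicator_of_mem ht]
  · have : f t = 0 := hM t (by rwa [Set.mem_Icc, ← abs_le, not_le] at ht)
    simp only [this, zero_mul]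

theorem integrable_wavelet {m : ℕ} (hm : 1 ≤ m) : Integrable (wavelet m) := by
  refine Integrable.const_mul (integrable_finsetSum _ fun l _ => Integrable.const_mul ?_ _) _
  exact ((integrable_bdiff hm m).comp_sub_right (l : ℝ)).comp_mul_left' two_ne_zero

theorem wavelet_eq_zero {m : ℕ} (hm : 1 ≤ m) {x : ℝ} (hx : 2 * (m : ℝ) < |x|) :
    wavelet m x = 0 := by
  rw [wavelet, Finset.sum_eq_zero, mul_zero]
  intro l hl
  have hl' : ((l : ℕ) : ℝ) ≤ ((2 * m : ℕ) : ℝ) := by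
    rw [Nat.cast_le]; have := Finset.mem_range.1 hl; omega
  push_cast at hl'
  have hl0 : (0 : ℝ) ≤ l := Nat.cast_nonneg l
  rcases lt_abs.1 hx with h | h
  · rw [bdiff_eq_zero_of_ge hm m (by linarith), mul_zero]
  · rw [bdiff_eq_zero_of_neg hm m (by linarith), mul_zero]

/-- Each of the m integrations of a function of 2x contributes 1/2, so the normalisation 2^{-(m-1)}
becomes 2^{-(2m-1)}. -/
theorem setIntegral_Iic_wavelet {m : ℕ} (hm : 1 ≤ m) (n : ℤ) (x : ℝ) :
    ∫ t in Set.Iic x, wavelet m (t - n) / ((m - 1).factorial : ℝ) * (x - t) ^ (m - 1) =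
      waveletPrimitive m (x - n) := by
  obtain ⟨p, rfl⟩ := Nat.exists_eq_add_of_le' hm
  simp only [Nat.add_sub_cancel]
  have hi : ∀ b c : ℝ, Integrable fun t => bdiff (p + 1) (p + 1) (2 * t - b) * (c - t) ^ p :=
      fun b c => by
    refine integrable_mul_of_bounded_support (M := 2 * (p + 1) + |b|)
      (((integrable_bdiff hm (p + 1)).comp_sub_right b).comp_mul_left' two_ne_zero)
      (fun t ht => ?_) (by fun_prop)
    have hp : (0 : ℝ) ≤ p := Nat.cast_nonneg p
    rcases lt_abs.1 ht with h | h
    · apply bdiff_eq_zero_of_ge hm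
      push_cast
      linarith [le_abs_self b, neg_abs_le b, abs_nonneg b]
    · apply bdiff_eq_zero_of_neg hm
      linarith [le_abs_self b, neg_abs_le b, abs_nonneg b]
  have h1 : ∀ l : ℕ, ∫ t in Set.Iic x, bdiff (p + 1) (p + 1) (2 * (t - n) - l) /
      (p.factorial : ℝ) * (x - t) ^ p =
      1 / 2 ^ (p + 1) * bspline (2 * (p + 1)) (2 * (x - n) - l) := fun l => by
    have h2 := setIntegral_Iic_comp_mul_sub (fun t => bdiff (p + 1) (p + 1) t /
      (p.factorial : ℝ) * (2 * (x - n) - l - t) ^ p) two_pos (2 * n + l) x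
    have h3 := setIntegral_Iic_bdiff (r := p + 1) (by omega) p (2 * (x - n) - l)
    rw [show 2 * x - (2 * n + l) = 2 * (x - n) - l by ring, h3,
      show p + 1 + p + 1 = 2 * (p + 1) by ring] at h2
    have h4 : ∀ t : ℝ, bdiff (p + 1) (p + 1) (2 * (t - n) - l) /
        (p.factorial : ℝ) * (x - t) ^ p = 1 / 2 ^ p * (bdiff (p + 1) (p + 1) (2 * t - (2 * n + l)) /
        (p.factorial : ℝ) * (2 * (x - n) - l - (2 * t - (2 * n + l))) ^ p) := fun t => by
      rw [show 2 * (x - n) - l - (2 * t - (2 * n + l)) = 2 * (x - t) by ring, mul_pow,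
        show 2 * (t - n) - l = 2 * t - (2 * n + l) by ring]
      field_simp
    simp_rw [h4]
    rw [integral_const_mul, h2, pow_succ]
    field_simp
  rw [waveletPrimitive, show 2 * (p + 1) - 1 = p + (p + 1) by omega]
  have h5 : ∀ t : ℝ, wavelet (p + 1) (t - n) / (p.factorial : ℝ) * (x - t) ^ p =
      ∑ l ∈ Finset.range (p + (p + 1)), 1 / 2 ^ p *
        ((-1) ^ l * bspline (2 * (p + 1)) ((l : ℝ) + 1)) *
        (bdiff (p + 1) (p + 1) (2 * (t - n) - l) / (p.factorial : ℝ) * (x - t) ^ p) := fun t => by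
    rw [wavelet, show 2 * (p + 1) - 1 = p + (p + 1) by omega, Nat.add_sub_cancel,
      Finset.mul_sum, Finset.sum_div, Finset.sum_mul]
    refine Finset.sum_congr rfl fun l _ => ?_
    ring
  simp_rw [h5]
  rw [integral_finsetSum]
  · simp_rw [integral_const_mul, h1]
    rw [Finset.mul_sum]
    refine Finset.sum_congr rfl fun l _ => ?_
    rw [pow_add]
    ring
  · intro l _
    refine Integrable.const_mul ?_ _
    have := ((hi (2 * n + l) x).div_const (p.factorial : ℝ)).integrableOn (s := Set.Iic x)
    refine this.congr (ae_of_all _ fun t => ?_)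
    simp only
    rw [show 2 * (t - n) - l = 2 * t - (2 * n + l) by ring]
    ring

/-- The Faber spline of level `0` at the origin. -/
noncomputable def faberBase (m : ℕ) (x : ℝ) : ℝ :=
  ∫ t in Set.Iic x, dualWavelet m t / ((m - 1).factorial : ℝ) * (x - t) ^ (m - 1)

theorem integrable_wavelet_mul_pow {m : ℕ} (hm : 1 ≤ m) (n : ℤ) (x : ℝ) :
    Integrable fun t => wavelet m (t - n) / ((m - 1).factorial : ℝ) * (x - t) ^ (m - 1) := by
  have h := integrable_mul_of_bounded_support (integrable_wavelet hm)
    (fun t => wavelet_eq_zero hm)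
    (g := fun t => (x - n - t) ^ (m - 1) / ((m - 1).factorial : ℝ)) (by fun_prop)
  refine (h.comp_sub_right (n : ℝ)).congr (ae_of_all _ fun t => ?_)
  simp only
  rw [show x - n - (t - n) = x - t by ring]
  ring

/-- On the support of the translated wavelet |x - t| is at most |x| + 2m + |n|. Only the polynomial
growth in n matters. -/
theorem integral_norm_wavelet_mul_pow_le {m : ℕ} (hm : 1 ≤ m) (n : ℤ) (x : ℝ) :
    ∫ t in Set.Iic x, ‖wavelet m (t - n) / ((m - 1).factorial : ℝ) * (x - t) ^ (m - 1)‖ ≤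
      (|x| + 2 * m + |(n : ℝ)|) ^ (m - 1) * ∫ t, ‖wavelet m t‖ := by
  have hi := (integrable_wavelet_mul_pow hm n x).norm
  refine (setIntegral_le_integral hi (ae_of_all _ fun t => norm_nonneg _)).trans ?_
  rw [← integral_sub_right_eq_self (fun t => ‖wavelet m t‖) (n : ℝ), ← integral_const_mul]
  refine integral_mono hi
    (((integrable_wavelet hm).comp_sub_right (n : ℝ)).norm.const_mul _) fun t => ?_
  simp only
  by_cases ht : 2 * (m : ℝ) < |t - n|
  · simp [wavelet_eq_zero hm ht]
  · rw [norm_mul, norm_div, norm_pow, mul_comm]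
    refine mul_le_mul ?_ ?_ (by positivity) (by positivity)
    · refine pow_le_pow_left₀ (norm_nonneg _) ?_ _
      rw [Real.norm_eq_abs]
      have h2 : |t| ≤ |t - n| + |(n : ℝ)| := by
        simpa using abs_add_le (t - n) n
      have h3 : |x - t| ≤ |x| + |t| := abs_sub x t
      linarith [not_lt.1 ht]
    · refine div_le_self (norm_nonneg _) ?_
      rw [Real.norm_natCast]
      exact_mod_cast Nat.one_le_iff_ne_zero.2 (Nat.factorial_ne_zero _)

/-- Integration term by term is justified because the dual coefficients are summable against
|n|^(m-1). -/
theorem faberBase_eq_conv {m : ℕ} (hm : 1 ≤ m) :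
    faberBase m = conv (dualCoeff m) (waveletPrimitive m) := by
  funext x
  set F : ℤ → ℝ → ℝ := fun n t => dualCoeff m n *
    (wavelet m (t - n) / ((m - 1).factorial : ℝ) * (x - t) ^ (m - 1)) with hF
  have h1 : ∀ᵐ t : ℝ, dualWavelet m t / ((m - 1).factorial : ℝ) * (x - t) ^ (m - 1) =
      ∑' n, F n t := by
    have h2 : ∀ᵐ t : ℝ, ∀ n : ℤ, chuiWang m (t - n) = wavelet m (t - n) :=
      ae_all_iff.2 fun n => ae_sub_of_ae (chuiWang_ae_eq hm) n
    filter_upwards [h2] with t ht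
    rw [dualWavelet, ← tsum_div_const, ← tsum_mul_right]
    refine tsum_congr fun n => ?_
    rw [ht n, hF]
    ring
  have h3 : ∀ n, Integrable (F n) (volume.restrict (Set.Iic x)) := fun n =>
    ((integrable_wavelet_mul_pow hm n x).const_mul _).integrableOn
  have h4 : Summable fun n => ∫ t in Set.Iic x, ‖F n t‖ := by
    have h5 : Summable fun n : ℤ => 2 ^ (m - 1 - 1) * (∫ t, ‖wavelet m t‖) *
        ((|x| + 2 * m) ^ (m - 1) * |dualCoeff m n| + |(n : ℝ)| ^ (m - 1) * |dualCoeff m n|) :=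
      (((summable_dualCoeff hm).abs.mul_left _).add
        (summable_abs_pow_mul_dualCoeff hm (m - 1))).mul_left _
    refine h5.of_nonneg_of_le (fun n => integral_nonneg fun t => norm_nonneg _) fun n => ?_
    simp only [hF, norm_mul (dualCoeff m n)]
    rw [integral_const_mul]
    refine (mul_le_mul_of_nonneg_left (integral_norm_wavelet_mul_pow_le hm n x)
      (norm_nonneg _)).trans ?_
    have h6 := add_pow_le (show 0 ≤ |x| + 2 * (m : ℝ) by positivity) (abs_nonneg (n : ℝ)) (m - 1)
    have h7 : 0 ≤ ∫ t, ‖wavelet m t‖ := integral_nonneg fun t => norm_nonneg _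
    rw [Real.norm_eq_abs]
    calc _ ≤ |dualCoeff m n| * (2 ^ (m - 1 - 1) *
          ((|x| + 2 * m) ^ (m - 1) + |(n : ℝ)| ^ (m - 1)) * ∫ t, ‖wavelet m t‖) := by gcongr
      _ = _ := by ring
  have h5 := hasSum_integral_of_summable_integral_norm h3 h4
  rw [faberBase, integral_congr_ae (ae_restrict_of_ae h1), ← h5.tsum_eq, conv]
  refine tsum_congr fun n => ?_
  simp only [hF]
  rw [integral_const_mul, setIntegral_Iic_wavelet hm, smul_eq_mul]

theorem norm_faberBase_le {m : ℕ} (hm : 1 ≤ m) : ∃ C, ∀ x, ‖faberBase m x‖ ≤ C := by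
  obtain ⟨C, hC⟩ := norm_waveletPrimitive_le hm
  rw [faberBase_eq_conv hm]
  exact ⟨_, norm_conv_le (summable_dualCoeff hm) hC⟩

/-- The Faber splines expressed by cardinal splines of half the mesh width. -/
theorem conv_samples_faberBase {m : ℕ} (hm : 1 ≤ m) :
    conv (samples m) (faberBase m) =
      fun x => ((-1) ^ (m + 1) / 2 ^ (2 * m - 1) : ℝ) • shiftedCardinal m x := by
  obtain ⟨C, hC⟩ := norm_waveletPrimitive_le hm
  have hb := norm_shiftedCardinal_le hm
  have hE := summable_samples hm
  have hR := summable_crossSamples hm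
  have ha := summable_dualCoeff hm
  rw [faberBase_eq_conv hm, conv_left_comm hE ha hC, waveletPrimitive_eq hm]
  funext x
  -- The dual coefficients meet E ⋆ R, whose convolution inverse they are, and only the shifted
  -- cardinal spline is left.
  rw [funext (conv_const_smul _ _ _), conv_const_smul, ← conv_assoc hE hR hb,
    conv_left_comm ha (summable_conv_seq hE hR) hb, ← conv_assoc (summable_conv_seq hE hR) ha hb,
    conv_gram_dualCoeff hm, single_conv]

theorem faberSpline_neg_one (m : ℕ) (k : ℤ) (x : ℝ) :
    faberSpline m (-1) k x = cardinalSpline (2 * m) (x - k) := by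
  rw [faberSpline, if_pos rfl]

/-- The factor 2^{mj} absorbs the Jacobian and the m - 1 powers of 2^j coming from the kernel, so
all levels j ≥ 0 are dilates and translates of one function. -/
theorem faberSpline_eq {m : ℕ} (hm : 1 ≤ m) {j : ℤ} (hj : j ≠ -1) (k : ℤ) (x : ℝ) :
    faberSpline m j k x = faberBase m (2 ^ j * x - k) := by
  obtain ⟨p, rfl⟩ := Nat.exists_eq_add_of_le' hm
  rw [faberSpline, if_neg hj, mul_comm (_ : ℤ) j, zpow_mul, zpow_natCast, faberBase]
  have hc : (0 : ℝ) < 2 ^ j := by positivity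
  set c : ℝ := 2 ^ j
  simp only [Nat.add_sub_cancel]
  have h1 := setIntegral_Iic_comp_mul_sub (fun t => dualWavelet (p + 1) t /
      (p.factorial : ℝ) * (c * x - k - t) ^ p) hc k x
  have h2 : ∀ t : ℝ, dualWavelet (p + 1) (c * t - k) / (p.factorial : ℝ) *
      (c * x - k - (c * t - k)) ^ p =
      c ^ p * (dualWavelet (p + 1) (c * t - k) / (p.factorial : ℝ) * (x - t) ^ p) := fun t => by
    rw [show c * x - k - (c * t - k) = c * (x - t) by ring, mul_pow]
    ring
  simp_rw [h2] at h1
  rw [integral_const_mul] at h1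
  rw [pow_succ, mul_right_comm, h1]
  field_simp

/-! ### Telescoping of the univariate expansion -/

theorem tsum_even_add_odd_int {f : ℤ → ℝ} (hf : Summable f) :
    ∑' j, f j = ∑' r, f (2 * r) + ∑' r, f (2 * r + 1) := by
  have h1 := hf.indicator {j : ℤ | Even j}
  have h2 := hf.indicator {j : ℤ | Even j}ᶜ
  have h3 : ∑' j, f j = ∑' j, (Set.indicator {j : ℤ | Even j} f j +
      Set.indicator {j : ℤ | Even j}ᶜ f j) :=
    tsum_congr fun j => (congrFun (Set.indicator_self_add_compl {j : ℤ | Even j} f) j).symm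
  have h4 : ∑' j, Set.indicator {j : ℤ | Even j} f j = ∑' r, f (2 * r) := by
    rw [tsum_eq_tsum_two_mul]
    · refine tsum_congr fun r => ?_
      rw [Set.indicator_of_mem]
      exact even_two_mul r
    · intro j hj
      rw [Set.indicator_of_notMem]
      simpa using hj
  have h5 : ∑' j, Set.indicator {j : ℤ | Even j}ᶜ f j = ∑' r, f (2 * r + 1) := by
    rw [← (Equiv.addRight (1 : ℤ)).tsum_eq, tsum_eq_tsum_two_mul]
    · refine tsum_congr fun r => ?_
      rw [Equiv.coe_addRight, Set.indicator_of_mem]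
      simp
    · intro j hj
      rw [Equiv.coe_addRight, Set.indicator_of_notMem]
      simpa using hj.add_one
  rw [h3, h1.tsum_add h2, h4, h5]

theorem conv_add {u : ℤ → ℝ} (hu : Summable u) {φ χ : ℝ → ℝ} {C D : ℝ} (hφ : ∀ x, ‖φ x‖ ≤ C)
    (hχ : ∀ x, ‖χ x‖ ≤ D) (x : ℝ) :
    conv u (fun y => φ y + χ y) x = conv u φ x + conv u χ x := by
  simp only [conv, smul_add]
  exact (summable_conv hu hφ x).tsum_add (summable_conv hu hχ x)

/-- The samples of the centered B-spline at the odd multiples of `1/2`. -/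
noncomputable def oddSamples (m : ℕ) (i : ℤ) : ℝ := halfSamples m (2 * i + 1)

theorem summable_oddSamples {m : ℕ} (hm : 1 ≤ m) : Summable (oddSamples m) :=
  (summable_halfSamples hm).comp_injective (i := fun i : ℤ => 2 * i + 1)
    fun a b h => by simpa using h

/-- The half-integer interpolation formula split by parity: even indices stay on the integer grid,
odd ones give the new grid points. -/
theorem centered_eq_add {m : ℕ} (hm : 1 ≤ m) (y : ℝ) :
    centered m y = conv (samples m) (fun x => cardinalSpline (2 * m) (2 * x)) y +
      conv (oddSamples m) (shiftedCardinal m) (y + (m - 1)) := by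
  rw [← conv_halfSamples_cardinalSpline hm, conv, tsum_even_add_odd_int
    (summable_conv (summable_halfSamples hm) (norm_cardinalSpline_le hm) (2 * y))]
  congr 1
  · refine tsum_congr fun r => ?_
    rw [halfSamples_two_mul]
    congr 2; push_cast; ring
  · refine tsum_congr fun r => ?_
    rw [oddSamples, shiftedCardinal]
    congr 2; push_cast; ring

/-- The difference of the cardinal splines of successive levels in terms of Faber splines. -/
theorem cardinalSpline_sub {m : ℕ} (hm : 1 ≤ m) (y : ℝ) :
    cardinalSpline (2 * m) y - cardinalSpline (2 * m) (2 * y) =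
      (-1) ^ (m + 1) * 2 ^ (2 * m - 1) * conv (oddSamples m) (faberBase m) (y + (m - 1)) := by
  have hO := summable_oddSamples hm
  have hc := summable_cardinalCoeff hm
  have hb := norm_shiftedCardinal_le hm
  have hL := norm_cardinalSpline_le hm
  have hOb := norm_conv_le hO hb
  obtain ⟨C, hC⟩ := norm_faberBase_le hm
  obtain ⟨D, hD⟩ : ∃ D, ∀ x,
      ‖conv (samples m) (fun x => cardinalSpline (2 * m) (2 * x)) x‖ ≤ D :=
    ⟨_, norm_conv_le (summable_samples hm) fun x => hL (2 * x)⟩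
  -- Inverting E turns E ⋆ s = κ b into s = κ (c ⋆ b). Applying c to the parity splitting of the
  -- B-spline then produces the same expression.
  have h1 : faberBase m = fun x => ((-1) ^ (m + 1) / 2 ^ (2 * m - 1) : ℝ) •
      conv (cardinalCoeff (2 * m)) (shiftedCardinal m) x := by
    rw [← conv_cardinalCoeff_conv_samples hm hC, conv_samples_faberBase hm]
    exact funext fun x => conv_const_smul _ _ _ x
  have h2 : cardinalSpline (2 * m) y = cardinalSpline (2 * m) (2 * y) +
      conv (cardinalCoeff (2 * m)) (conv (oddSamples m) (shiftedCardinal m)) (y + (m - 1)) := by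
    conv_lhs => rw [cardinalSpline_eq_conv, funext (centered_eq_add hm),
      conv_add hc hD (fun x => hOb (x + (m - 1)))]
    congr 1
    · rw [conv_cardinalCoeff_conv_samples hm fun x => hL (2 * x)]
    · have := conv_shift (cardinalCoeff (2 * m)) (conv (oddSamples m) (shiftedCardinal m))
        (-((m : ℝ) - 1)) y
      simpa only [sub_neg_eq_add] using this
  rw [h1, conv_const_smul, conv_left_comm hO hc hb, h2, smul_eq_mul, add_sub_cancel_left,
    ← mul_assoc]
  have h3 : ((-1 : ℝ) ^ (m + 1)) * (-1) ^ (m + 1) = 1 := by rw [← mul_pow]; simp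
  field_simp
  rw [pow_two, h3, mul_one]

/-- The univariate Faber spline coefficient functionals. -/
noncomputable def univariateCoeff (m : ℕ) (j k : ℤ) (h : ℝ → ℝ) : ℝ :=
  ∑ l ∈ Finset.range (2 * m - 1),
    (if 0 ≤ j then (-1 : ℝ) ^ (m + l) else 1) * bspline (2 * m) ((l : ℝ) + 1) *
      (if 0 ≤ j then (fwdDiff ((2 : ℝ) ^ (-j - 1)))^[2 * m] h else h) (node j k l)

/-- Feeding h(l) = (-1)^l into the reindexing lemma cancels the signs and leaves the partition of
unity at 0. -/
theorem sum_bspline_add_one {m : ℕ} (hm : 1 ≤ m) :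
    ∑ l ∈ Finset.range (2 * m - 1), bspline (2 * m) ((l : ℝ) + 1) = 1 := by
  have h := sum_alternating_bspline hm fun l => (l.negOnePow : ℤ)
  have h1 : ∀ l : ℕ, (-1) ^ l * bspline (2 * m) ((l : ℝ) + 1) * (((l : ℤ).negOnePow : ℤ) : ℝ) =
      bspline (2 * m) ((l : ℝ) + 1) := fun l => by
    have h2 : ((-1 : ℝ) ^ l) * (-1) ^ l = 1 := by rw [← mul_pow]; simp
    have h3 : ((((l : ℤ).negOnePow : ℤˣ) : ℤ) : ℝ) = (-1) ^ l := by simp [Int.negOnePow]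
    rw [h3]
    linear_combination bspline (2 * m) ((l : ℝ) + 1) * h2
  simp_rw [h1] at h
  rw [h, ← tsum_mul_left]
  have h4 := tsum_centered_sub hm 0
  rw [← (Equiv.neg ℤ).tsum_eq] at h4
  refine Eq.trans ?_ h4
  refine tsum_congr fun j => ?_
  have h2 : ((-1 : ℝ) ^ m) * (-1) ^ m = 1 := by rw [← mul_pow]; simp
  have h3 : ((((m : ℤ).negOnePow : ℤˣ) : ℤ) : ℝ) = (-1) ^ m := by simp [Int.negOnePow]
  have h5 : ((j.negOnePow : ℤ) : ℝ) * (j.negOnePow : ℤ) = 1 := by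
    rw [← Int.cast_mul, ← Units.val_mul, Int.units_mul_self]
    simp
  rw [altSamples, Int.negOnePow_sub, Int.negOnePow_add, samples, Equiv.neg_apply]
  push_cast
  rw [h3, zero_sub, neg_neg]
  simp only [Int.negOnePow_one, Units.val_neg, Units.val_one, Int.cast_neg, Int.cast_one]
  rw [pow_succ]
  linear_combination centered m j * ((-1) ^ m * (-1) ^ m * h5 + h2)

theorem univariateCoeff_neg_one {m : ℕ} (hm : 1 ≤ m) (k : ℤ) (h : ℝ → ℝ) :
    univariateCoeff m (-1) k h = h k := by
  simp only [univariateCoeff, node, if_pos]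
  simp [← Finset.sum_mul, sum_bspline_add_one hm]

/-- The 2m-th difference expands into binomials, to which the alternating difference identity
applies. The prefactor is the reciprocal of the constant relating Faber splines to cardinal splines.
-/
theorem univariateCoeff_natCast {m : ℕ} (hm : 1 ≤ m) (j : ℕ) (k : ℤ) (h : ℝ → ℝ) :
    univariateCoeff m j k h = (-1) ^ (m + 1) * 2 ^ (2 * m - 1) *
      ∑' i : ℤ, (i.negOnePow : ℤ) * halfSamples m i *
        h ((2 * k + i + 2 * m - 1 : ℤ) / 2 ^ (j + 1)) := by
  have h1 := sum_alternating_bspline_diff hm fun n : ℤ => h ((2 * k + n : ℤ) / 2 ^ (j + 1))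
  have h2 : ∀ l : ℕ, ((fwdDiff ((2 : ℝ) ^ (-(j : ℤ) - 1)))^[2 * m] h) (node j k l) =
      ∑ i ∈ Finset.range (2 * m + 1), (-1) ^ i * ((2 * m).choose i : ℝ) *
        h ((2 * k + (l + i) : ℤ) / 2 ^ (j + 1)) := fun l => by
    rw [fwdDiff_iter_eq_sum_shift]
    refine Finset.sum_congr rfl fun i hi => ?_
    have h3 : node j k l + i • (2 : ℝ) ^ (-(j : ℤ) - 1) =
        (2 * k + (l + i) : ℤ) / 2 ^ (j + 1) := by
      rw [node, if_neg (by omega), show -(j : ℤ) - 1 = -((j + 1 : ℕ) : ℤ) by push_cast; ring,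
        zpow_neg, zpow_natCast, show (j : ℤ) + 1 = ((j + 1 : ℕ) : ℤ) by push_cast; ring,
        zpow_natCast, nsmul_eq_mul]
      push_cast
      ring
    rw [h3, zsmul_eq_mul]
    have h4 : (-1 : ℤ) ^ (2 * m - i) = (-1) ^ i := by
      have h5 : i ≤ 2 * m := by have := Finset.mem_range.1 hi; omega
      exact neg_one_pow_congr (by rw [Nat.even_sub h5]; simp)
    rw [h4]
    push_cast
    rfl
  rw [univariateCoeff]
  simp only [Nat.cast_nonneg, if_true, h2]
  have h3 : ∀ l : ℕ, (-1) ^ (m + l) * bspline (2 * m) ((l : ℝ) + 1) *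
      ∑ i ∈ Finset.range (2 * m + 1), (-1) ^ i * ((2 * m).choose i : ℝ) *
        h ((2 * k + (l + i) : ℤ) / 2 ^ (j + 1)) =
      (-1) ^ m * ((-1) ^ l * bspline (2 * m) ((l : ℝ) + 1) *
      ∑ i ∈ Finset.range (2 * m + 1), (-1) ^ i * ((2 * m).choose i : ℝ) *
        h ((2 * k + (l + i) : ℤ) / 2 ^ (j + 1))) := fun l => by
    rw [pow_add]; ring
  simp_rw [h3]
  rw [← Finset.mul_sum, h1, pow_succ]
  simp only [← add_sub_assoc, ← add_assoc]
  ring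

/-- The indicator function of a point. -/
noncomputable def pointMass (q : ℝ) (x : ℝ) : ℝ := if x = q then 1 else 0

/-- The part of a cardinal spline interpolant of mesh width `2^{-J}` due to the value at `q`. -/
noncomputable def gridSpline (m J : ℕ) (q x : ℝ) : ℝ :=
  ∑' n : ℤ, pointMass q (n / 2 ^ J) * cardinalSpline (2 * m) (2 ^ J * x - n)

theorem div_two_pow_eq_iff {J : ℕ} {a b : ℤ} :
    (a : ℝ) / 2 ^ J = b / 2 ^ J ↔ a = b := by
  rw [div_left_inj' (by positivity), Int.cast_inj]

theorem gridSpline_div (m J : ℕ) (n : ℤ) (x : ℝ) :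
    gridSpline m J (n / 2 ^ J) x = cardinalSpline (2 * m) (2 ^ J * x - n) := by
  rw [gridSpline, tsum_eq_single n]
  · simp [pointMass]
  · intro k hk
    rw [pointMass, if_neg (by rwa [div_two_pow_eq_iff]), zero_mul]

theorem gridSpline_eq_zero {m J : ℕ} {q : ℝ} (hq : ∀ n : ℤ, (n : ℝ) / 2 ^ J ≠ q) (x : ℝ) :
    gridSpline m J q x = 0 := by
  rw [gridSpline, ← tsum_zero (β := ℤ)]
  refine tsum_congr fun n => ?_
  rw [pointMass, if_neg (hq n), zero_mul]

theorem univariateCoeff_pointMass_eq_zero {m : ℕ} (hm : 1 ≤ m) {j : ℕ} {q : ℝ}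
    (hq : ∀ n : ℤ, (n : ℝ) / 2 ^ (j + 1) ≠ q) (k : ℤ) :
    univariateCoeff m j k (pointMass q) = 0 := by
  rw [univariateCoeff_natCast hm]
  simp only [pointMass, hq, if_false, mul_zero, tsum_zero]

theorem univariateCoeff_pointMass {m : ℕ} (hm : 1 ≤ m) (j : ℕ) (n k : ℤ) :
    univariateCoeff m j k (pointMass (n / 2 ^ (j + 1))) =
      (-1) ^ m * 2 ^ (2 * m - 1) *
        ((n.negOnePow : ℤ) * halfSamples m (n - 2 * k - 2 * m + 1)) := by
  rw [univariateCoeff_natCast hm, tsum_eq_single (n - 2 * k - 2 * m + 1)]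
  · rw [pointMass, if_pos (by rw [div_two_pow_eq_iff]; ring)]
    rw [Int.negOnePow_add, Int.negOnePow_sub, Int.negOnePow_sub, Int.negOnePow_two_mul,
      Int.negOnePow_two_mul]
    simp [pow_succ]
  · intro i hi
    rw [pointMass, if_neg, mul_zero]
    rw [div_two_pow_eq_iff]
    omega

/-- Needed to write the sum over ℤ^d of products as a product of sums. -/
theorem finite_support_univariateCoeff {m : ℕ} (hm : 1 ≤ m) {j : ℤ} (hj : -1 ≤ j) (q : ℝ) :
    (Function.support fun k => univariateCoeff m j k (pointMass q)).Finite := by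
  rcases hj.eq_or_lt with rfl | hj
  · refine Set.Subsingleton.finite fun a ha b hb => ?_
    simp only [univariateCoeff_neg_one hm, pointMass, Function.mem_support, ne_eq,
      ite_eq_right_iff, one_ne_zero, imp_false, not_not] at ha hb
    exact_mod_cast ha.trans hb.symm
  · lift j to ℕ using by omega
    by_cases hq : ∃ n : ℤ, (n : ℝ) / 2 ^ (j + 1) = q
    · obtain ⟨n, rfl⟩ := hq
      refine ((Finset.Icc (-(2 * m) : ℤ) (2 * m)).finite_toSet.preimage
        (f := fun k => n - 2 * k - 2 * m + 1) fun a _ b _ h => by simpa using h).subset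
        fun k hk => ?_
      by_contra h
      refine hk ?_
      simp only
      rw [univariateCoeff_pointMass hm, halfSamples_eq_zero hm h, mul_zero, mul_zero]
    · push Not at hq
      simp [univariateCoeff_pointMass_eq_zero hm hq]

/-- The heart of the telescoping: a level adds exactly what refinement of the mesh adds. The parity
of the index of q on the finer grid decides whether odd or even half-integer samples occur as
coefficients. -/
theorem tsum_univariateCoeff_mul_faberSpline {m : ℕ} (hm : 1 ≤ m) (j : ℕ) (q x : ℝ) :
    ∑' k : ℤ, univariateCoeff m j k (pointMass q) * faberSpline m j k x =
      gridSpline m (j + 1) q x - gridSpline m j q x := by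
  have hs : ∀ k : ℤ, faberSpline m j k x = faberBase m (2 ^ j * x - k) := fun k => by
    rw [faberSpline_eq hm (by omega), zpow_natCast]
  simp_rw [hs]
  set y : ℝ := 2 ^ j * x with hy
  have h3 : ((-1 : ℝ) ^ m) * (-1) ^ m = 1 := by rw [← mul_pow]; simp
  by_cases hq : ∃ n : ℤ, (n : ℝ) / 2 ^ (j + 1) = q
  · obtain ⟨n, rfl⟩ := hq
    rw [gridSpline_div, pow_succ' (2 : ℝ) j, mul_assoc, ← hy, ← pow_succ' (2 : ℝ) j]
    simp_rw [univariateCoeff_pointMass hm]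
    rcases Int.even_or_odd' n with ⟨r, rfl | rfl⟩
    -- Here q lies on the coarse grid too; the odd half-integer samples reproduce the difference of
    -- two cardinal splines.
    · have h1 : ((2 * r : ℤ) : ℝ) / 2 ^ (j + 1) = r / 2 ^ j := by
        rw [pow_succ']; push_cast; field_simp
      rw [h1, gridSpline_div, ← hy]
      have h2 := cardinalSpline_sub hm (y - r)
      have h4 : ∑' k : ℤ, (-1) ^ m * 2 ^ (2 * m - 1) * (((2 * r).negOnePow : ℤ) *
          halfSamples m (2 * r - 2 * k - 2 * m + 1)) * faberBase m (y - k) =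
          (-1) ^ m * 2 ^ (2 * m - 1) *
            conv (oddSamples m) (faberBase m) (y - r + (m - 1)) := by
        rw [conv, ← tsum_mul_left, ← (Equiv.addRight (r - m + 1)).tsum_eq]
        refine tsum_congr fun k => ?_
        rw [Equiv.coe_addRight, Int.negOnePow_two_mul, oddSamples, ← halfSamples_neg hm,
          smul_eq_mul,
          show -(2 * r - 2 * (k + (r - m + 1)) - 2 * m + 1) = 2 * k + 1 by ring,
          show y - ((k + (r - m + 1) : ℤ) : ℝ) = y - r + (m - 1) - k by push_cast; ring]
        push_cast
        ring
      rw [h4]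
      push_cast
      rw [← mul_sub]
      rw [pow_succ] at h2
      linear_combination h2
    -- Here q is new on the finer grid; the coefficients are integer samples, and E ⋆ s is a single
    -- cardinal spline.
    · rw [gridSpline_eq_zero, sub_zero]
      · have h2 := congrFun (conv_samples_faberBase hm) (y - r - 1 + m)
        have h4 : ∑' k : ℤ, (-1) ^ m * 2 ^ (2 * m - 1) * (((2 * r + 1).negOnePow : ℤ) *
            halfSamples m (2 * r + 1 - 2 * k - 2 * m + 1)) * faberBase m (y - k) =
            (-1) ^ (m + 1) * 2 ^ (2 * m - 1) *
              conv (samples m) (faberBase m) (y - r - 1 + m) := by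
          rw [conv, ← tsum_mul_left, ← (Equiv.addRight (r + 1 - m)).tsum_eq]
          refine tsum_congr fun k => ?_
          rw [Equiv.coe_addRight, Int.negOnePow_succ, Int.negOnePow_two_mul,
            ← halfSamples_two_mul, ← halfSamples_neg hm, smul_eq_mul,
            show -(2 * r + 1 - 2 * (k + (r + 1 - m)) - 2 * m + 1) = 2 * k by ring,
            show y - ((k + (r + 1 - m) : ℤ) : ℝ) = y - r - 1 + m - k by push_cast; ring]
          push_cast
          ring
        rw [h4, h2, shiftedCardinal, smul_eq_mul, pow_succ]
        push_cast
        rw [show 2 * (y - r - 1 + m) - (2 * m - 1) = 2 * y - (2 * r + 1) by ring]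
        field_simp
        linear_combination cardinalSpline (2 * m) (2 * y - (2 * r + 1)) * h3
      · intro i hi
        rw [pow_succ', ← div_div, div_left_inj' (by positivity), eq_div_iff two_ne_zero] at hi
        have : i * 2 = 2 * r + 1 := by exact_mod_cast hi
        omega
  · push Not at hq
    rw [gridSpline_eq_zero hq, gridSpline_eq_zero]
    · simp [univariateCoeff_pointMass_eq_zero hm hq]
    · intro n hn
      refine hq (2 * n) ?_
      rw [← hn, pow_succ']; push_cast; field_simp

/-- The univariate expansion of a point mass on the grid of width `2^{-N}` reproduces the
cardinal spline of that mesh width. -/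
theorem sum_tsum_univariateCoeff {m : ℕ} (hm : 1 ≤ m) {N : ℕ} (hN : 2 ≤ N) (p : ℤ) (x : ℝ) :
    ∑ j ∈ (Finset.Icc (-1 : ℤ) N).filter fun a : ℤ => |a| < (N : ℤ),
      ∑' k : ℤ, univariateCoeff m j k (pointMass (p / 2 ^ N)) * faberSpline m j k x =
      cardinalSpline (2 * m) (2 ^ N * x - p) := by
  -- This uses N ≥ 2: for N = 1 the condition |a| < 1 would exclude the level -1, which starts the
  -- telescoping.
  have h1 : ((Finset.Icc (-1 : ℤ) N).filter fun a : ℤ => |a| < (N : ℤ)) =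
      insert (-1) ((Finset.range N).map ⟨fun n : ℕ => (n : ℤ), Nat.cast_injective⟩) := by
    ext a
    simp only [Finset.mem_filter, Finset.mem_Icc, abs_lt, Finset.mem_insert, Finset.mem_map,
      Finset.mem_range, Function.Embedding.coeFn_mk]
    constructor
    · rintro ⟨⟨h1, h2⟩, h3, h4⟩
      rcases h1.eq_or_lt with h | h
      · exact Or.inl h.symm
      · exact Or.inr ⟨a.toNat, by omega, by omega⟩
    · rintro (rfl | ⟨n, hn, rfl⟩) <;> omega
  rw [h1, Finset.sum_insert (by simp), Finset.sum_map]
  simp only [Function.Embedding.coeFn_mk, tsum_univariateCoeff_mul_faberSpline hm]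
  rw [Finset.sum_range_sub (fun j => gridSpline m j ((p : ℝ) / 2 ^ N) x), gridSpline_div]
  have h2 : ∑' k : ℤ, univariateCoeff m (-1) k (pointMass (p / 2 ^ N)) *
      faberSpline m (-1) k x = gridSpline m 0 (p / 2 ^ N) x := by
    rw [gridSpline]
    refine tsum_congr fun k => ?_
    rw [univariateCoeff_neg_one hm, faberSpline_neg_one, pow_zero, div_one, one_mul]
  rw [h2]
  ring

/-! ### Tensor products -/

section tensor

variable {d : ℕ} {E : Type*}

/-- One step of the mixed difference: the iterated difference in direction `i` if `i ∈ e`. -/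
noncomputable def diffStep [AddCommGroup E] (M : ℕ) (e : Finset (Fin d)) (h : Fin d → ℝ)
    (i : Fin d) (g : (Fin d → ℝ) → E) : (Fin d → ℝ) → E :=
  if i ∈ e then (fwdDiff (Pi.single i (h i) : Fin d → ℝ))^[M] g else g

theorem mixedDiff_eq_foldr [AddCommGroup E] (M : ℕ) (e : Finset (Fin d)) (h : Fin d → ℝ)
    (f : (Fin d → ℝ) → E) :
    mixedDiff M e h f = (List.finRange d).foldr (diffStep M e h) f := rfl

theorem diffStep_add [AddCommGroup E] (M : ℕ) (e : Finset (Fin d)) (h : Fin d → ℝ) (i : Fin d)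
    (f g : (Fin d → ℝ) → E) :
    diffStep M e h i (f + g) = diffStep M e h i f + diffStep M e h i g := by
  rw [diffStep, diffStep, diffStep]
  split_ifs
  · exact fwdDiff_iter_add _ _ _ _
  · rfl

theorem foldr_diffStep_add [AddCommGroup E] (M : ℕ) (e : Finset (Fin d)) (h : Fin d → ℝ)
    (L : List (Fin d)) (f g : (Fin d → ℝ) → E) :
    L.foldr (diffStep M e h) (f + g) = L.foldr (diffStep M e h) f + L.foldr (diffStep M e h) g := by
  induction L with
  | nil => rfl
  | cons i L ih => rw [List.foldr_cons, ih, diffStep_add, List.foldr_cons, List.foldr_cons]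

theorem mixedDiff_add [AddCommGroup E] (M : ℕ) (e : Finset (Fin d)) (h : Fin d → ℝ)
    (f g : (Fin d → ℝ) → E) :
    mixedDiff M e h (f + g) = mixedDiff M e h f + mixedDiff M e h g := by
  rw [mixedDiff_eq_foldr, foldr_diffStep_add, mixedDiff_eq_foldr, mixedDiff_eq_foldr]

theorem faberCoeff_add [AddCommGroup E] [Module ℝ E] (m : ℕ) (j k : Fin d → ℤ)
    (f g : (Fin d → ℝ) → E) :
    faberCoeff m j k (f + g) = faberCoeff m j k f + faberCoeff m j k g := by
  rw [faberCoeff, faberCoeff, faberCoeff, ← Finset.sum_add_distrib]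
  simp only [mixedDiff_add, Pi.add_apply, smul_add]

theorem faberCoeff_sum [AddCommGroup E] [Module ℝ E] {ι : Type*} (m : ℕ) (j k : Fin d → ℤ)
    (P : Finset ι) (f : ι → (Fin d → ℝ) → E) :
    faberCoeff m j k (∑ p ∈ P, f p) = ∑ p ∈ P, faberCoeff m j k (f p) := by
  classical
  induction P using Finset.induction_on with
  | empty =>
    have h := faberCoeff_add m j k (0 : (Fin d → ℝ) → E) 0
    rw [add_zero, left_eq_add] at h
    simpa using h
  | insert p P hp ih => rw [Finset.sum_insert hp, faberCoeff_add, ih, Finset.sum_insert hp]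

/-- The points with coordinates in `2^{-N} ℤ`. -/
def dyadicGrid (d N : ℕ) : Set (Fin d → ℝ) := {x | ∀ i, ∃ n : ℤ, x i = n / 2 ^ N}

theorem iterate_fwdDiff_congr [AddCommGroup E] {S : Set (Fin d → ℝ)} {a : Fin d → ℝ}
    (ha : ∀ x ∈ S, x + a ∈ S) {f g : (Fin d → ℝ) → E} (hfg : ∀ x ∈ S, f x = g x) (M : ℕ) :
    ∀ x ∈ S, (fwdDiff a)^[M] f x = (fwdDiff a)^[M] g x := by
  induction M with
  | zero => exact hfg
  | succ M ih =>
    intro x hx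
    rw [Function.iterate_succ_apply', Function.iterate_succ_apply', fwdDiff, fwdDiff, ih x hx,
      ih _ (ha x hx)]

theorem mixedDiff_congr [AddCommGroup E] {S : Set (Fin d → ℝ)} {M : ℕ} {e : Finset (Fin d)}
    {h : Fin d → ℝ} (hS : ∀ i ∈ e, ∀ x ∈ S, x + Pi.single i (h i) ∈ S) {f g : (Fin d → ℝ) → E}
    (hfg : ∀ x ∈ S, f x = g x) : ∀ x ∈ S, mixedDiff M e h f x = mixedDiff M e h g x := by
  have key : ∀ L : List (Fin d), ∀ x ∈ S,
      L.foldr (diffStep M e h) f x = L.foldr (diffStep M e h) g x := by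
    intro L
    induction L with
    | nil => exact hfg
    | cons i L ih =>
      rw [List.foldr_cons, List.foldr_cons, diffStep, diffStep]
      split_ifs with hi
      · exact iterate_fwdDiff_congr (hS i hi) ih M
      · exact ih
  simp only [mixedDiff_eq_foldr]
  exact key _

theorem exists_intCast_div_two_pow_eq_zpow {a : ℤ} {N : ℕ} (ha : -(N : ℤ) ≤ a) :
    ∃ n : ℤ, (2 : ℝ) ^ a = n / 2 ^ N := by
  refine ⟨2 ^ (a + N).toNat, ?_⟩
  rw [eq_div_iff (by positivity), ← zpow_natCast, ← zpow_add₀ two_ne_zero]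
  push_cast
  rw [← zpow_natCast, Int.toNat_of_nonneg (by omega)]

theorem node_mem_grid {j : ℤ} {N : ℕ} (hj : j < N) (k : ℤ) (l : ℕ) :
    ∃ n : ℤ, node j k l = n / 2 ^ N := by
  rw [node]
  split_ifs with h
  · exact ⟨k * 2 ^ N, by push_cast; field_simp⟩
  · obtain ⟨n, hn⟩ := exists_intCast_div_two_pow_eq_zpow (a := -(j + 1)) (N := N) (by omega)
    refine ⟨(2 * k + l) * n, ?_⟩
    rw [div_eq_mul_inv, ← zpow_neg, hn]
    push_cast
    ring

/-- For levels below N both the nodes and the step sizes are multiples of 2^{-N}, so every sampled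
point lies on the grid. -/
theorem faberCoeff_congr [AddCommGroup E] [Module ℝ E] {m N : ℕ} {j : Fin d → ℤ}
    (hj : ∀ i, -1 ≤ j i ∧ j i < N) (k : Fin d → ℤ) {f g : (Fin d → ℝ) → E}
    (hfg : ∀ x ∈ dyadicGrid d N, f x = g x) : faberCoeff m j k f = faberCoeff m j k g := by
  rw [faberCoeff, faberCoeff]
  refine Finset.sum_congr rfl fun l _ => ?_
  congr 1
  refine mixedDiff_congr (S := dyadicGrid d N) (fun i _ x hx i' => ?_) hfg _
    fun i => node_mem_grid (hj i).2 _ _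
  obtain ⟨n, hn⟩ := hx i'
  obtain ⟨n', hn'⟩ := exists_intCast_div_two_pow_eq_zpow (a := -j i - 1) (N := N)
    (by linarith [(hj i).2])
  by_cases h : i' = i
  · subst h
    refine ⟨n + n', ?_⟩
    rw [Pi.add_apply, Pi.single_eq_same, hn, hn']
    push_cast
    ring
  · exact ⟨n, by rw [Pi.add_apply, Pi.single_eq_of_ne h, add_zero, hn]⟩

theorem iterate_fwdDiff_prod [AddCommGroup E] [Module ℝ E] (i : Fin d) (a : ℝ) (M : ℕ)
    (φ : Fin d → ℝ → ℝ) (v : E) :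
    (fwdDiff (Pi.single i a : Fin d → ℝ))^[M] (fun x => (∏ t, φ t (x t)) • v) =
      fun x => (∏ t, (if t = i then (fwdDiff a)^[M] (φ t) else φ t) (x t)) • v := by
  induction M with
  | zero => simp
  | succ M ih =>
    rw [Function.iterate_succ_apply', ih]
    funext x
    rw [fwdDiff, ← sub_smul]
    congr 1
    rw [← Finset.mul_prod_erase _ _ (Finset.mem_univ i), ← Finset.mul_prod_erase _ _
      (Finset.mem_univ i), ← Finset.mul_prod_erase _ _ (Finset.mem_univ i)]
    have h1 : ∏ t ∈ Finset.univ.erase i, (if t = i then (fwdDiff a)^[M] (φ t) else φ t)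
        ((x + (Pi.single i a : Fin d → ℝ)) t) = ∏ t ∈ Finset.univ.erase i,
        (if t = i then (fwdDiff a)^[M] (φ t) else φ t) (x t) :=
      Finset.prod_congr rfl fun t ht => by
        rw [Pi.add_apply, Pi.single_eq_of_ne (Finset.ne_of_mem_erase ht), add_zero]
    have h2 : ∏ t ∈ Finset.univ.erase i, (if t = i then (fwdDiff a)^[M + 1] (φ t) else φ t)
        (x t) = ∏ t ∈ Finset.univ.erase i,
        (if t = i then (fwdDiff a)^[M] (φ t) else φ t) (x t) :=
      Finset.prod_congr rfl fun t ht => by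
        rw [if_neg (Finset.ne_of_mem_erase ht), if_neg (Finset.ne_of_mem_erase ht)]
    rw [h1, h2, ← sub_mul, if_pos rfl, if_pos rfl, Pi.add_apply, Pi.single_eq_same,
      Function.iterate_succ_apply', fwdDiff]

theorem mixedDiff_prod [AddCommGroup E] [Module ℝ E] (M : ℕ) (e : Finset (Fin d))
    (h : Fin d → ℝ) (φ : Fin d → ℝ → ℝ) (v : E) :
    mixedDiff M e h (fun x => (∏ t, φ t (x t)) • v) =
      fun x => (∏ t, (if t ∈ e then (fwdDiff (h t))^[M] (φ t) else φ t) (x t)) • v := by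
  -- Without repetitions, each direction met in the fold still carries its original factor.
  have key : ∀ L : List (Fin d), L.Nodup →
      L.foldr (diffStep M e h) (fun x => (∏ t, φ t (x t)) • v) =
      fun x => (∏ t, (if t ∈ L ∧ t ∈ e then (fwdDiff (h t))^[M] (φ t) else φ t) (x t)) • v := by
    intro L hL
    induction L with
    | nil => simp
    | cons i L ih =>
      rw [List.nodup_cons] at hL
      rw [List.foldr_cons, ih hL.2, diffStep]
      split_ifs with hi
      · rw [iterate_fwdDiff_prod]
        funext x
        congr 1
        refine Finset.prod_congr rfl fun t _ => ?_
        by_cases ht : t = i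
        · subst ht; simp [hi, hL.1]
        · simp [ht]
      · funext x
        congr 1
        refine Finset.prod_congr rfl fun t _ => ?_
        by_cases ht : t = i
        · subst ht; simp [hi]
        · simp [ht]
  have := key _ (List.nodup_finRange d)
  simpa [mixedDiff_eq_foldr] using this

/-- Differences, signs and weights all act coordinatewise, and the sum over the box of l factorises.
-/
theorem faberCoeff_prod [AddCommGroup E] [Module ℝ E] (m : ℕ) (j k : Fin d → ℤ)
    (φ : Fin d → ℝ → ℝ) (v : E) :
    faberCoeff m j k (fun x => (∏ t, φ t (x t)) • v) =
      (∏ t, univariateCoeff m (j t) (k t) (φ t)) • v := by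
  simp only [univariateCoeff]
  rw [faberCoeff, Finset.prod_univ_sum, Finset.sum_smul]
  refine Finset.sum_congr rfl fun l _ => ?_
  rw [mixedDiff_prod, smul_smul, activeDirs, Finset.prod_filter]
  simp only [Finset.prod_mul_distrib, Finset.mem_filter, Finset.mem_univ, true_and]

theorem hasSum_prod_pi {u : Fin d → ℤ → ℝ} (hu : ∀ i, (Function.support (u i)).Finite) :
    HasSum (fun k : Fin d → ℤ => ∏ i, u i (k i)) (∏ i, ∑' n, u i n) := by
  have h1 : ∀ i, ∑' n, u i n = ∑ n ∈ (hu i).toFinset, u i n := fun i =>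
    tsum_eq_sum fun n hn => by simpa using hn
  simp_rw [h1]
  rw [Finset.prod_univ_sum]
  refine hasSum_sum_of_ne_finset_zero fun k hk => ?_
  rw [Fintype.mem_piFinset, not_forall] at hk
  obtain ⟨i, hi⟩ := hk
  exact Finset.prod_eq_zero (Finset.mem_univ i) (by simpa using hi)

theorem eq_sum_pointMass_on_grid [AddCommGroup E] [Module ℝ E] {f : (Fin d → ℝ) → E} {N : ℕ}
    {P : Finset (Fin d → ℤ)} (hP : ∀ p ∉ P, f (fun i => p i / 2 ^ N) = 0) :
    ∀ x ∈ dyadicGrid d N, f x =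
      (∑ p ∈ P, fun y : Fin d → ℝ => (∏ i, pointMass (p i / 2 ^ N) (y i)) •
        f (fun i => p i / 2 ^ N)) x := by
  intro x hx
  choose n hn using hx
  obtain rfl : x = fun i => (n i : ℝ) / 2 ^ N := funext hn
  rw [Finset.sum_apply]
  have h1 : ∀ p : Fin d → ℤ, p ≠ n →
      ∏ i, pointMass ((p i : ℝ) / 2 ^ N) ((n i : ℝ) / 2 ^ N) = 0 := fun p hp => by
    obtain ⟨i, hi⟩ := Function.ne_iff.1 hp
    refine Finset.prod_eq_zero (Finset.mem_univ i) ?_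
    rw [pointMass, if_neg]
    rw [div_two_pow_eq_iff]
    exact hi.symm
  rw [Finset.sum_eq_single n]
  · simp [pointMass]
  · intro p _ hp
    rw [h1 p hp, zero_smul]
  · intro hn'
    rw [hP n hn', smul_zero]

/-- The partial sums of the tensor Faber spline expansion are the tensor product cardinal spline
interpolants. -/
theorem partialSum_eq [NormedAddCommGroup E] [NormedSpace ℝ E] {m : ℕ} (hm : 1 ≤ m) {N : ℕ}
    (hN : 2 ≤ N) {f : (Fin d → ℝ) → E} {P : Finset (Fin d → ℤ)}
    (hP : ∀ p ∉ P, f (fun i => p i / 2 ^ N) = 0) (x : Fin d → ℝ) :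
    partialSum m N f x =
      ∑ p ∈ P, (∏ i, cardinalSpline (2 * m) (2 ^ N * x i - p i)) •
        f (fun i => p i / 2 ^ N) := by
  have hlev : ∀ j ∈ levels d N, ∀ i, -1 ≤ j i ∧ j i < N := fun j hj i => by
    have := Fintype.mem_piFinset.1 hj i
    rw [Finset.mem_filter, Finset.mem_Icc, abs_lt] at this
    exact ⟨this.1.1, this.2.2⟩
  have h1 : ∀ j ∈ levels d N, ∑' k : Fin d → ℤ, tensorFaberSpline m j k x • faberCoeff m j k f =
      ∑ p ∈ P, (∏ i, ∑' k : ℤ, univariateCoeff m (j i) k (pointMass (p i / 2 ^ N)) *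
        faberSpline m (j i) k (x i)) • f (fun i => p i / 2 ^ N) := fun j hj => by
    have h2 : ∀ k, tensorFaberSpline m j k x • faberCoeff m j k f =
        ∑ p ∈ P, (∏ i, univariateCoeff m (j i) (k i) (pointMass (p i / 2 ^ N)) *
          faberSpline m (j i) (k i) (x i)) • f (fun i => p i / 2 ^ N) := fun k => by
      rw [faberCoeff_congr (hlev j hj) k (eq_sum_pointMass_on_grid hP), faberCoeff_sum,
        Finset.smul_sum]
      refine Finset.sum_congr rfl fun p _ => ?_
      rw [faberCoeff_prod m j k fun i => pointMass ((p i : ℝ) / 2 ^ N), smul_smul,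
        tensorFaberSpline, Finset.prod_mul_distrib, mul_comm]
    simp_rw [h2]
    refine HasSum.tsum_eq (hasSum_sum fun p _ => ?_)
    refine (hasSum_prod_pi (u := fun i k => univariateCoeff m (j i) k (pointMass (p i / 2 ^ N)) *
      faberSpline m (j i) k (x i)) fun i => ?_).smul_const (f fun i => p i / 2 ^ N)
    exact (finite_support_univariateCoeff hm (hlev j hj i).1 (p i / 2 ^ N)).subset
      (Function.support_mul_subset_left _ _)
  rw [partialSum, Finset.sum_congr rfl h1, Finset.sum_comm]
  refine Finset.sum_congr rfl fun p _ => ?_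
  rw [← Finset.sum_smul]
  congr 1
  -- The levels form a box, so their sum too is a product of univariate sums, each of which
  -- telescopes.
  refine (Finset.prod_univ_sum (fun _ => (Finset.Icc (-1 : ℤ) N).filter fun a : ℤ => |a| < (N : ℤ))
    fun i j => ∑' k : ℤ, univariateCoeff m j k (pointMass (p i / 2 ^ N)) *
      faberSpline m j k (x i)).symm.trans ?_
  exact Finset.prod_congr rfl fun i _ => sum_tsum_univariateCoeff hm hN (p i) (x i)

end tensor

/-! ### Uniform convergence -/

section convergence

variable {d : ℕ} {E : Type*} [NormedAddCommGroup E]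

theorem sum_prod_abs_cardinalSpline_le {m : ℕ} {A : ℝ}
    (hA : ∀ (t : ℝ) (P : Finset ℤ), ∑ p ∈ P, |cardinalSpline (2 * m) (t - p)| ≤ A)
    (t : Fin d → ℝ) (Q : Finset ℤ) :
    ∑ p ∈ Fintype.piFinset fun _ : Fin d => Q, ∏ i, |cardinalSpline (2 * m) (t i - p i)| ≤
      A ^ d := by
  refine (Finset.prod_univ_sum (fun _ : Fin d => Q)
    fun i n => |cardinalSpline (2 * m) (t i - n)|).symm.trans_le ?_
  refine (Finset.prod_le_prod (fun i _ => Finset.sum_nonneg fun _ _ => abs_nonneg _)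
    fun i _ => hA (t i) Q).trans_eq ?_
  simp

/-- The indicator involves the coordinate i₀ alone, so the sum factorises with one tail factor. That
factor is bounded by A τ instead of τ to keep the exponent d. -/
theorem sum_prod_abs_cardinalSpline_tail_le {m : ℕ} {A τ R : ℝ} (hA1 : 1 ≤ A) (hτ : 0 ≤ τ)
    (hA : ∀ (t : ℝ) (P : Finset ℤ), ∑ p ∈ P, |cardinalSpline (2 * m) (t - p)| ≤ A)
    (hR : ∀ (t : ℝ) (P : Finset ℤ), (∀ p ∈ P, R ≤ |t - p|) →
      ∑ p ∈ P, |cardinalSpline (2 * m) (t - p)| ≤ τ)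
    (t : Fin d → ℝ) (Q : Finset ℤ) (i₀ : Fin d) :
    ∑ p ∈ Fintype.piFinset fun _ : Fin d => Q, (∏ i, |cardinalSpline (2 * m) (t i - p i)|) *
      (if R ≤ |t i₀ - p i₀| then 1 else 0) ≤ A ^ d * τ := by
  have h1 : ∀ p : Fin d → ℤ, (∏ i, |cardinalSpline (2 * m) (t i - p i)|) *
      (if R ≤ |t i₀ - p i₀| then (1 : ℝ) else 0) =
      ∏ i, (fun (i : Fin d) (n : ℤ) => |cardinalSpline (2 * m) (t i - n)| *
        if i = i₀ then (if R ≤ |t i - n| then 1 else 0) else 1) i (p i) := fun p => by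
    simp only
    rw [Finset.prod_mul_distrib, Finset.prod_ite_eq' Finset.univ i₀
      (fun i => if R ≤ |t i - p i| then (1 : ℝ) else 0), if_pos (Finset.mem_univ _)]
  refine (Finset.sum_congr rfl fun p _ => h1 p).trans_le ?_
  refine (Finset.prod_univ_sum (fun _ : Fin d => Q) fun (i : Fin d) (n : ℤ) =>
    |cardinalSpline (2 * m) (t i - n)| *
      if i = i₀ then (if R ≤ |t i - n| then (1 : ℝ) else 0) else 1).symm.trans_le ?_
  have h2 : ∏ i : Fin d, A * (if i = i₀ then τ else 1) = A ^ d * τ := by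
    rw [Finset.prod_mul_distrib, Finset.prod_ite_eq' Finset.univ i₀ (fun _ => τ),
      if_pos (Finset.mem_univ _)]
    simp
  rw [← h2]
  refine Finset.prod_le_prod (fun i _ => Finset.sum_nonneg fun n _ => ?_) fun i _ => ?_
  · refine mul_nonneg (abs_nonneg _) ?_
    split_ifs <;> norm_num
  · split_ifs with hi
    · simp only [mul_ite, mul_one, mul_zero]
      rw [← Finset.sum_filter]
      exact (hR (t i) _ fun p hp => (Finset.mem_filter.1 hp).2).trans
        (le_mul_of_one_le_left hτ hA1)
    · simpa using hA (t i) Q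

/-- If some coordinate differs by at least δ, the crude bound 2C applies; counting such coordinates
separates the directions for the tail estimate. -/
theorem norm_sub_le_add_sum {f : (Fin d → ℝ) → E} {C ε δ : ℝ} (hε : 0 ≤ ε) (hδ : 0 < δ)
    (hC : ∀ x, ‖f x‖ ≤ C) (hf : ∀ x y, dist x y < δ → dist (f x) (f y) < ε)
    (x y : Fin d → ℝ) :
    ‖f x - f y‖ ≤ ε + 2 * C * ∑ i, (if δ ≤ |x i - y i| then 1 else 0) := by
  have hC0 : 0 ≤ C := (norm_nonneg _).trans (hC x)
  have hs : ∀ i ∈ (Finset.univ : Finset (Fin d)),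
      (0 : ℝ) ≤ if δ ≤ |x i - y i| then 1 else 0 := fun i _ => by split_ifs <;> norm_num
  by_cases h : ∃ i, δ ≤ |x i - y i|
  · obtain ⟨i, hi⟩ := h
    have h1 := Finset.single_le_sum hs (Finset.mem_univ i)
    rw [if_pos hi] at h1
    have h2 := norm_sub_le (f x) (f y)
    nlinarith [hC x, hC y]
  · push Not at h
    have h1 := hf x y ((dist_pi_lt_iff hδ).2 fun i => by rw [Real.dist_eq]; exact h i)
    rw [dist_eq_norm] at h1
    have h2 := Finset.sum_nonneg hs
    nlinarith

theorem exists_finset_grid_support {f : (Fin d → ℝ) → E} (hf : HasCompactSupport f) (N : ℕ) :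
    ∃ Q₀ : Finset ℤ, ∀ p : Fin d → ℤ, f (fun i => p i / 2 ^ N) ≠ 0 → ∀ i, p i ∈ Q₀ := by
  obtain ⟨B, hB⟩ := hf.isCompact.isBounded.subset_closedBall (0 : Fin d → ℝ)
  refine ⟨Finset.Icc (-⌈B * 2 ^ N⌉) ⌈B * 2 ^ N⌉, fun p hp i => ?_⟩
  have h1 := hB (subset_tsupport f hp)
  rw [mem_closedBall_zero_iff] at h1
  have h2 := (norm_le_pi_norm _ i).trans h1
  rw [Real.norm_eq_abs, abs_div, abs_of_pos (show (0 : ℝ) < 2 ^ N by positivity),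
    div_le_iff₀ (by positivity)] at h2
  have h3 : |(p i : ℝ)| ≤ ⌈B * 2 ^ N⌉ := h2.trans (Int.le_ceil _)
  rw [← Int.cast_abs, Int.cast_le, abs_le] at h3
  exact Finset.mem_Icc.2 h3

/-- The three terms come from the truncated partition of unity, the nodes near x, and the nodes far
from x in some direction. -/
theorem norm_sub_partialSum_le [NormedSpace ℝ E] {m : ℕ} (hm : 1 ≤ m) {N : ℕ} (hN : 2 ≤ N)
    {f : (Fin d → ℝ) → E} (hf : HasCompactSupport f) {A τ R C ε δ : ℝ} (hA1 : 1 ≤ A)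
    (hτ : 0 ≤ τ)
    (hA : ∀ (t : ℝ) (P : Finset ℤ), ∑ p ∈ P, |cardinalSpline (2 * m) (t - p)| ≤ A)
    (hR : ∀ (t : ℝ) (P : Finset ℤ), (∀ p ∈ P, R ≤ |t - p|) →
      ∑ p ∈ P, |cardinalSpline (2 * m) (t - p)| ≤ τ)
    (hε : 0 < ε) (hδ : 0 < δ) (hC : ∀ x, ‖f x‖ ≤ C)
    (hfc : ∀ x y, dist x y < δ → dist (f x) (f y) < ε) (hRδ : R ≤ 2 ^ N * δ)
    (x : Fin d → ℝ) :
    ‖f x - partialSum m N f x‖ ≤ ε + A ^ d * ε + 2 * C * (d * (A ^ d * τ)) := by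
  have hC0 : 0 ≤ C := (norm_nonneg _).trans (hC x)
  obtain ⟨Q₀, hQ₀⟩ := exists_finset_grid_support hf N
  set t : Fin d → ℝ := fun i => 2 ^ N * x i with ht
  set Λ : (Fin d → ℤ) → ℝ := fun p => ∏ i, cardinalSpline (2 * m) (t i - p i) with hΛ
  have hlim : Tendsto (fun Q : Finset ℤ => ‖(1 - ∏ i, ∑ n ∈ Q,
      cardinalSpline (2 * m) (t i - n)) • f x‖) atTop (𝓝 0) := by
    have h1 : Tendsto (fun Q : Finset ℤ => ∏ i, ∑ n ∈ Q, cardinalSpline (2 * m) (t i - n)) atTop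
        (𝓝 (∏ _i : Fin d, 1)) :=
      tendsto_finsetProd _ fun i _ => hasSum_cardinalSpline_sub hm (t i)
    have h2 := ((h1.const_sub 1).smul_const (f x)).norm
    simpa using h2
  -- The interpolation formula holds for every finite set containing the relevant nodes, so Q may be
  -- enlarged, depending on x, until the partition of unity is almost complete.
  obtain ⟨Q, hQ, hQ'⟩ := ((hlim.eventually (gt_mem_nhds hε)).and (eventually_ge_atTop Q₀)).exists
  have hP : ∀ p ∉ Fintype.piFinset fun _ : Fin d => Q, f (fun i => p i / 2 ^ N) = 0 :=
    fun p hp => by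
      by_contra h
      exact hp (Fintype.mem_piFinset.2 fun i => hQ' (hQ₀ p h i))
  have h0 : ∏ i, ∑ n ∈ Q, cardinalSpline (2 * m) (t i - n) =
      ∑ p ∈ Fintype.piFinset fun _ : Fin d => Q, Λ p :=
    Finset.prod_univ_sum (fun _ : Fin d => Q) fun i n => cardinalSpline (2 * m) (t i - n)
  have h1 : f x - partialSum m N f x =
      (1 - ∏ i, ∑ n ∈ Q, cardinalSpline (2 * m) (t i - n)) • f x +
      ∑ p ∈ Fintype.piFinset fun _ : Fin d => Q, Λ p • (f x - f (fun i => p i / 2 ^ N)) := by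
    rw [partialSum_eq hm hN hP, h0, sub_smul, one_smul, Finset.sum_smul]
    simp only [smul_sub, Finset.sum_sub_distrib]
    abel
  have h2 : ∀ p : Fin d → ℤ, ‖Λ p • (f x - f (fun i => p i / 2 ^ N))‖ ≤
      (∏ i, |cardinalSpline (2 * m) (t i - p i)|) * ε +
      2 * C * ∑ i₀, (∏ i, |cardinalSpline (2 * m) (t i - p i)|) *
        (if R ≤ |t i₀ - p i₀| then 1 else 0) := fun p => by
    rw [norm_smul, Real.norm_eq_abs, hΛ, Finset.abs_prod, ← Finset.mul_sum]
    have h3 := norm_sub_le_add_sum hε.le hδ hC hfc x fun i => p i / 2 ^ N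
    have h4 : ∑ i, (if δ ≤ |x i - p i / 2 ^ N| then (1 : ℝ) else 0) ≤
        ∑ i, (if R ≤ |t i - p i| then (1 : ℝ) else 0) := by
      refine Finset.sum_le_sum fun i _ => ?_
      by_cases h : δ ≤ |x i - p i / 2 ^ N|
      · rw [if_pos h, if_pos]
        -- Distance δ in x becomes distance 2^N δ ≥ R on the integer scale.
        have h5 : t i - p i = 2 ^ N * (x i - p i / 2 ^ N) := by
          rw [ht]; field_simp
        rw [h5, abs_mul, abs_of_pos (show (0 : ℝ) < 2 ^ N by positivity)]
        exact hRδ.trans (mul_le_mul_of_nonneg_left h (by positivity))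
      · rw [if_neg h]
        split_ifs <;> norm_num
    have h5 : 0 ≤ ∏ i, |cardinalSpline (2 * m) (t i - p i)| :=
      Finset.prod_nonneg fun _ _ => abs_nonneg _
    calc _ ≤ (∏ i, |cardinalSpline (2 * m) (t i - p i)|) *
          (ε + 2 * C * ∑ i, (if R ≤ |t i - p i| then (1 : ℝ) else 0)) := by
          refine mul_le_mul_of_nonneg_left (h3.trans ?_) h5
          gcongr
      _ = _ := by ring
  rw [h1, add_assoc]
  refine (norm_add_le _ _).trans (add_le_add hQ.le ?_)
  refine (norm_sum_le_of_le _ fun p _ => h2 p).trans ?_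
  rw [Finset.sum_add_distrib, ← Finset.sum_mul, ← Finset.mul_sum, Finset.sum_comm]
  refine add_le_add (mul_le_mul_of_nonneg_right
    (sum_prod_abs_cardinalSpline_le hA t Q) hε.le) ?_
  refine mul_le_mul_of_nonneg_left ?_ (by positivity)
  refine (Finset.sum_le_sum fun i₀ _ =>
    sum_prod_abs_cardinalSpline_tail_le hA1 hτ hA hR t Q i₀).trans_eq ?_
  simp

/-- The tensor Faber spline expansion of a compactly supported continuous function converges
uniformly. -/
theorem tendstoUniformly_partialSum [NormedSpace ℝ E] {m : ℕ} (hm : 1 ≤ m)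
    {f : (Fin d → ℝ) → E} (hf : Continuous f) (hsupp : HasCompactSupport f) :
    TendstoUniformly (fun N : ℕ => partialSum m N f) f atTop := by
  rw [Metric.tendstoUniformly_iff]
  intro ε hε
  obtain ⟨A, hA1, hA⟩ := exists_sum_abs_cardinalSpline_sub_le hm
  obtain ⟨C, hC⟩ := hf.bounded_above_of_compact_support hsupp
  have hC0 : 0 ≤ C := (norm_nonneg _).trans (hC 0)
  have hA0 : 0 < A := by linarith
  -- ε₁ and τ are chosen so that the truncation and near terms together give ε/4 and the far term at
  -- most ε/4; the summand 1 in τ avoids division by zero.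
  set ε₁ : ℝ := ε / (4 * (1 + A ^ d)) with hε₁
  have hε₁0 : 0 < ε₁ := by positivity
  set τ : ℝ := ε / (4 * (2 * C * (d * A ^ d) + 1)) with hτ
  have hτ0 : 0 < τ := by positivity
  obtain ⟨δ, hδ, hfδ⟩ := Metric.uniformContinuous_iff.1
    (hsupp.uniformContinuous_of_continuous hf) ε₁ hε₁0
  obtain ⟨R, hR⟩ := exists_tail_cardinalSpline_sub_le hm hτ0
  have h1 : Tendsto (fun N : ℕ => (2 : ℝ) ^ N * δ) atTop atTop :=
    (tendsto_pow_atTop_atTop_of_one_lt one_lt_two).atTop_mul_const hδ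
  filter_upwards [h1.eventually_ge_atTop R, eventually_ge_atTop 2] with N hN hN2 x
  rw [dist_eq_norm]
  refine (norm_sub_partialSum_le hm hN2 hsupp hA1 hτ0.le hA hR hε₁0 hδ hC
    (fun x y h => hfδ h) hN x).trans_lt ?_
  have h2 : ε₁ + A ^ d * ε₁ = ε / 4 := by
    rw [hε₁]; field_simp
  have h3 : 2 * C * (d * (A ^ d * τ)) ≤ ε / 4 := by
    have h4 : (2 * C * (d * A ^ d) + 1) * τ = ε / 4 := by
      rw [hτ]; field_simp
    nlinarith
  linarith

end convergence

end FaberSpline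

theorem mainTheorem8 {𝕜 : Type*} [RCLike 𝕜] (d m : ℕ) (hm : 1 ≤ m)
    (f : (Fin d → ℝ) → 𝕜) (hf : Continuous f) (hsupp : HasCompactSupport f) :
    TendstoUniformly (fun N : ℕ => FaberSpline.partialSum m N f) f atTop :=
  FaberSpline.tendstoUniformly_partialSum hm hf hsupp
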